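/- **Setting.** Let $n\ge 1$. Let $\mathcal P_0$ be the set of measurable $p(\cdot):\mathbb R^n\to(0,\infty)$ with $p_+=\operatorname{ess\,sup}p<\infty$, and let $p_-=\operatorname{ess\,inf}p$. For $p(\cdot)\in\mathcal P_0$ and measurable $g$ put $$\|g\|_{p(\cdot)}=\inf\Big\{\lambda>0:\int_{\mathbb R^n}\big(|g(x)|/\lambda\big)^{p(x)}\,dx\le 1\Big\}\in[0,\infty].$$ Let $Mf(x)=\sup_{Q\ni x}|Q|^{-1}\int_Q|f|$ (supremum over cubes with sides parallel to the axes). Write $p(\cdot)\in M\mathcal P_0$ if $p(\cdot)\in\mathcal P_0$, $p_->0$ and there is $p_0$ with $0<p_0<p_-$ such that $M$ is bounded on $L^{p(\cdot)/p_0}$, i.e. $\|Mf\|_{p(\cdot)/p_0}\le C\|f\|_{p(\cdot)/p_0}$ for all $f\in L^{p(\cdot)/p_0}$. For $\Phi\in\mathcal S(\mathbb R^n)$, $t>0$ put $\Phi_t(x)=t^{-n}\Phi(x/t)$. For an integer $N>0$ let $\mathcal S_N$ be the set of $\Phi\in\mathcal S$ with $\sup_x|x^\alpha D^\beta\Phi(x)|\le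 1$ for all multi-indices $|\alpha|,|\beta|\le N$, and for $f\in\mathcal S'$ let $\mathcal M_Nf(x)=\sup_{\Phi\in\mathcal S_N}\sup_{t>0}|f*\Phi_t(x)|$. For $p(\cdot)\in M\mathcal P_0$, with $p_0$ as above and $N>n/p_0+n+1$, let $H^{p(\cdot)}$ be the set of $f\in\mathcal S'$ with $\|f\|_{H^{p(\cdot)}}:=\|\mathcal M_Nf\|_{p(\cdot)}<\infty$. A distribution $f\in\mathcal S'$ is *bounded* if $f*\Phi\in L^\infty$ for every $\Phi\in\mathcal S$. For such $f$ and $h\in L^1$, the distribution $f*h$ is defined by $\langle f*h,\varphi\rangle=\int (f*\tilde\varphi)(x)\,h(-x)\,dx$, where $\tilde\varphi(x)=\varphi(-x)$. Let $P(x)=\Gamma(\frac{n+1}2)\pi^{-\frac{n+1}2}(1+|x|^2)^{-\frac{n+1}2}$ be the Poisson kernel and $P_t(x)=t^{-n}P(x/t)$. A tempered distribution belongs to $L^1_{loc}$ if it is given by integration against a locally integrable function on all test functions in $C_c^\infty(\mathbb R^n)$. **Proposition 4.2.** Let $p(\cdot)\in M\mathcal P_0$, let $p_0$ be as in the definition of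 $M\mathcal P_0$, and let $N>n/p_0+n+1$. Then $H^{p(\cdot)}\cap L^1_{loc}$ is dense in $H^{p(\cdot)}$: for every $f\in H^{p(\cdot)}$ and $\varepsilon>0$ there is $g\in H^{p(\cdot)}\cap L^1_{loc}$ with $\|f-g\|_{H^{p(\cdot)}}<\varepsilon$. Concretely, every $f\in H^{p(\cdot)}$ is a bounded distribution, for every $t>0$ the convolution $f*P_t$ is a tempered distribution belonging to $H^{p(\cdot)}\cap L^1_{loc}$, and $\|f*P_t-f\|_{H^{p(\cdot)}}\to 0$ as $t\to0^+$. -/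

import Mathlib

open MeasureTheory Filter Topology Set
open scoped ENNReal NNReal SchwartzMap

namespace VarHardy

noncomputable section

/-- The Euclidean space `ℝⁿ`. -/
abbrev Rn (n : ℕ) : Type := EuclideanSpace ℝ (Fin n)

/-! ### Variable exponents and variable Lebesgue spaces -/

/-- `p₋ = ess inf p`, with values in `[0,∞]`. -/
def pMinus {n : ℕ} (p : Rn n → ℝ) : ℝ≥0∞ := essInf (fun x => ENNReal.ofReal (p x)) volume

/-- `p₊ = ess sup p`, with values in `[0,∞]`. -/
def pPlus {n : ℕ} (p : Rn n → ℝ) : ℝ≥0∞ := essSup (fun x => ENNReal.ofReal (p x)) volume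

/-- The class `𝒫₀` of (Lebesgue) measurable exponents `p : ℝⁿ → (0,∞)` with `p₊ < ∞`. -/
structure MemP0 {n : ℕ} (p : Rn n → ℝ) : Prop where
  aemeasurable : AEMeasurable p volume
  pos : ∀ x, 0 < p x
  pPlus_lt_top : pPlus p < ∞

/-- The modular `ρ(g) = ∫ g(x)^{p(x)} dx` of a `[0,∞]`-valued function `g` (the absolute value of
a function, or a maximal function). -/
def modular {n : ℕ} (p : Rn n → ℝ) (g : Rn n → ℝ≥0∞) : ℝ≥0∞ := ∫⁻ x, g x ^ p x

/-- The Luxemburg (quasi-)norm `‖g‖_{p(·)} = inf {lam > 0 : ρ(g / lam) ≤ 1}`; it is `∞` when there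
is no such `lam`. -/
def luxNorm {n : ℕ} (p : Rn n → ℝ) (g : Rn n → ℝ≥0∞) : ℝ≥0∞ :=
  ⨅ (lam : ℝ) (_ : 0 < lam) (_ : modular p (fun x => g x / ENNReal.ofReal lam) ≤ 1),
    ENNReal.ofReal lam

/-! ### The Hardy–Littlewood maximal operator and the class `M𝒫₀` -/

/-- The cube with centre `c`, side length `2 r` and sides parallel to the coordinate axes. -/
def cube {n : ℕ} (c : Rn n) (r : ℝ) : Set (Rn n) := {y | ∀ i, |y i - c i| ≤ r}

/-- The (uncentred) Hardy–Littlewood maximal function: the supremum of the averages of `|f|` over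
all cubes containing `x`. -/
def maximal {n : ℕ} (f : Rn n → ℝ) (x : Rn n) : ℝ≥0∞ :=
  ⨆ (c : Rn n) (r : ℝ) (_ : 0 < r) (_ : x ∈ cube c r),
    (∫⁻ y in cube c r, ‖f y‖ₑ) / volume (cube c r)

/-- `p₀` is an index as required in the definition of `M𝒫₀`: `0 < p₀ < p₋`, and the maximal
operator is bounded on `L^{p(·)/p₀}`. -/
structure IsMP0Index {n : ℕ} (p : Rn n → ℝ) (p₀ : ℝ) : Prop where
  pos : 0 < p₀
  lt_pMinus : ENNReal.ofReal p₀ < pMinus p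
  bounded : ∃ C : ℝ≥0, ∀ f : Rn n → ℝ, AEMeasurable f volume →
    luxNorm (fun x => p x / p₀) (fun x => ‖f x‖ₑ) < ∞ →
    luxNorm (fun x => p x / p₀) (maximal f) ≤
      C * luxNorm (fun x => p x / p₀) (fun x => ‖f x‖ₑ)

/-- The class `M𝒫₀`. -/
structure MemMP0 {n : ℕ} (p : Rn n → ℝ) : Prop where
  memP0 : MemP0 p
  pMinus_pos : 0 < pMinus p
  exists_index : ∃ p₀, IsMP0Index p p₀

/-! ### Convolution of a tempered distribution with a Schwartz function -/

/-- The reflection `φ̃(x) = φ(-x)`. -/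
def reflect {n : ℕ} (φ : 𝓢(Rn n, ℂ)) : 𝓢(Rn n, ℂ) :=
  SchwartzMap.compCLMOfContinuousLinearEquiv ℂ (ContinuousLinearEquiv.neg ℝ) φ

/-- `Φ_t(x) = t⁻ⁿ Φ(x / t)`. -/
def dilate {n : ℕ} (Φ : 𝓢(Rn n, ℂ)) (t : ℝ) (ht : 0 < t) : 𝓢(Rn n, ℂ) :=
  ((t : ℂ) ^ n)⁻¹ • SchwartzMap.compCLMOfContinuousLinearEquiv ℂ
    (ContinuousLinearEquiv.smulLeft (Units.mk0 t⁻¹ (inv_ne_zero ht.ne'))) Φ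

/-- `(f * Φ)(x) = ⟨f, Φ(x - ·)⟩`; here `Φ(x - y) = φ̃(y - x)` with `φ̃` the reflection of `Φ`. -/
def conv {n : ℕ} (f : 𝓢'(Rn n, ℂ)) (Φ : 𝓢(Rn n, ℂ)) (x : Rn n) : ℂ :=
  f ((reflect Φ).compSubConstCLM ℂ x)

theorem reflect_apply {n : ℕ} (φ : 𝓢(Rn n, ℂ)) (x : Rn n) : reflect φ x = φ (-x) := rfl

theorem dilate_apply {n : ℕ} (Φ : 𝓢(Rn n, ℂ)) (t : ℝ) (ht : 0 < t) (x : Rn n) :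
    dilate Φ t ht x = ((t : ℂ) ^ n)⁻¹ * Φ (t⁻¹ • x) := rfl

/-! ### The grand maximal operator and the variable Hardy space -/

/-- The class `𝒮_N` of the Schwartz functions `Φ` with `sup_x |x^α D^β Φ(x)| ≤ 1` for all
multi-indices `|α|, |β| ≤ N`.  The derivatives `D^β` of order `k` are written as
`∂_{i₁} ⋯ ∂_{i_k}`, where `i₁, …, i_k` runs over the finite sequences of coordinates. -/
def testClass (n N : ℕ) : Set 𝓢(Rn n, ℂ) :=
  {Φ | ∀ α : Fin n → ℕ, ∑ i, α i ≤ N → ∀ k ≤ N, ∀ idx : Fin k → Fin n, ∀ x : Rn n,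
    ‖(∏ i, (x i : ℂ) ^ α i) *
      iteratedFDeriv ℝ k Φ x (fun j => EuclideanSpace.single (idx j) (1 : ℝ))‖ ≤ 1}

/-- The radial maximal function `M_{Φ,0} f(x) = sup_{t>0} |f * Φ_t(x)|`. -/
def radialMaximal {n : ℕ} (Φ : 𝓢(Rn n, ℂ)) (f : 𝓢'(Rn n, ℂ)) (x : Rn n) : ℝ≥0∞ :=
  ⨆ (t : ℝ) (ht : 0 < t), ‖conv f (dilate Φ t ht) x‖ₑ

/-- The grand maximal function `ℳ_N f = sup_{Φ ∈ 𝒮_N} M_{Φ,0} f`. -/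
def grandMaximal {n : ℕ} (N : ℕ) (f : 𝓢'(Rn n, ℂ)) (x : Rn n) : ℝ≥0∞ :=
  ⨆ Φ ∈ testClass n N, radialMaximal Φ f x

/-- `‖f‖_{H^{p(·)}} = ‖ℳ_N f‖_{p(·)}`. -/
def hpNorm {n : ℕ} (p : Rn n → ℝ) (N : ℕ) (f : 𝓢'(Rn n, ℂ)) : ℝ≥0∞ :=
  luxNorm p (grandMaximal N f)

/-- The variable Hardy space `H^{p(·)}`, defined through `ℳ_N`. -/
def Hp {n : ℕ} (p : Rn n → ℝ) (N : ℕ) : Set 𝓢'(Rn n, ℂ) := {f | hpNorm p N f < ∞}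

/-- The tempered distributions given by a locally integrable function `v`, in the sense
`⟨f, φ⟩ = ∫ v φ` for all test functions `φ ∈ C_c^∞`. -/
def L1loc (n : ℕ) : Set 𝓢'(Rn n, ℂ) :=
  {f | ∃ v : Rn n → ℂ, LocallyIntegrable v volume ∧
    ∀ φ : 𝓢(Rn n, ℂ), HasCompactSupport φ → f φ = ∫ x, v x * φ x}

/-! ### Bounded distributions and convolution with the Poisson kernel -/

/-- A tempered distribution `f` is bounded if `f * Φ ∈ L^∞` for all `Φ ∈ 𝒮` (the function `f * Φ`
is continuous, so that its essential supremum is its supremum). -/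
def IsBoundedDistribution {n : ℕ} (f : 𝓢'(Rn n, ℂ)) : Prop :=
  ∀ Φ : 𝓢(Rn n, ℂ), ∃ C : ℝ, ∀ x, ‖conv f Φ x‖ ≤ C

/-- `g = f * h`, for a bounded distribution `f` and `h ∈ L¹`: by definition this is the
distribution `⟨f * h, φ⟩ = ∫ (f * φ̃)(x) h(-x) dx`.  It determines `g`. -/
structure IsConvL1 {n : ℕ} (f : 𝓢'(Rn n, ℂ)) (h : Rn n → ℝ) (g : 𝓢'(Rn n, ℂ)) : Prop where
  bounded : IsBoundedDistribution f
  integrable : Integrable h volume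
  apply_eq : ∀ φ : 𝓢(Rn n, ℂ), g φ = ∫ x, conv f (reflect φ) x * (h (-x) : ℂ)

/-- The Poisson kernel `P(x) = Γ((n+1)/2) π^{-(n+1)/2} (1 + |x|²)^{-(n+1)/2}`. -/
def poisson {n : ℕ} (x : Rn n) : ℝ :=
  Real.Gamma (((n : ℝ) + 1) / 2) / Real.pi ^ (((n : ℝ) + 1) / 2) *
    (1 / (1 + ‖x‖ ^ 2) ^ (((n : ℝ) + 1) / 2))

/-- `P_t(x) = t⁻ⁿ P(x / t)`. -/
def poissonT {n : ℕ} (t : ℝ) (x : Rn n) : ℝ := (t ^ n)⁻¹ * poisson (t⁻¹ • x)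

end

end VarHardy

open MeasureTheory Filter Topology Set
open scoped ENNReal NNReal SchwartzMap

namespace VarHardy

noncomputable section

open LineDeriv

/-! ### Translations of Schwartz functions -/

/-! The quasi-norm of H^{p(·)} involves all test functions in 𝒮_N; the proof first replaces it by
one involving Gaussians only. Let U(θ, z) = (f * h_θ)(z), with h_θ(x) = (πθ)^{-n/2} exp(-|x|²/θ), be
the caloric extension of f, and let `ntMax f` be the supremum of |U| over the parabolic cone |z -
x|² < θ. Up to a constant, `ntMax f` lies below the grand maximal function
(`ntMax_le_grandMaximal`).

The converse in norm is `exists_hpNorm_le_luxNorm_ntMax`. Averaging over a ball of radius √θ bounds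
|U(θ, x - y)|^{p₀} by M((ntMax f)^{p₀})(x) (1 + |y|/√θ)^n up to a constant. To recover f * Φ_s from
U, follow r ↦ f * h_r * Φ_s down to r = 0. Each derivative in r moves a Laplacian onto Φ_s, and a
Taylor expansion of high enough order absorbs the singularity r^{-n/(2p₀)} left by the polynomial
growth in y. Thus the grand maximal function is pointwise at most a constant times M((ntMax
f)^{p₀})^{1/p₀}, and boundedness of M on L^{p(·)/p₀} finishes the comparison.

The Poisson kernel P_t is the average of h_{t²/η} when η has the Gamma(1/2, 1) law
(`integral_heatK_subord`). Hence the caloric extension of f * P_t at time θ is an average of U at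
the later times θ + t²/η. Later times stay in the cone, so `ntMax` does not increase, and f * P_t
lies in H^{p(·)}. Integrating the bound |U(θ, ·)| ≲ 1 + θ^{-n/(2p₀)} against the law of η shows that
f * P_t is a continuous function.

For the convergence, `ntMax (f * P_t - f)` is at most 2 `ntMax f`, whose p(·)-modular is finite at
every scale because p₊ < ∞. By dominated convergence it is enough that it tends to 0 almost
everywhere. This follows from Fatou's theorem for the heat equation (`ae_exists_caloric_limit`): U
has parabolic limits at almost every point where `ntMax f` is finite. Its proof works over a compact
set E on which `ntMax f` ≤ λ. There U is compared with the heat extension of a weak limit of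
truncations of U(ε, ·). The maximum principle bounds the difference by a multiple of the heat
extension of the indicator of the complement of E, and the latter vanishes in the limit at almost
every point of E. -/

/-- The translate `x ↦ Φ (x - a)` of a Schwartz function. -/
abbrev translate {n : ℕ} (a : Rn n) (Φ : 𝓢(Rn n, ℂ)) : 𝓢(Rn n, ℂ) := Φ.compSubConstCLM ℂ a

theorem translate_coe {n : ℕ} (a : Rn n) (Φ : 𝓢(Rn n, ℂ)) :
    ⇑(translate a Φ) = fun x => Φ (x - a) := rfl

theorem iteratedFDeriv_translate {n : ℕ} (a : Rn n) (Φ : 𝓢(Rn n, ℂ)) (l : ℕ) (x : Rn n) :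
    iteratedFDeriv ℝ l (translate a Φ) x = iteratedFDeriv ℝ l Φ (x - a) := by
  rw [translate_coe]; exact iteratedFDeriv_comp_sub l a x

/-- A bound for all the weighted derivatives of order at most `l` with weight at most `k`. -/
def weightedBound {n : ℕ} (k l : ℕ) (Φ : 𝓢(Rn n, ℂ)) : ℝ :=
  2 ^ k * ((Finset.Iic (k, l)).sup fun m => SchwartzMap.seminorm ℂ m.1 m.2) Φ

theorem weightedBound_nonneg {n : ℕ} (k l : ℕ) (Φ : 𝓢(Rn n, ℂ)) : 0 ≤ weightedBound k l Φ := by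
  unfold weightedBound; positivity

theorem le_weightedBound {n : ℕ} {k l j : ℕ} (hj : j ≤ l) (Φ : 𝓢(Rn n, ℂ)) (x : Rn n) :
    (1 + ‖x‖) ^ k * ‖iteratedFDeriv ℝ j Φ x‖ ≤ weightedBound k l Φ :=
  SchwartzMap.one_add_le_sup_seminorm_apply (𝕜 := ℂ) (m := (k, l)) le_rfl hj Φ x

theorem one_add_norm_pow_le {n : ℕ} (k : ℕ) (x a : Rn n) :
    (1 + ‖x‖) ^ k ≤ (1 + ‖x - a‖) ^ k * (1 + ‖a‖) ^ k := by
  rw [← mul_pow]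
  gcongr
  have : ‖x‖ ≤ ‖x - a‖ + ‖a‖ := by simpa using norm_add_le (x - a) a
  nlinarith [norm_nonneg (x - a), norm_nonneg a]

theorem weighted_iteratedFDeriv_translate_le {n : ℕ} {k l j : ℕ} (hj : j ≤ l) (Φ : 𝓢(Rn n, ℂ))
    (a x : Rn n) :
    (1 + ‖x‖) ^ k * ‖iteratedFDeriv ℝ j (translate a Φ) x‖ ≤
      weightedBound k l Φ * (1 + ‖a‖) ^ k := by
  rw [iteratedFDeriv_translate]
  calc _ ≤ ((1 + ‖x - a‖) ^ k * (1 + ‖a‖) ^ k) * ‖iteratedFDeriv ℝ j Φ (x - a)‖ := by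
        gcongr; exact one_add_norm_pow_le k x a
    _ = ((1 + ‖x - a‖) ^ k * ‖iteratedFDeriv ℝ j Φ (x - a)‖) * (1 + ‖a‖) ^ k := by ring
    _ ≤ _ := by gcongr; exact le_weightedBound hj Φ _

/-- Polynomial growth in the translation vector is what makes a Schwartz superposition of translates
converge absolutely in every seminorm. -/
theorem seminorm_translate_le {n : ℕ} (k l : ℕ) (Φ : 𝓢(Rn n, ℂ)) (a : Rn n) :
    SchwartzMap.seminorm ℂ k l (translate a Φ) ≤ weightedBound k l Φ * (1 + ‖a‖) ^ k := by
  refine SchwartzMap.seminorm_le_bound ℂ k l _ (by have := weightedBound_nonneg k l Φ; positivity)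
    fun x => ?_
  refine le_trans ?_ (weighted_iteratedFDeriv_translate_le le_rfl Φ a x)
  gcongr; linarith

/-- Mean value inequality on the unit ball around x. The weight 1 + |x| changes there by a factor of
at most 2, hence the 2^k; one extra derivative is spent. -/
theorem norm_iteratedFDeriv_sub_translate_le {n : ℕ} (k l : ℕ) (Φ : 𝓢(Rn n, ℂ)) {a : Rn n}
    (ha : ‖a‖ ≤ 1) :
    SchwartzMap.seminorm ℂ k l (translate a Φ - Φ) ≤ weightedBound k (l + 1) Φ * 2 ^ k * ‖a‖ := by
  refine SchwartzMap.seminorm_le_bound ℂ k l _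
    (by have := weightedBound_nonneg k (l + 1) Φ; positivity) fun x => ?_
  have h1 : iteratedFDeriv ℝ l (⇑(translate a Φ - Φ)) x =
      iteratedFDeriv ℝ l Φ (x - a) - iteratedFDeriv ℝ l Φ x := by
    have : ⇑(translate a Φ - Φ) = ⇑(translate a Φ) - ⇑Φ := rfl
    rw [this, iteratedFDeriv_sub_apply ((translate a Φ).smooth l).contDiffAt
      (Φ.smooth l).contDiffAt, iteratedFDeriv_translate]
  rw [h1]
  have hd : Differentiable ℝ (iteratedFDeriv ℝ l Φ) :=
    (Φ.smooth ⊤).differentiable_iteratedFDeriv (by exact_mod_cast WithTop.coe_lt_top _)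
  have h2 : ‖iteratedFDeriv ℝ l Φ (x - a) - iteratedFDeriv ℝ l Φ x‖ ≤
      (weightedBound k (l + 1) Φ * 2 ^ k / (1 + ‖x‖) ^ k) * ‖(x - a) - x‖ := by
    refine Convex.norm_image_sub_le_of_norm_fderiv_le (𝕜 := ℝ)
      (s := Metric.closedBall x 1) (fun y _ => hd y) (fun y hy => ?_)
      (convex_closedBall x 1) (by simp) (by simpa [dist_eq_norm] using ha)
    rw [norm_fderiv_iteratedFDeriv, le_div_iff₀ (by positivity)]
    have hxy : ‖x - y‖ ≤ 1 := by simpa [dist_eq_norm, norm_sub_rev] using hy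
    calc _ ≤ ‖iteratedFDeriv ℝ (l + 1) Φ y‖ * ((1 + ‖y‖) ^ k * 2 ^ k) := by
          gcongr
          rw [← mul_pow]
          gcongr
          have : ‖x‖ ≤ ‖x - y‖ + ‖y‖ := by simpa using norm_add_le (x - y) y
          linarith [norm_nonneg y]
      _ = ((1 + ‖y‖) ^ k * ‖iteratedFDeriv ℝ (l + 1) Φ y‖) * 2 ^ k := by ring
      _ ≤ _ := by gcongr; exact le_weightedBound le_rfl Φ y
  have h3 : ‖x - a - x‖ = ‖a‖ := by simp
  rw [h3] at h2
  calc _ ≤ (1 + ‖x‖) ^ k * ((weightedBound k (l + 1) Φ * 2 ^ k / (1 + ‖x‖) ^ k) * ‖a‖) := by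
        gcongr; linarith
    _ = _ := by field_simp

/-- Translations form a group, so continuity at a = 0 for every Schwartz function suffices. -/
theorem continuous_translate {n : ℕ} (Φ : 𝓢(Rn n, ℂ)) : Continuous fun a => translate a Φ := by
  have key : ∀ Ψ : 𝓢(Rn n, ℂ), Tendsto (fun a => translate a Ψ) (𝓝 0) (𝓝 Ψ) := by
    intro Ψ
    rw [(schwartz_withSeminorms ℂ (Rn n) ℂ).tendsto_nhds]
    rintro ⟨k, l⟩ ε hε
    have h0 : Tendsto (fun a : Rn n => weightedBound k (l + 1) Ψ * 2 ^ k * ‖a‖) (𝓝 0) (𝓝 0) := by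
      have : Continuous (fun a : Rn n => weightedBound k (l + 1) Ψ * 2 ^ k * ‖a‖) := by fun_prop
      simpa using this.tendsto 0
    filter_upwards [h0.eventually (gt_mem_nhds hε), Metric.closedBall_mem_nhds (0 : Rn n) one_pos]
      with a h1 h2
    exact (norm_iteratedFDeriv_sub_translate_le k l Ψ (by simpa using h2)).trans_lt h1
  rw [continuous_iff_continuousAt]
  intro a
  have h1 : Tendsto (fun b : Rn n => b - a) (𝓝 a) (𝓝 0) := by
    have : Continuous fun b : Rn n => b - a := by fun_prop
    simpa using this.tendsto a
  have h2 := (key (translate a Φ)).comp h1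
  refine h2.congr fun b => ?_
  simp only [Function.comp, translate, SchwartzMap.compSubConstCLM_comp, add_sub_cancel]

/-! ### Exchange of a continuous functional with an integral of Schwartz functions -/

/-- The space of `l`-linear forms on `ℝⁿ`, with its operator norm. -/
def Forms (n l : ℕ) : Type := ContinuousMultilinearMap ℝ (fun _ : Fin l => Rn n) ℂ

instance (n l : ℕ) : NormedAddCommGroup (Forms n l) :=
  inferInstanceAs (NormedAddCommGroup (ContinuousMultilinearMap ℝ (fun _ : Fin l => Rn n) ℂ))

instance (n l : ℕ) : NormedSpace ℂ (Forms n l) :=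
  inferInstanceAs (NormedSpace ℂ (ContinuousMultilinearMap ℝ (fun _ : Fin l => Rn n) ℂ))

instance (n l : ℕ) : CompleteSpace (Forms n l) :=
  inferInstanceAs (CompleteSpace (ContinuousMultilinearMap ℝ (fun _ : Fin l => Rn n) ℂ))

/-- The iterated derivative as an element of `Forms`. -/
def iterForm {n : ℕ} (l : ℕ) (Φ : 𝓢(Rn n, ℂ)) (x : Rn n) : Forms n l := iteratedFDeriv ℝ l Φ x

theorem norm_iterForm {n : ℕ} (l : ℕ) (Φ : 𝓢(Rn n, ℂ)) (x : Rn n) :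
    ‖iterForm l Φ x‖ = ‖iteratedFDeriv ℝ l Φ x‖ := rfl

/-- Evaluation of a form at vectors. -/
def evalForm {n l : ℕ} (m : Fin l → Rn n) : Forms n l →L[ℂ] ℂ :=
  LinearMap.mkContinuous
    { toFun := fun A => (show ContinuousMultilinearMap ℝ (fun _ : Fin l => Rn n) ℂ from A) m
      map_add' := fun _ _ => rfl
      map_smul' := fun _ _ => rfl } (∏ i, ‖m i‖) fun A => by
    rw [mul_comm]
    exact ContinuousMultilinearMap.le_opNorm
      (show ContinuousMultilinearMap ℝ (fun _ : Fin l => Rn n) ℂ from A) m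

theorem evalForm_iterForm {n l : ℕ} (m : Fin l → Rn n) (Φ : 𝓢(Rn n, ℂ)) (x : Rn n) :
    evalForm m (iterForm l Φ x) = iteratedFDeriv ℝ l Φ x m := rfl

theorem Forms.ext {n l : ℕ} {A B : Forms n l} (h : ∀ m, evalForm m A = evalForm m B) : A = B :=
  ContinuousMultilinearMap.ext h

/-- The weighted derivative `x ↦ ‖x‖ ^ k • D^l Φ x` as a bounded continuous function. -/
def weightedDeriv {n : ℕ} (k l : ℕ) :
    𝓢(Rn n, ℂ) →L[ℂ] BoundedContinuousFunction (Rn n) (Forms n l) :=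
  SchwartzMap.mkCLMtoNormedSpace (σ := RingHom.id ℂ)
    (fun Φ => BoundedContinuousFunction.ofNormedAddCommGroup
      (fun x => ((‖x‖ ^ k : ℝ) : ℂ) • iterForm l Φ x)
      ((Complex.continuous_ofReal.comp (continuous_norm.pow k)).smul
        ((Φ.smooth ⊤).continuous_iteratedFDeriv (by exact_mod_cast le_top)))
      (SchwartzMap.seminorm ℂ k l Φ)
      (fun x => by
        rw [norm_smul, Complex.norm_real, norm_pow, norm_norm]
        exact SchwartzMap.le_seminorm ℂ k l Φ x))
    (fun f g => by
      ext1 x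
      have : iterForm l (f + g) x = iterForm l f x + iterForm l g x :=
        iteratedFDeriv_add_apply (f.smooth l).contDiffAt (g.smooth l).contDiffAt
      change ((‖x‖ ^ k : ℝ) : ℂ) • iterForm l (f + g) x =
        ((‖x‖ ^ k : ℝ) : ℂ) • iterForm l f x + ((‖x‖ ^ k : ℝ) : ℂ) • iterForm l g x
      rw [this, smul_add])
    (fun a f => by
      ext1 x
      have : iterForm l (a • f) x = a • iterForm l f x :=
        iteratedFDeriv_const_smul_apply (f.smooth l).contDiffAt
      change ((‖x‖ ^ k : ℝ) : ℂ) • iterForm l (a • f) x =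
        a • (((‖x‖ ^ k : ℝ) : ℂ) • iterForm l f x)
      rw [this, smul_comm])
    ⟨{(k, l)}, 1, zero_le_one, fun f => by
      rw [one_mul, Finset.sup_singleton]
      exact BoundedContinuousFunction.norm_ofNormedAddCommGroup_le _ (apply_nonneg _ _) _⟩

theorem weightedDeriv_apply {n : ℕ} (k l : ℕ) (Φ : 𝓢(Rn n, ℂ)) (x : Rn n) :
    weightedDeriv k l Φ x = ((‖x‖ ^ k : ℝ) : ℂ) • iterForm l Φ x := rfl

theorem norm_weightedDeriv_apply {n : ℕ} (k l : ℕ) (Φ : 𝓢(Rn n, ℂ)) (x : Rn n) :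
    ‖weightedDeriv k l Φ x‖ = ‖x‖ ^ k * ‖iteratedFDeriv ℝ l Φ x‖ := by
  rw [weightedDeriv_apply, norm_smul, Complex.norm_real, norm_pow, norm_norm, norm_iterForm]

theorem seminorm_le_norm_weightedDeriv {n : ℕ} (k l : ℕ) (Φ : 𝓢(Rn n, ℂ)) :
    SchwartzMap.seminorm ℂ k l Φ ≤ ‖weightedDeriv k l Φ‖ := by
  refine SchwartzMap.seminorm_le_bound ℂ k l _ (norm_nonneg _) fun x => ?_
  rw [← norm_weightedDeriv_apply]
  exact (weightedDeriv k l Φ).norm_coe_le_norm x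

theorem norm_weightedDeriv_le {n : ℕ} (k l : ℕ) (Φ : 𝓢(Rn n, ℂ)) :
    ‖weightedDeriv k l Φ‖ ≤ SchwartzMap.seminorm ℂ k l Φ := by
  refine (BoundedContinuousFunction.norm_le (apply_nonneg _ _)).2 fun x => ?_
  rw [norm_weightedDeriv_apply]
  exact SchwartzMap.le_seminorm ℂ k l Φ x

/-- A continuous functional on the Schwartz space factors through finitely many weighted
derivatives. -/
theorem exists_factor_weightedDeriv {n : ℕ} (f : 𝓢(Rn n, ℂ) →L[ℂ] ℂ) :
    ∃ (s : Finset (ℕ × ℕ))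
      (Λ : (∀ i : s, BoundedContinuousFunction (Rn n) (Forms n i.1.2)) →L[ℂ] ℂ),
      ∀ Φ, f Φ = Λ (fun i => weightedDeriv i.1.1 i.1.2 Φ) := by
  -- Continuity means domination by finitely many seminorms, and each seminorm is a sup norm of a
  -- weighted derivative.
  obtain ⟨s, C, -, hC⟩ := Seminorm.bound_of_continuous (schwartz_withSeminorms ℂ (Rn n) ℂ)
    ((normSeminorm ℂ ℂ).comp f.toLinearMap) (by
      change Continuous fun Φ => ‖f Φ‖
      fun_prop)
  let J : 𝓢(Rn n, ℂ) →ₗ[ℂ] (∀ i : s, BoundedContinuousFunction (Rn n) (Forms n i.1.2)) :=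
    LinearMap.pi fun i => (weightedDeriv i.1.1 i.1.2).toLinearMap
  have hb : ∀ Φ, ‖f Φ‖ ≤ C * ‖J Φ‖ := by
    intro Φ
    have h1 : ‖f Φ‖ ≤ C * (s.sup (schwartzSeminormFamily ℂ (Rn n) ℂ)) Φ := hC Φ
    refine h1.trans ?_
    gcongr
    refine Seminorm.finset_sup_apply_le (norm_nonneg _) fun i hi => ?_
    exact (seminorm_le_norm_weightedDeriv i.1 i.2 Φ).trans (norm_le_pi_norm (J Φ) ⟨i, hi⟩)
  have hker : LinearMap.ker J ≤ LinearMap.ker f.toLinearMap := by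
    intro Φ hΦ
    rw [LinearMap.mem_ker] at hΦ ⊢
    have := hb Φ
    rw [hΦ] at this
    simpa using this
  let g0 : LinearMap.range J →ₗ[ℂ] ℂ :=
    (Submodule.liftQ (LinearMap.ker J) f.toLinearMap hker) ∘ₗ
      J.quotKerEquivRange.symm.toLinearMap
  have hg0 : ∀ Φ, g0 ⟨J Φ, LinearMap.mem_range_self J Φ⟩ = f Φ := by
    intro Φ
    have : J.quotKerEquivRange.symm ⟨J Φ, LinearMap.mem_range_self J Φ⟩ =
        Submodule.Quotient.mk Φ := by
      rw [LinearEquiv.symm_apply_eq]; rfl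
    change Submodule.liftQ _ _ hker (J.quotKerEquivRange.symm _) = _
    rw [this]; rfl
  let g : LinearMap.range J →L[ℂ] ℂ := g0.mkContinuous C (by
    rintro ⟨_, Φ, rfl⟩
    rw [hg0]
    exact hb Φ)
  -- Hahn–Banach, from the range of the Schwartz space to the whole product of Banach spaces.
  obtain ⟨Λ, hΛ, -⟩ := exists_extension_norm_eq (LinearMap.range J) g
  refine ⟨s, Λ, fun Φ => ?_⟩
  have := hΛ ⟨J Φ, LinearMap.mem_range_self J Φ⟩
  rw [← hg0 Φ]
  exact this.symm

/-- A continuous functional on the Schwartz space commutes with absolutely convergent integrals. -/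
theorem apply_eq_integral {n : ℕ} (f : 𝓢(Rn n, ℂ) →L[ℂ] ℂ) (φ : Rn n → 𝓢(Rn n, ℂ))
    (Φ : 𝓢(Rn n, ℂ)) (hφ : Continuous φ)
    (hint : ∀ k l, ∃ b : Rn n → ℝ, Integrable b ∧ ∀ y, SchwartzMap.seminorm ℂ k l (φ y) ≤ b y)
    (heq : ∀ (l : ℕ) (m : Fin l → Rn n) (x : Rn n),
      iteratedFDeriv ℝ l Φ x m = ∫ y, iteratedFDeriv ℝ l (φ y) x m) :
    f Φ = ∫ y, f (φ y) := by
  -- The Schwartz space is not normed, so the Bochner integral is taken in the Banach product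
  -- through which f factors. Evaluating at x and at m identifies that integral with the weighted
  -- derivatives of Φ.
  obtain ⟨s, Λ, hΛ⟩ := exists_factor_weightedDeriv f
  have hi : ∀ k l, Integrable fun y => weightedDeriv k l (φ y) := by
    intro k l
    obtain ⟨b, hb, hle⟩ := hint k l
    exact hb.mono' ((weightedDeriv k l).continuous.comp hφ).aestronglyMeasurable
      (Eventually.of_forall fun y => (norm_weightedDeriv_le k l _).trans (hle y))
  have hI : Integrable fun y => (fun i : s => weightedDeriv i.1.1 i.1.2 (φ y)) :=
    Integrable.of_eval fun i => hi _ _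
  simp_rw [hΛ]
  rw [Λ.integral_comp_comm hI]
  congr 1
  funext i
  have h1 := (ContinuousLinearMap.proj (R := ℂ)
    (φ := fun i : s => BoundedContinuousFunction (Rn n) (Forms n i.1.2)) i).integral_comp_comm hI
  refine Eq.trans ?_ h1
  simp only [ContinuousLinearMap.proj_apply]
  ext1 x
  refine Forms.ext fun m => ?_
  have h2 := ((evalForm m).comp (BoundedContinuousFunction.evalCLM ℂ x)).integral_comp_comm
    (hi i.1.1 i.1.2)
  simp only [ContinuousLinearMap.comp_apply, BoundedContinuousFunction.evalCLM_apply] at h2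
  rw [← h2]
  simp only [weightedDeriv_apply, map_smul, evalForm_iterForm, heq, integral_smul]

/-! ### Convolution of Schwartz functions -/

/-- The convolution `(Φ ⋆ Ψ)(x) = ∫ Φ(y) Ψ(x - y) dy` of two Schwartz functions. -/
def sconv {n : ℕ} (Φ Ψ : 𝓢(Rn n, ℂ)) : 𝓢(Rn n, ℂ) :=
  SchwartzMap.convolution (ContinuousLinearMap.mul ℂ ℂ) Φ Ψ

theorem sconv_apply {n : ℕ} (Φ Ψ : 𝓢(Rn n, ℂ)) (x : Rn n) :
    sconv Φ Ψ x = ∫ y, Φ y * Ψ (x - y) := by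
  rw [sconv, SchwartzMap.convolution_apply, MeasureTheory.convolution_def]
  simp

theorem sconv_comm {n : ℕ} (Φ Ψ : 𝓢(Rn n, ℂ)) : sconv Φ Ψ = sconv Ψ Φ := by
  have h : (ContinuousLinearMap.mul ℂ ℂ).flip = ContinuousLinearMap.mul ℂ ℂ := by
    ext; simp
  rw [sconv, sconv, ← SchwartzMap.convolution_flip, h]

/-- On the Fourier side convolution is a product and the derivative is a multiplier, which may be
attached to either factor. -/
theorem lineDerivOp_sconv {n : ℕ} (Φ Ψ : 𝓢(Rn n, ℂ)) (m : Rn n) :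
    ∂_{m} (sconv Φ Ψ) = sconv Φ (∂_{m} Ψ) := by
  apply (FourierTransform.fourierCLE ℂ 𝓢(Rn n, ℂ)).injective
  simp only [FourierTransform.fourierCLE_apply, sconv]
  rw [SchwartzMap.fourier_lineDerivOp_eq, SchwartzMap.fourier_convolution,
    SchwartzMap.fourier_convolution, SchwartzMap.fourier_lineDerivOp_eq]
  ext x
  have hg : (fun x : Rn n => (inner ℝ x m : ℝ)).HasTemperateGrowth := by fun_prop
  simp only [smul_apply, SchwartzMap.pairing_apply_apply,
    SchwartzMap.smulLeftCLM_apply_apply hg, ContinuousLinearMap.mul_apply', smul_eq_mul,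
    Complex.real_smul]
  ring

theorem iteratedLineDerivOp_sconv {n l : ℕ} (m : Fin l → Rn n) (Φ Ψ : 𝓢(Rn n, ℂ)) :
    ∂^{m} (sconv Φ Ψ) = sconv Φ (∂^{m} Ψ) := by
  induction l with
  | zero => simp [LineDeriv.iteratedLineDerivOp_fin_zero]
  | succ l ih =>
    rw [LineDeriv.iteratedLineDerivOp_succ_left, LineDeriv.iteratedLineDerivOp_succ_left, ih,
      lineDerivOp_sconv]

theorem laplacian_sconv {n : ℕ} (Φ Ψ : 𝓢(Rn n, ℂ)) :
    Laplacian.laplacian (sconv Φ Ψ) = sconv Φ (Laplacian.laplacian Ψ) := by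
  rw [SchwartzMap.laplacian_eq_sum (EuclideanSpace.basisFun (Fin n) ℝ),
    SchwartzMap.laplacian_eq_sum (EuclideanSpace.basisFun (Fin n) ℝ)]
  simp only [lineDerivOp_sconv]
  simp [sconv]

/-- This passes the Laplacian from the heat kernel to the test function. -/
theorem laplacian_sconv_left {n : ℕ} (Φ Ψ : 𝓢(Rn n, ℂ)) :
    sconv (Laplacian.laplacian Φ) Ψ = sconv Φ (Laplacian.laplacian Ψ) := by
  rw [sconv_comm, ← laplacian_sconv, sconv_comm, laplacian_sconv]

/-- A convolution is a superposition of translates, and f may be taken inside it. Everything below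
about f * (Φ * Ψ) rests on this exchange. -/
theorem apply_sconv {n : ℕ} (f : 𝓢(Rn n, ℂ) →L[ℂ] ℂ) (Φ Ψ : 𝓢(Rn n, ℂ)) :
    f (sconv Φ Ψ) = ∫ y, Φ y * f (translate y Ψ) := by
  rw [apply_eq_integral f (fun y => Φ y • translate y Ψ) (sconv Φ Ψ)]
  · simp
  · exact Φ.continuous.smul (continuous_translate Ψ)
  · intro k l
    refine ⟨fun y => weightedBound k l Ψ * ((1 + ‖y‖) ^ k * ‖Φ y‖), ?_, fun y => ?_⟩
    · refine Integrable.const_mul ?_ _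
      have h0 := (Φ.integrable (μ := volume)).norm
      have hk := Φ.integrable_pow_mul volume k
      refine ((h0.add hk).const_mul (2 ^ k)).mono' ?_ (Eventually.of_forall fun y => ?_)
      · exact (((continuous_const.add continuous_norm).pow k).mul
          Φ.continuous.norm).aestronglyMeasurable
      · rw [Real.norm_of_nonneg (by positivity)]
        have : (1 + ‖y‖) ^ k ≤ 2 ^ k * (1 + ‖y‖ ^ k) := by
          have h := add_pow_le (zero_le_one) (norm_nonneg y) k
          rw [one_pow] at h
          refine h.trans ?_
          gcongr
          · norm_num
          · omega
        calc _ ≤ (2 ^ k * (1 + ‖y‖ ^ k)) * ‖Φ y‖ := by gcongr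
          _ = _ := by simp only [Pi.add_apply]; ring
    · rw [map_smul_eq_mul]
      calc _ ≤ ‖Φ y‖ * (weightedBound k l Ψ * (1 + ‖y‖) ^ k) := by
            gcongr; exact seminorm_translate_le k l Ψ y
        _ = _ := by ring
  · intro l m x
    rw [← SchwartzMap.iteratedLineDerivOp_eq_iteratedFDeriv, iteratedLineDerivOp_sconv,
      sconv_apply]
    congr 1
    funext y
    have : iteratedFDeriv ℝ l (⇑(Φ y • translate y Ψ)) x =
        Φ y • iteratedFDeriv ℝ l (translate y Ψ) x :=
      iteratedFDeriv_const_smul_apply ((translate y Ψ).smooth l).contDiffAt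
    rw [this, smul_apply, iteratedFDeriv_translate,
      SchwartzMap.iteratedLineDerivOp_eq_iteratedFDeriv, smul_eq_mul]

/-! ### Convolution of distributions with Schwartz functions -/

/-- The functional `Φ ↦ (f * Φ)(x)`. -/
def convCLM {n : ℕ} (f : 𝓢'(Rn n, ℂ)) (x : Rn n) : 𝓢(Rn n, ℂ) →L[ℂ] ℂ :=
  (show 𝓢(Rn n, ℂ) →L[ℂ] ℂ from f).comp
    ((SchwartzMap.compSubConstCLM ℂ x).comp
      (SchwartzMap.compCLMOfContinuousLinearEquiv ℂ (ContinuousLinearEquiv.neg ℝ)))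

theorem convCLM_apply {n : ℕ} (f : 𝓢'(Rn n, ℂ)) (x : Rn n) (Φ : 𝓢(Rn n, ℂ)) :
    convCLM f x Φ = conv f Φ x := rfl

theorem conv_translate {n : ℕ} (f : 𝓢'(Rn n, ℂ)) (Φ : 𝓢(Rn n, ℂ)) (a x : Rn n) :
    conv f (translate a Φ) x = conv f Φ (x - a) := by
  unfold conv
  congr 1
  ext y
  simp only [SchwartzMap.compSubConstCLM_apply, reflect_apply]
  congr 1
  abel

theorem conv_sconv {n : ℕ} (f : 𝓢'(Rn n, ℂ)) (Φ Ψ : 𝓢(Rn n, ℂ)) (x : Rn n) :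
    conv f (sconv Φ Ψ) x = ∫ y, Φ y * conv f Ψ (x - y) := by
  rw [← convCLM_apply, apply_sconv]
  simp only [convCLM_apply, conv_translate]

theorem continuous_conv {n : ℕ} (f : 𝓢'(Rn n, ℂ)) (Φ : 𝓢(Rn n, ℂ)) : Continuous (conv f Φ) := by
  have h := (convCLM f 0).continuous.comp (continuous_translate Φ)
  have h2 : conv f Φ = (⇑(convCLM f 0) ∘ fun a => translate a Φ) ∘ fun x => -x := by
    funext x
    simp [convCLM_apply, conv_translate]
  rw [h2]
  exact h.comp continuous_neg

/-! ### The Gaussian as a Schwartz function -/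

/-- From (1 + s)^m ≤ e^{ms} and ms - s² ≤ m². -/
theorem one_add_pow_mul_exp_le (m : ℕ) {s : ℝ} (hs : 0 ≤ s) :
    (1 + s) ^ m * Real.exp (-s ^ 2) ≤ Real.exp ((m : ℝ) ^ 2) := by
  have h1 : (1 + s) ^ m ≤ Real.exp (m * s) := by
    rw [Real.exp_nat_mul]
    gcongr
    linarith [Real.add_one_le_exp s]
  calc _ ≤ Real.exp (m * s) * Real.exp (-s ^ 2) := by gcongr
    _ = Real.exp (m * s + -s ^ 2) := (Real.exp_add _ _).symm
    _ ≤ _ := by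
      gcongr
      nlinarith [sq_nonneg ((m : ℝ) - s), sq_nonneg (m : ℝ)]

/-- The Gaussian `x ↦ exp (-|x|²)` as a real Schwartz function. -/
def gaussReal (n : ℕ) : 𝓢(Rn n, ℝ) where
  toFun x := Real.exp (-‖x‖ ^ 2)
  smooth' := by
    exact (contDiff_norm_sq ℝ).neg.exp
  decay' := by
    intro k l
    obtain ⟨m, C, hC, h⟩ :=
      (Function.hasTemperateGrowth_norm_sq (H := Rn n)).norm_iteratedFDeriv_le_uniform l
    refine ⟨(l.factorial : ℝ) * (1 + C) ^ l * Real.exp (((k + m * l : ℕ) : ℝ) ^ 2), fun x => ?_⟩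
    -- Faà di Bruno estimate for exp(-s) composed with |x|². The constant C is enlarged to 1 + C so
    -- that D ≥ 1 and D ≤ D^i for i ≥ 1.
    have hb := norm_iteratedFDeriv_comp_le (𝕜 := ℝ) (g := fun s : ℝ => Real.exp ((-1) * s))
      (f := fun x : Rn n => ‖x‖ ^ 2) (n := l) (N := ((⊤ : ℕ∞) : WithTop ℕ∞)) (by fun_prop)
      (contDiff_norm_sq ℝ)
      (by exact_mod_cast le_top) x
      (C := Real.exp (-‖x‖ ^ 2)) (D := (1 + C) * (1 + ‖x‖) ^ m)
      (fun i _ => by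
        rw [norm_iteratedFDeriv_eq_norm_iteratedDeriv, iteratedDeriv_exp_const_mul]
        simp)
      (fun i hi hil => by
        refine (h i hil x).trans ?_
        have h1 : (1 : ℝ) ≤ (1 + ‖x‖) ^ m := one_le_pow₀ (by linarith [norm_nonneg x])
        calc C * (1 + ‖x‖) ^ m ≤ (1 + C) * (1 + ‖x‖) ^ m := by gcongr; linarith
          _ ≤ _ := le_self_pow₀ (by nlinarith) (by omega))
    have hcomp : (fun x : Rn n => Real.exp (-‖x‖ ^ 2)) =
        (fun s : ℝ => Real.exp ((-1) * s)) ∘ fun x : Rn n => ‖x‖ ^ 2 := by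
      funext x; simp
    rw [hcomp]
    calc _ ≤ (1 + ‖x‖) ^ k * (l.factorial * Real.exp (-‖x‖ ^ 2) * ((1 + C) * (1 + ‖x‖) ^ m) ^ l) := by
          gcongr
          linarith
      _ = l.factorial * (1 + C) ^ l * ((1 + ‖x‖) ^ (k + m * l) * Real.exp (-‖x‖ ^ 2)) := by
          rw [mul_pow, pow_add, pow_mul]; ring
      _ ≤ _ := by
          gcongr
          exact one_add_pow_mul_exp_le _ (norm_nonneg x)

/-- The normalized Gaussian `π^{-n/2} exp (-|x|²)`. -/
def gauss (n : ℕ) : 𝓢(Rn n, ℂ) :=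
  ((Real.pi ^ (-(n : ℝ) / 2) : ℝ) : ℂ) • (gaussReal n).postcompCLM (𝕜 := ℝ) Complex.ofRealCLM

theorem gauss_apply {n : ℕ} (x : Rn n) :
    gauss n x = ((Real.pi ^ (-(n : ℝ) / 2) * Real.exp (-‖x‖ ^ 2) : ℝ) : ℂ) := by
  change ((Real.pi ^ (-(n : ℝ) / 2) : ℝ) : ℂ) * ((Real.exp (-‖x‖ ^ 2) : ℝ) : ℂ) = _
  push_cast; ring

/-- The heat kernel `(π θ)^{-n/2} exp (-|x|² / θ)`. -/
def heatK {n : ℕ} (θ : ℝ) (x : Rn n) : ℝ :=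
  (Real.pi * θ) ^ (-(n : ℝ) / 2) * Real.exp (-‖x‖ ^ 2 / θ)

/-- The heat kernel as a Schwartz function (and `0` for nonpositive times). -/
def heat (n : ℕ) (θ : ℝ) : 𝓢(Rn n, ℂ) :=
  if h : 0 < θ then dilate (gauss n) (√θ) (Real.sqrt_pos.2 h) else 0

theorem heat_of_pos {n : ℕ} {θ : ℝ} (h : 0 < θ) :
    heat n θ = dilate (gauss n) (√θ) (Real.sqrt_pos.2 h) := dif_pos h

theorem heat_apply {n : ℕ} {θ : ℝ} (h : 0 < θ) (x : Rn n) : heat n θ x = (heatK θ x : ℂ) := by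
  rw [heat_of_pos h, dilate_apply, gauss_apply, heatK, ← Complex.ofReal_pow, ← Complex.ofReal_inv,
    ← Complex.ofReal_mul]
  congr 1
  rw [norm_smul, mul_pow, norm_inv, Real.norm_of_nonneg (Real.sqrt_nonneg θ), inv_pow,
    Real.sq_sqrt h.le, Real.mul_rpow Real.pi_pos.le h.le]
  have h1 : (√θ ^ n)⁻¹ = θ ^ (-(n : ℝ) / 2) := by
    rw [Real.sqrt_eq_rpow, ← Real.rpow_natCast, ← Real.rpow_mul h.le, ← Real.rpow_neg h.le]
    congr 1; ring
  rw [h1]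
  have h2 : -(θ⁻¹ * ‖x‖ ^ 2) = -‖x‖ ^ 2 / θ := by field_simp
  rw [h2]; ring

theorem heatK_pos {n : ℕ} {θ : ℝ} (h : 0 < θ) (x : Rn n) : 0 < heatK θ x := by
  unfold heatK
  have := Real.pi_pos
  positivity

theorem continuous_heatK {n : ℕ} (θ : ℝ) : Continuous (heatK θ : Rn n → ℝ) := by
  unfold heatK; fun_prop

theorem heatK_neg {n : ℕ} (θ : ℝ) (x : Rn n) : heatK θ (-x) = heatK θ x := by
  simp [heatK]

theorem integrable_heatK {n : ℕ} {θ : ℝ} (h : 0 < θ) : Integrable (heatK θ : Rn n → ℝ) := by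
  have := ((heat n θ).integrable (μ := volume)).norm
  refine this.congr (Eventually.of_forall fun x => ?_)
  simp only [heat_apply h, Complex.norm_real, Real.norm_of_nonneg (heatK_pos h x).le]

theorem integrable_pow_mul_heatK {n : ℕ} {θ : ℝ} (h : 0 < θ) (k : ℕ) :
    Integrable (fun x : Rn n => ‖x‖ ^ k * heatK θ x) := by
  refine ((heat n θ).integrable_pow_mul volume k).congr (Eventually.of_forall fun x => ?_)
  simp only [heat_apply h, Complex.norm_real, Real.norm_of_nonneg (heatK_pos h x).le]

theorem integral_heatK {n : ℕ} {θ : ℝ} (h : 0 < θ) : ∫ x : Rn n, heatK θ x = 1 := by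
  unfold heatK
  rw [integral_const_mul]
  have h1 := GaussianFourier.integral_rexp_neg_mul_sq_norm (V := Rn n) (b := θ⁻¹) (by positivity)
  have h2 : (fun x : Rn n => Real.exp (-‖x‖ ^ 2 / θ)) = fun x => Real.exp (-θ⁻¹ * ‖x‖ ^ 2) := by
    funext x; congr 1; field_simp
  have hpos : 0 < Real.pi * θ := mul_pos Real.pi_pos h
  rw [h2, h1, finrank_euclideanSpace_fin, div_inv_eq_mul, ← Real.rpow_add hpos]
  rw [neg_div, neg_add_cancel, Real.rpow_zero]

/-- Completing the square in y. The second factor on the right is a heat kernel in y of total mass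
one, so integrating in y gives the semigroup law. -/
theorem heatK_mul_heatK {n : ℕ} {a b : ℝ} (ha : 0 < a) (hb : 0 < b) (x y : Rn n) :
    heatK a y * heatK b (x - y) =
      heatK (a + b) x * heatK (a * b / (a + b)) (y - (a / (a + b)) • x) := by
  unfold heatK
  have hpi := Real.pi_pos
  have e1 : (Real.pi * a) ^ (-(n : ℝ) / 2) * (Real.pi * b) ^ (-(n : ℝ) / 2) =
      (Real.pi * (a + b)) ^ (-(n : ℝ) / 2) * (Real.pi * (a * b / (a + b))) ^ (-(n : ℝ) / 2) := by
    rw [← Real.mul_rpow (by positivity) (by positivity),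
      ← Real.mul_rpow (by positivity) (by positivity)]
    congr 1
    field_simp
  have e2 : -‖y‖ ^ 2 / a + -‖x - y‖ ^ 2 / b =
      -‖x‖ ^ 2 / (a + b) + -‖y - (a / (a + b)) • x‖ ^ 2 / (a * b / (a + b)) := by
    rw [norm_sub_sq_real, norm_sub_sq_real, norm_smul, inner_smul_right, real_inner_comm,
      mul_pow, Real.norm_eq_abs, sq_abs]
    field_simp
    ring
  calc _ = ((Real.pi * a) ^ (-(n : ℝ) / 2) * (Real.pi * b) ^ (-(n : ℝ) / 2)) *
        Real.exp (-‖y‖ ^ 2 / a + -‖x - y‖ ^ 2 / b) := by rw [Real.exp_add]; ring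
    _ = _ := by rw [e1, e2, Real.exp_add]; ring

theorem integral_heatK_mul_heatK {n : ℕ} {a b : ℝ} (ha : 0 < a) (hb : 0 < b) (x : Rn n) :
    ∫ y, heatK a y * heatK b (x - y) = heatK (a + b) x := by
  simp_rw [heatK_mul_heatK ha hb]
  rw [integral_const_mul, integral_sub_right_eq_self (fun y : Rn n => heatK (a * b / (a + b)) y),
    integral_heatK (by positivity), mul_one]

theorem sconv_heat {n : ℕ} {a b : ℝ} (ha : 0 < a) (hb : 0 < b) :
    sconv (heat n a) (heat n b) = heat n (a + b) := by
  ext x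
  rw [sconv_apply, heat_apply (add_pos ha hb), ← integral_heatK_mul_heatK ha hb,
    ← integral_complex_ofReal]
  congr 1
  funext y
  rw [heat_apply ha, heat_apply hb]; push_cast; ring

theorem heatK_scale {n : ℕ} {θ : ℝ} (h : 0 < θ) (x : Rn n) :
    heatK θ (√θ • x) = (√θ ^ n)⁻¹ * heatK 1 x := by
  unfold heatK
  have h1 : (√θ ^ n)⁻¹ = θ ^ (-(n : ℝ) / 2) := by
    rw [Real.sqrt_eq_rpow, ← Real.rpow_natCast, ← Real.rpow_mul h.le, ← Real.rpow_neg h.le]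
    congr 1; ring
  rw [h1, Real.mul_rpow Real.pi_pos.le h.le, norm_smul, mul_pow,
    Real.norm_of_nonneg (Real.sqrt_nonneg θ), Real.sq_sqrt h.le]
  have h2 : -(θ * ‖x‖ ^ 2) / θ = -‖x‖ ^ 2 / 1 := by field_simp
  rw [h2]; ring_nf

/-- Change of variables `y = √θ z` in Gaussian integrals. -/
theorem integral_heatK_smul {n : ℕ} {F : Type*} [NormedAddCommGroup F] [NormedSpace ℝ F]
    {θ : ℝ} (h : 0 < θ) (w : Rn n → F) :
    ∫ y, heatK θ y • w y = ∫ z, heatK 1 z • w (√θ • z) := by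
  have hs : 0 < √θ := Real.sqrt_pos.2 h
  have := Measure.integral_comp_smul (volume : Measure (Rn n)) (fun y => heatK θ y • w y) (√θ)
  rw [finrank_euclideanSpace_fin] at this
  simp_rw [heatK_scale h, mul_smul] at this
  rw [integral_smul] at this
  have h2 : |(√θ ^ n)⁻¹| = (√θ ^ n)⁻¹ := abs_of_pos (by positivity)
  rw [h2] at this
  exact ((smul_right_injective F (by positivity : (√θ ^ n)⁻¹ ≠ 0)) this).symm

/-! ### The heat equation -/

theorem hasDerivAt_heatK_time {n : ℕ} {θ : ℝ} (h : 0 < θ) (x : Rn n) :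
    HasDerivAt (fun θ => heatK θ x) ((‖x‖ ^ 2 / θ ^ 2 - n / (2 * θ)) * heatK θ x) θ := by
  unfold heatK
  have hpos : 0 < Real.pi * θ := mul_pos Real.pi_pos h
  have h1 : HasDerivAt (fun θ : ℝ => (Real.pi * θ) ^ (-(n : ℝ) / 2))
      (Real.pi * (-(n : ℝ) / 2) * (Real.pi * θ) ^ (-(n : ℝ) / 2 - 1)) θ := by
    have := ((hasDerivAt_id θ).const_mul Real.pi).rpow_const (p := -(n : ℝ) / 2)
      (Or.inl hpos.ne')
    simpa using this
  have h2 : HasDerivAt (fun θ : ℝ => Real.exp (-‖x‖ ^ 2 / θ))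
      (Real.exp (-‖x‖ ^ 2 / θ) * (‖x‖ ^ 2 / θ ^ 2)) θ := by
    have := ((hasDerivAt_inv h.ne').const_mul (-‖x‖ ^ 2)).exp
    convert! this using 1
    field_simp
  convert! h1.mul h2 using 1
  rw [Real.rpow_sub_one hpos.ne']
  have := Real.pi_pos
  field_simp
  ring

theorem norm_add_smul_single_sq {n : ℕ} (x : Rn n) (i : Fin n) (t : ℝ) :
    ‖x + t • EuclideanSpace.basisFun (Fin n) ℝ i‖ ^ 2 = ‖x‖ ^ 2 + 2 * t * x i + t ^ 2 := by
  rw [norm_add_sq_real, inner_smul_right, norm_smul, (EuclideanSpace.basisFun (Fin n) ℝ).norm_eq_one]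
  have : inner ℝ x (EuclideanSpace.basisFun (Fin n) ℝ i) = x i := by
    rw [EuclideanSpace.basisFun_apply, EuclideanSpace.inner_single_right]; simp
  rw [this, mul_one, Real.norm_eq_abs, sq_abs]; ring

theorem hasDerivAt_heatK_line {n : ℕ} (θ : ℝ) (x : Rn n) (i : Fin n) :
    HasDerivAt (fun t : ℝ => heatK θ (x + t • EuclideanSpace.basisFun (Fin n) ℝ i))
      (-(2 * x i / θ) * heatK θ x) 0 := by
  unfold heatK
  simp_rw [norm_add_smul_single_sq]
  have h1 : HasDerivAt (fun t : ℝ => -(‖x‖ ^ 2 + 2 * t * x i + t ^ 2) / θ) (-(2 * x i / θ)) 0 := by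
    have ha := ((((hasDerivAt_id (0 : ℝ)).const_mul 2).mul_const (x i)).const_add (‖x‖ ^ 2)).add
      ((hasDerivAt_id (0 : ℝ)).pow 2)
    have := (ha.neg).div_const θ
    convert! this using 1
    simp; ring
  have h2 := (h1.exp).const_mul ((Real.pi * θ) ^ (-(n : ℝ) / 2))
  convert! h2 using 1
  simp; ring

theorem lineDerivOp_heat {n : ℕ} {θ : ℝ} (h : 0 < θ) (i : Fin n) (x : Rn n) :
    (∂_{EuclideanSpace.basisFun (Fin n) ℝ i} (heat n θ)) x =
      ((-(2 * x i / θ) * heatK θ x : ℝ) : ℂ) := by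
  rw [SchwartzMap.lineDerivOp_apply, lineDeriv]
  have := (hasDerivAt_heatK_line θ x i).ofReal_comp
  simp_rw [heat_apply h]
  exact this.deriv

theorem lineDerivOp_lineDerivOp_heat {n : ℕ} {θ : ℝ} (h : 0 < θ) (i : Fin n) (x : Rn n) :
    (∂_{EuclideanSpace.basisFun (Fin n) ℝ i} (∂_{EuclideanSpace.basisFun (Fin n) ℝ i} (heat n θ))) x =
      (((4 * x i ^ 2 / θ ^ 2 - 2 / θ) * heatK θ x : ℝ) : ℂ) := by
  rw [SchwartzMap.lineDerivOp_apply, lineDeriv]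
  simp_rw [lineDerivOp_heat h]
  refine HasDerivAt.deriv (HasDerivAt.ofReal_comp ?_)
  have h1 : HasDerivAt (fun t : ℝ => -(2 * (x + t • EuclideanSpace.basisFun (Fin n) ℝ i) i / θ))
      (-(2 / θ)) 0 := by
    have he : (fun t : ℝ => -(2 * (x + t • EuclideanSpace.basisFun (Fin n) ℝ i) i / θ)) =
        fun t : ℝ => -(2 * (x i + t) / θ) := by
      funext t; simp [EuclideanSpace.basisFun_apply]
    rw [he]
    have := ((((hasDerivAt_id (0 : ℝ)).const_add (x i)).const_mul 2).div_const θ).neg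
    convert! this using 1
    simp
  convert! h1.mul (hasDerivAt_heatK_line θ x i) using 1
  simp
  field_simp
  ring

/-- Together with `hasDerivAt_heatK_time` this says ∂_θ h_θ = (1/4) Δ h_θ; the factor 1/4 comes from
the normalization exp(-|x|²/θ). -/
theorem laplacian_heat {n : ℕ} {θ : ℝ} (h : 0 < θ) (x : Rn n) :
    (Laplacian.laplacian (heat n θ)) x =
      ((4 * ((‖x‖ ^ 2 / θ ^ 2 - n / (2 * θ)) * heatK θ x) : ℝ) : ℂ) := by
  rw [SchwartzMap.laplacian_eq_sum (EuclideanSpace.basisFun (Fin n) ℝ), sum_apply]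
  simp_rw [lineDerivOp_lineDerivOp_heat h]
  rw [← Complex.ofReal_sum, ← Finset.sum_mul, Finset.sum_sub_distrib, EuclideanSpace.norm_sq_eq,
    ← Finset.sum_div, ← Finset.mul_sum]
  simp only [Finset.sum_const, Finset.card_univ, Fintype.card_fin, nsmul_eq_mul, Real.norm_eq_abs,
    sq_abs]
  congr 1
  field_simp
  ring

/-! ### The heat semigroup on bounded functions -/

theorem aestronglyMeasurable_comp_sub {n : ℕ} {F : Type*} [NormedAddCommGroup F]
    {w : Rn n → F} (hw : AEStronglyMeasurable w volume) (z : Rn n) : AEStronglyMeasurable (fun y => w (z - y)) volume :=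
  hw.comp_quasiMeasurePreserving (quasiMeasurePreserving_sub_left volume z)

section HeatSemigroup

variable {n : ℕ} {F : Type*} [NormedAddCommGroup F] [NormedSpace ℝ F]

/-- The heat semigroup `T_θ w (z) = ∫ heatK θ y • w (z - y) dy`. -/
def heatT (θ : ℝ) (w : Rn n → F) (z : Rn n) : F := ∫ y, heatK θ y • w (z - y)

theorem integrable_heatK_smul {θ : ℝ} (h : 0 < θ) {w : Rn n → F}
    (hw : AEStronglyMeasurable w volume) {C : ℝ} (hC : ∀ x, ‖w x‖ ≤ C) (z : Rn n) :
    Integrable fun y => heatK θ y • w (z - y) := by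
  refine ((integrable_heatK h).mul_const C).mono'
    ((continuous_heatK θ).aestronglyMeasurable.smul (aestronglyMeasurable_comp_sub hw z))
    (Eventually.of_forall fun y => ?_)
  rw [norm_smul, Real.norm_of_nonneg (heatK_pos h y).le]
  exact mul_le_mul_of_nonneg_left (hC _) (heatK_pos h y).le

theorem norm_heatT_le {θ : ℝ} (h : 0 < θ) {w : Rn n → F} {C : ℝ} (hC : ∀ x, ‖w x‖ ≤ C)
    (z : Rn n) : ‖heatT θ w z‖ ≤ C := by
  have h1 : ‖heatT θ w z‖ ≤ ∫ y, heatK θ y * C :=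
    norm_integral_le_of_norm_le ((integrable_heatK h).mul_const C) (Eventually.of_forall fun y => by
      rw [norm_smul, Real.norm_of_nonneg (heatK_pos h y).le]
      exact mul_le_mul_of_nonneg_left (hC _) (heatK_pos h y).le)
  rwa [integral_mul_const, integral_heatK h, one_mul] at h1

theorem heatT_eq_integral_sub (θ : ℝ) (w : Rn n → F) (z : Rn n) :
    heatT θ w z = ∫ y, heatK θ (z - y) • w y := by
  unfold heatT
  rw [← integral_sub_left_eq_self _ volume z]
  simp

theorem heatT_eq_integral_scaled {θ : ℝ} (h : 0 < θ) (w : Rn n → F) (z : Rn n) :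
    heatT θ w z = ∫ y, heatK 1 y • w (z - √θ • y) :=
  integral_heatK_smul h fun y => w (z - y)

/-- The scaled form of the heat semigroup is jointly continuous up to time `0`. -/
theorem continuous_integral_scaled {w : Rn n → F} (hw : Continuous w) {C : ℝ}
    (hC : ∀ x, ‖w x‖ ≤ C) :
    Continuous fun p : ℝ × Rn n => ∫ y, heatK 1 y • w (p.2 - √p.1 • y) := by
  refine continuous_of_dominated (bound := fun y => heatK 1 y * C) (fun p => ?_) (fun p => ?_)
    ((integrable_heatK one_pos).mul_const C) (Eventually.of_forall fun y => ?_)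
  · refine Continuous.aestronglyMeasurable ?_
    have := continuous_heatK (n := n) 1
    fun_prop
  · refine Eventually.of_forall fun y => ?_
    rw [norm_smul, Real.norm_of_nonneg (heatK_pos one_pos y).le]
    exact mul_le_mul_of_nonneg_left (hC _) (heatK_pos one_pos y).le
  · fun_prop

theorem continuousOn_heatT_of_continuous {w : Rn n → F} (hw : Continuous w) {C : ℝ}
    (hC : ∀ x, ‖w x‖ ≤ C) :
    ContinuousOn (fun p : ℝ × Rn n => heatT p.1 w p.2) {p | 0 < p.1} :=
  (continuous_integral_scaled hw hC).continuousOn.congr fun p hp =>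
    heatT_eq_integral_scaled hp w p.2

theorem tendsto_heatT_zero [CompleteSpace F] {w : Rn n → F} (hw : Continuous w) {C : ℝ}
    (hC : ∀ x, ‖w x‖ ≤ C) (z : Rn n) :
    Tendsto (fun θ => heatT θ w z) (𝓝[>] 0) (𝓝 (w z)) := by
  have h1 := ((continuous_integral_scaled hw hC).comp (Continuous.prodMk_left z)).tendsto (0 : ℝ)
  have h2 : ∫ y : Rn n, heatK 1 y • w (z - √(0 : ℝ) • y) = w z := by
    simp [integral_smul_const, integral_heatK]
  simp only [Function.comp_def] at h1
  rw [h2] at h1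
  refine (h1.mono_left nhdsWithin_le_nhds).congr' ?_
  filter_upwards [self_mem_nhdsWithin] with θ hθ
  exact (heatT_eq_integral_scaled hθ w z).symm

/-- One Gaussian dominates the kernels for all nearby (θ, z). Doubling the largest time pays for the
shift of centre, through |z₀ - y|² ≤ 2|z - y|² + 2. -/
theorem heatK_le_of_mem {a b θ : ℝ} (ha : 0 < a) (h1 : a ≤ θ) (h2 : θ ≤ b) {z z₀ : Rn n}
    (hz : ‖z - z₀‖ ≤ 1) (y : Rn n) :
    heatK θ (z - y) ≤ (Real.pi * a) ^ (-(n : ℝ) / 2) * Real.exp (1 / a) *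
      Real.exp (-‖z₀ - y‖ ^ 2 / (2 * b)) := by
  have hpi := Real.pi_pos
  have hθ : 0 < θ := ha.trans_le h1
  have hb : 0 < b := hθ.trans_le h2
  unfold heatK
  rw [mul_assoc, ← Real.exp_add]
  gcongr ?_ * Real.exp ?_
  · refine Real.rpow_le_rpow_of_nonpos (by positivity) (by gcongr) ?_
    have : (0 : ℝ) ≤ n := by positivity
    linarith
  · have hn : ‖z₀ - y‖ ^ 2 ≤ 2 * ‖z - y‖ ^ 2 + 2 := by
      have h3 : ‖z₀ - y‖ ≤ ‖z - y‖ + 1 := by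
        calc ‖z₀ - y‖ = ‖(z - y) - (z - z₀)‖ := by congr 1; abel
          _ ≤ ‖z - y‖ + ‖z - z₀‖ := norm_sub_le _ _
          _ ≤ _ := by gcongr
      nlinarith [norm_nonneg (z₀ - y), sq_nonneg (‖z - y‖ - 1)]
    have h4 : ‖z₀ - y‖ ^ 2 / (2 * b) ≤ ‖z₀ - y‖ ^ 2 / (2 * θ) := by gcongr
    have h5 : ‖z₀ - y‖ ^ 2 / (2 * θ) ≤ (2 * ‖z - y‖ ^ 2 + 2) / (2 * θ) := by gcongr
    have h6 : (2 * ‖z - y‖ ^ 2 + 2) / (2 * θ) = ‖z - y‖ ^ 2 / θ + 1 / θ := by field_simp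
    have h7 : 1 / θ ≤ 1 / a := by gcongr
    rw [neg_div, neg_div]
    linarith

theorem integrable_exp_neg_norm_sq {b : ℝ} (hb : 0 < b) (z₀ : Rn n) :
    Integrable fun y : Rn n => Real.exp (-‖z₀ - y‖ ^ 2 / b) := by
  have h1 := ((integrable_heatK (n := n) hb).comp_sub_left z₀).const_mul
    ((Real.pi * b) ^ (-(n : ℝ) / 2))⁻¹
  refine h1.congr (Eventually.of_forall fun y => ?_)
  have : (Real.pi * b) ^ (-(n : ℝ) / 2) ≠ 0 := by
    have := Real.pi_pos
    positivity
  simp only [heatK]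
  field_simp

/-- Here w is only measurable, so the kernel must carry the dependence on (θ, z). The price is that
time 0 is excluded, unlike in `continuous_integral_scaled`. -/
theorem continuousOn_heatT {w : Rn n → F} (hw : AEStronglyMeasurable w volume) {C : ℝ}
    (hC : ∀ x, ‖w x‖ ≤ C) :
    ContinuousOn (fun p : ℝ × Rn n => heatT p.1 w p.2) {p | 0 < p.1} := by
  rintro ⟨θ₀, z₀⟩ hθ₀
  have hθ₀ : 0 < θ₀ := hθ₀
  refine ContinuousAt.continuousWithinAt ?_
  simp_rw [heatT_eq_integral_sub]
  have hC0 : 0 ≤ C := (norm_nonneg _).trans (hC 0)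
  have hev : ∀ᶠ p : ℝ × Rn n in 𝓝 (θ₀, z₀), (θ₀ / 2 < p.1 ∧ p.1 < 2 * θ₀) ∧ ‖p.2 - z₀‖ < 1 := by
    refine IsOpen.mem_nhds ?_ ?_
    · refine IsOpen.inter ?_ (isOpen_lt (f := fun p : ℝ × Rn n => ‖p.2 - z₀‖)
        (by fun_prop) continuous_const)
      exact (isOpen_lt continuous_const continuous_fst).inter
        (isOpen_lt continuous_fst continuous_const)
    · refine ⟨⟨by dsimp; linarith, by dsimp; linarith⟩, by simp⟩
  refine continuousAt_of_dominated (bound := fun y => (Real.pi * (θ₀ / 2)) ^ (-(n : ℝ) / 2) *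
      Real.exp (1 / (θ₀ / 2)) * Real.exp (-‖z₀ - y‖ ^ 2 / (2 * (2 * θ₀))) * C) ?_ ?_ ?_ ?_
  · refine Eventually.of_forall fun p => AEStronglyMeasurable.smul ?_ hw
    have := continuous_heatK (n := n) p.1
    exact (this.comp (by fun_prop)).aestronglyMeasurable
  · filter_upwards [hev] with p hp
    refine Eventually.of_forall fun y => ?_
    rw [norm_smul, Real.norm_of_nonneg (heatK_pos (by linarith [hp.1.1]) _).le]
    gcongr
    · exact heatK_le_of_mem (by linarith) hp.1.1.le hp.1.2.le hp.2.le y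
    · exact hC y
  · exact ((integrable_exp_neg_norm_sq (by positivity) z₀).const_mul _).mul_const C
  · refine Eventually.of_forall fun y => ContinuousAt.smul ?_ continuousAt_const
    unfold heatK
    have hpi := Real.pi_pos
    refine ContinuousAt.mul ?_ ?_
    · refine ContinuousAt.rpow_const (by fun_prop) (Or.inl ?_)
      dsimp; positivity
    · refine Real.continuous_exp.continuousAt.comp (ContinuousAt.div (by fun_prop) (by fun_prop) ?_)
      exact hθ₀.ne'

theorem heatT_heatT [CompleteSpace F] {a b : ℝ} (ha : 0 < a) (hb : 0 < b) {w : Rn n → F}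
    (hw : AEStronglyMeasurable w volume) {C : ℝ} (hC : ∀ x, ‖w x‖ ≤ C) (z : Rn n) :
    heatT a (heatT b w) z = heatT (a + b) w z := by
  have hC0 : 0 ≤ C := (norm_nonneg _).trans (hC 0)
  have hk : Integrable (fun p : Rn n × Rn n => heatK a p.1 * heatK b (z - p.1 - p.2))
      (volume.prod volume) := by
    have h0 : Integrable (fun p : Rn n × Rn n => heatK a p.1 * heatK b p.2)
        (volume.prod volume) := (integrable_heatK ha).mul_prod (integrable_heatK hb)
    -- The shear (x, y) ↦ (x, z - x - y) carries the product kernel to the kernel of the iterated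
    -- integral, which justifies Fubini.
    have hmp : MeasurePreserving (fun p : Rn n × Rn n => (p.1, z - p.1 - p.2))
        (volume.prod volume) (volume.prod volume) := by
      refine MeasurePreserving.skew_product (g := fun x y : Rn n => z - x - y)
        (MeasurePreserving.id volume) (by fun_prop) (Eventually.of_forall fun x => ?_)
      exact (Measure.measurePreserving_sub_left volume (z - x)).map_eq
    exact hmp.integrable_comp_of_integrable h0
  have hk2 : Integrable (fun p : Rn n × Rn n =>
      (heatK a p.1 * heatK b (z - p.1 - p.2)) • w p.2) (volume.prod volume) := by
    refine (hk.mul_const C).mono' (hk.aestronglyMeasurable.smul hw.comp_snd)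
      (Eventually.of_forall fun p => ?_)
    have h1 : 0 ≤ heatK a p.1 * heatK b (z - p.1 - p.2) :=
      (mul_pos (heatK_pos ha _) (heatK_pos hb _)).le
    rw [norm_smul, Real.norm_of_nonneg h1]
    exact mul_le_mul_of_nonneg_left (hC _) h1
  calc heatT a (heatT b w) z
      = ∫ x, ∫ y, (heatK a x * heatK b (z - x - y)) • w y := by
        unfold heatT
        congr 1; funext x
        rw [← heatT, heatT_eq_integral_sub, ← integral_smul]
        simp_rw [mul_smul]
    _ = ∫ y, ∫ x, (heatK a x * heatK b (z - x - y)) • w y := integral_integral_swap hk2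
    _ = ∫ y, heatK (a + b) (z - y) • w y := by
        congr 1; funext y
        rw [integral_smul_const, ← integral_heatK_mul_heatK ha hb]
        simp_rw [sub_right_comm]
    _ = _ := (heatT_eq_integral_sub _ _ _).symm

theorem hasDerivAt_heatT {w : Rn n → F} (hw : AEStronglyMeasurable w volume) {C : ℝ}
    (hC : ∀ x, ‖w x‖ ≤ C) {r : ℝ} (hr : 0 < r) (z : Rn n) :
    HasDerivAt (fun θ => heatT θ w z)
      (∫ y, ((‖y‖ ^ 2 / r ^ 2 - n / (2 * r)) * heatK r y) • w (z - y)) r := by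
  have hpi := Real.pi_pos
  have hC0 : 0 ≤ C := (norm_nonneg _).trans (hC 0)
  have hs : Ioo (r / 2) (2 * r) ∈ 𝓝 r := Ioo_mem_nhds (by linarith) (by linarith)
  have hmeas := aestronglyMeasurable_comp_sub hw z
  let K : ℝ := (Real.pi * (r / 2)) ^ (-(n : ℝ) / 2) * Real.exp (1 / (r / 2))
  let g : Rn n → ℝ := fun y => Real.exp (-‖(0 : Rn n) - y‖ ^ 2 / (2 * (2 * r)))
  have hg0 : Integrable g := integrable_exp_neg_norm_sq (by positivity) 0
  have hg2 : Integrable fun y => ‖y‖ ^ 2 * g y := by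
    have := (integrable_pow_mul_heatK (n := n) (θ := 2 * (2 * r)) (by positivity) 2).const_mul
      ((Real.pi * (2 * (2 * r))) ^ (-(n : ℝ) / 2))⁻¹
    refine this.congr (Eventually.of_forall fun y => ?_)
    have : (Real.pi * (2 * (2 * r))) ^ (-(n : ℝ) / 2) ≠ 0 := by positivity
    simp only [heatK, g, zero_sub, norm_neg]
    field_simp
  refine (hasDerivAt_integral_of_dominated_loc_of_deriv_le (𝕜 := ℝ)
    (bound := fun y => (‖y‖ ^ 2 / (r / 2) ^ 2 + n / (2 * (r / 2))) * (K * g y) * C) hs ?_ ?_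
    (F' := fun θ y => ((‖y‖ ^ 2 / θ ^ 2 - n / (2 * θ)) * heatK θ y) • w (z - y)) ?_ ?_ ?_ ?_).2
  · exact Eventually.of_forall fun θ => (continuous_heatK θ).aestronglyMeasurable.smul hmeas
  · exact integrable_heatK_smul hr hw hC z
  · refine AEStronglyMeasurable.smul (Continuous.aestronglyMeasurable ?_) hmeas
    have := continuous_heatK (n := n) r
    fun_prop
  · refine Eventually.of_forall fun y θ hθ => ?_
    have hθ0 : 0 < θ := by linarith [hθ.1]
    rw [norm_smul, norm_mul, Real.norm_of_nonneg (heatK_pos hθ0 y).le]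
    gcongr
    · exact (heatK_pos hθ0 y).le
    · refine (norm_sub_le _ _).trans ?_
      rw [Real.norm_of_nonneg (by positivity), Real.norm_of_nonneg (by positivity)]
      have := hθ.1.le
      gcongr
    · have := heatK_le_of_mem (n := n) (by linarith : 0 < r / 2) hθ.1.le hθ.2.le
        (z := 0) (z₀ := 0) (by simp) y
      rw [zero_sub, heatK_neg] at this
      simpa only [K, g, zero_sub] using this
    · exact hC _
  · have : (fun y : Rn n => (‖y‖ ^ 2 / (r / 2) ^ 2 + n / (2 * (r / 2))) * (K * g y) * C) =
        fun y => (K * C / (r / 2) ^ 2) * (‖y‖ ^ 2 * g y) + (n / (2 * (r / 2)) * K * C) * g y := by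
      funext y; ring
    rw [this]
    exact (hg2.const_mul _).add (hg0.const_mul _)
  · refine Eventually.of_forall fun y θ hθ => ?_
    exact (hasDerivAt_heatK_time (by linarith [hθ.1]) y).smul_const _

end HeatSemigroup

/-! ### The caloric extension of a distribution -/

/-- The caloric extension `U(θ, z) = (f * heat θ)(z)`. -/
def caloric {n : ℕ} (f : 𝓢'(Rn n, ℂ)) (θ : ℝ) (z : Rn n) : ℂ := conv f (heat n θ) z

theorem continuous_caloric {n : ℕ} (f : 𝓢'(Rn n, ℂ)) (θ : ℝ) : Continuous (caloric f θ) :=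
  continuous_conv f _

theorem conv_sconv_heat {n : ℕ} (f : 𝓢'(Rn n, ℂ)) (Ψ : 𝓢(Rn n, ℂ)) {θ : ℝ} (h : 0 < θ)
    (z : Rn n) : conv f (sconv (heat n θ) Ψ) z = heatT θ (conv f Ψ) z := by
  rw [conv_sconv]
  simp only [heat_apply h, heatT, Complex.real_smul]

theorem conv_sconv_heat' {n : ℕ} (f : 𝓢'(Rn n, ℂ)) (Ψ : 𝓢(Rn n, ℂ)) (θ : ℝ)
    (z : Rn n) : conv f (sconv (heat n θ) Ψ) z = ∫ y, Ψ y * caloric f θ (z - y) := by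
  rw [sconv_comm, conv_sconv]; rfl

theorem caloric_add {n : ℕ} (f : 𝓢'(Rn n, ℂ)) {a b : ℝ} (ha : 0 < a) (hb : 0 < b) (z : Rn n) :
    caloric f (a + b) z = heatT a (caloric f b) z := by
  rw [caloric, ← sconv_heat ha hb, conv_sconv_heat f _ ha]; rfl

/-- The heat equation followed by a transfer of the Laplacian to Ψ. The derivative has the same
shape as the function, with Ψ replaced by ΔΨ, so the formula iterates. -/
theorem hasDerivAt_conv_sconv_heat {n : ℕ} {f : 𝓢'(Rn n, ℂ)} (hf : IsBoundedDistribution f)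
    (Ψ : 𝓢(Rn n, ℂ)) {r : ℝ} (hr : 0 < r) (z : Rn n) :
    HasDerivAt (fun θ => conv f (sconv (heat n θ) Ψ) z)
      (4⁻¹ * conv f (sconv (heat n r) (Laplacian.laplacian Ψ)) z) r := by
  obtain ⟨C, hC⟩ := hf Ψ
  have h := hasDerivAt_heatT (continuous_conv f Ψ).aestronglyMeasurable hC hr z
  have he : (fun θ => conv f (sconv (heat n θ) Ψ) z) =ᶠ[𝓝 r] fun θ => heatT θ (conv f Ψ) z := by
    filter_upwards [lt_mem_nhds hr] with θ hθ
    exact conv_sconv_heat f Ψ hθ z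
  refine (h.congr_of_eventuallyEq he).congr_deriv ?_
  rw [← laplacian_sconv_left, conv_sconv, ← integral_const_mul]
  congr 1
  funext y
  rw [laplacian_heat hr, Complex.real_smul]
  push_cast; ring

theorem caloric_sub {n : ℕ} (f g : 𝓢'(Rn n, ℂ)) (θ : ℝ) (z : Rn n) :
    caloric (f - g) θ z = caloric f θ z - caloric g θ z := rfl

/-- Half of the time θ₀ is spent to make f * h_{θ₀/2} a bounded continuous function; the rest is the
heat semigroup acting on it. -/
theorem continuousOn_caloric {n : ℕ} {f : 𝓢'(Rn n, ℂ)} (hf : IsBoundedDistribution f) :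
    ContinuousOn (fun p : ℝ × Rn n => caloric f p.1 p.2) {p | 0 < p.1} := by
  rintro ⟨θ₀, z₀⟩ hθ₀
  have hθ₀ : 0 < θ₀ := hθ₀
  obtain ⟨C, hC⟩ := hf (heat n (θ₀ / 2))
  have h1 := continuousOn_heatT_of_continuous (continuous_caloric f (θ₀ / 2)) hC
  have h2 : ContinuousAt (fun p : ℝ × Rn n => heatT p.1 (caloric f (θ₀ / 2)) p.2)
      (θ₀ - θ₀ / 2, z₀) :=
    h1.continuousAt ((isOpen_lt continuous_const continuous_fst).mem_nhds (by
      change 0 < θ₀ - θ₀ / 2; linarith))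
  have h3 : ContinuousAt ((fun p : ℝ × Rn n => heatT p.1 (caloric f (θ₀ / 2)) p.2) ∘
      fun p : ℝ × Rn n => (p.1 - θ₀ / 2, p.2)) (θ₀, z₀) :=
    ContinuousAt.comp (x := (θ₀, z₀)) h2 (by fun_prop)
  refine (h3.congr ?_).continuousWithinAt
  have : ∀ᶠ p : ℝ × Rn n in 𝓝 (θ₀, z₀), θ₀ / 2 < p.1 :=
    (isOpen_lt continuous_const continuous_fst).mem_nhds (by change θ₀ / 2 < θ₀; linarith)
  filter_upwards [this] with p hp
  have h4 := caloric_add f (sub_pos.2 hp) (by linarith : 0 < θ₀ / 2) p.2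
  rw [sub_add_cancel] at h4
  exact h4.symm

/-! ### Taylor expansion along the heat flow -/

/-- The sum is the Taylor polynomial of V 0 centred at r, evaluated at time 0. Differentiating in
the centre telescopes and leaves only the top term. -/
theorem hasDerivAt_taylor_sum {V : ℕ → ℝ → ℂ} {r : ℝ}
    (hV : ∀ k, HasDerivAt (V k) (V (k + 1) r) r) (K : ℕ) :
    HasDerivAt (fun r => ∑ k ∈ Finset.range (K + 1), (((-r) ^ k / k.factorial : ℝ) : ℂ) * V k r)
      ((((-r) ^ K / K.factorial : ℝ) : ℂ) * V (K + 1) r) r := by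
  induction K with
  | zero => simpa using hV 0
  | succ K ih =>
    simp_rw [Finset.sum_range_succ _ (K + 1)]
    have h1 : HasDerivAt (fun r : ℝ => (-r) ^ (K + 1) / ((K + 1).factorial : ℝ))
        (-((-r) ^ K / K.factorial)) r := by
      have := (((hasDerivAt_id r).neg).pow (K + 1)).div_const ((K + 1).factorial : ℝ)
      refine this.congr_deriv ?_
      rw [Nat.factorial_succ]
      have h2 : (K.factorial : ℝ) ≠ 0 := by positivity
      have h3 : ((K : ℝ) + 1) ≠ 0 := by positivity
      push_cast
      simp only [Pi.neg_apply, id]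
      field_simp
    have h2 := ih.add (h1.ofReal_comp.mul (hV (K + 1)))
    refine h2.congr_deriv ?_
    push_cast
    ring

/-- If `V 0, V 1, …` are successive derivatives on `(0, ∞)` and `|V k r| ≤ A S^{-k} (r / S)^{-β}`
with `β < K` for `k ≤ K`, then the limit of `V 0` at `0` is controlled by `A`. -/
theorem norm_limit_le_of_iterated_deriv_bound {V : ℕ → ℝ → ℂ}
    (hV : ∀ k, ∀ r > 0, HasDerivAt (V k) (V (k + 1) r) r) {L : ℕ → ℂ}
    (hL : ∀ k, Tendsto (V k) (𝓝[>] 0) (𝓝 (L k))) {K : ℕ} {A S β : ℝ} (hS : 0 < S)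
    (hA : 0 ≤ A) (hβ : β < K + 1)
    (hb : ∀ k ≤ K + 1, ∀ r, 0 < r → r ≤ S → ‖V k r‖ ≤ A * (S ^ k)⁻¹ * (r / S) ^ (-β)) :
    ‖L 0‖ ≤ A * ((K + 1) + 1 / (K + 1 - β)) := by
  set W : ℝ → ℂ := fun r => ∑ k ∈ Finset.range (K + 1), (((-r) ^ k / k.factorial : ℝ) : ℂ) * V k r
    with hW
  have hWd : ∀ r > 0, HasDerivAt W ((((-r) ^ K / K.factorial : ℝ) : ℂ) * V (K + 1) r) r :=
    fun r hr => hasDerivAt_taylor_sum (fun k => hV k r hr) K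
  have hγ : 0 < (K : ℝ) + 1 - β := by linarith
  -- An antiderivative of the bound A (r/S)^{K-β}/S for |W'|; the condition β < K + 1 makes it
  -- bounded down to r = 0.
  let B : ℝ → ℝ := fun r => A * (r / S) ^ ((K : ℝ) + 1 - β) / ((K : ℝ) + 1 - β)
  have hBd : ∀ r > 0, HasDerivAt B (A * (r / S) ^ ((K : ℝ) - β) / S) r := by
    intro r hr
    have h1 := ((((hasDerivAt_id r).div_const S).rpow_const (p := (K : ℝ) + 1 - β)
      (Or.inl (by simp only [id]; positivity))).const_mul A).div_const ((K : ℝ) + 1 - β)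
    refine h1.congr_deriv ?_
    have : (K : ℝ) + 1 - β - 1 = K - β := by ring
    rw [this]
    simp only [id]
    field_simp
  have hWS : ‖W S‖ ≤ A * (K + 1) := by
    refine (norm_sum_le _ _).trans ?_
    have : ∀ k ∈ Finset.range (K + 1), ‖(((-S) ^ k / k.factorial : ℝ) : ℂ) * V k S‖ ≤ A := by
      intro k hk
      rw [norm_mul, Complex.norm_real, norm_div, norm_pow, norm_neg, Real.norm_of_nonneg hS.le,
        Real.norm_of_nonneg (by positivity)]
      have h1 := hb k (by have := Finset.mem_range.1 hk; omega) S hS le_rfl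
      rw [div_self hS.ne', Real.one_rpow, mul_one] at h1
      have h2 : (1 : ℝ) ≤ k.factorial := by exact_mod_cast Nat.one_le_iff_ne_zero.2 k.factorial_ne_zero
      calc S ^ k / k.factorial * ‖V k S‖ ≤ S ^ k / 1 * (A * (S ^ k)⁻¹) := by gcongr
        _ = A := by field_simp
    refine (Finset.sum_le_sum this).trans ?_
    simp [mul_comm]
  have hWε : ∀ ε, 0 < ε → ε ≤ S → ‖W ε‖ ≤ A * ((K + 1) + 1 / (K + 1 - β)) := by
    intro ε hε hεS
    have key : ‖W S - W ε‖ ≤ B S - B ε := by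
      refine image_norm_le_of_norm_deriv_right_le_deriv_boundary' (a := ε) (b := S)
        (f := fun r => W r - W ε) (B := fun r => B r - B ε)
        (f' := fun r => (((-r) ^ K / K.factorial : ℝ) : ℂ) * V (K + 1) r)
        (B' := fun r => A * (r / S) ^ ((K : ℝ) - β) / S) ?_ ?_ ?_ ?_ ?_ ?_ ⟨hεS, le_rfl⟩
      · exact fun r hr => ((hWd r (hε.trans_le hr.1)).sub_const _).continuousAt.continuousWithinAt
      · exact fun r hr => ((hWd r (hε.trans_le hr.1)).sub_const _).hasDerivWithinAt
      · simp
      · exact fun r hr => ((hBd r (hε.trans_le hr.1)).sub_const _).continuousAt.continuousWithinAt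
      · exact fun r hr => ((hBd r (hε.trans_le hr.1)).sub_const _).hasDerivWithinAt
      · intro r hr
        have hr0 : 0 < r := hε.trans_le hr.1
        rw [norm_mul, Complex.norm_real, norm_div, norm_pow, norm_neg, Real.norm_of_nonneg hr0.le,
          Real.norm_of_nonneg (by positivity)]
        have h2 : (1 : ℝ) ≤ K.factorial := by
          exact_mod_cast Nat.one_le_iff_ne_zero.2 K.factorial_ne_zero
        calc r ^ K / K.factorial * ‖V (K + 1) r‖
            ≤ r ^ K / 1 * (A * (S ^ (K + 1))⁻¹ * (r / S) ^ (-β)) := by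
              gcongr
              exact hb _ le_rfl r hr0 hr.2.le
          _ = A * ((r / S) ^ (K : ℝ) * (r / S) ^ (-β)) / S := by
              rw [Real.rpow_natCast, div_pow]; field_simp; ring
          _ = _ := by rw [← Real.rpow_add (by positivity)]; ring_nf
    have hBε : 0 ≤ B ε := by simp only [B]; positivity
    have hBS : B S = A * (1 / (K + 1 - β)) := by simp only [B, div_self hS.ne', Real.one_rpow]; ring
    calc ‖W ε‖ = ‖W S - (W S - W ε)‖ := by congr 1; ring
      _ ≤ ‖W S‖ + ‖W S - W ε‖ := norm_sub_le _ _
      _ ≤ A * (K + 1) + A * (1 / (K + 1 - β)) := by rw [hBS] at key; linarith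
      _ = _ := by ring
  -- The terms with k ≥ 1 carry a factor r^k, and V k has a finite limit, so only V 0 survives.
  have hlim : Tendsto W (𝓝[>] 0) (𝓝 (L 0)) := by
    have h1 : ∀ k ∈ Finset.range (K + 1), Tendsto
        (fun r : ℝ => (((-r) ^ k / k.factorial : ℝ) : ℂ) * V k r) (𝓝[>] 0)
        (𝓝 ((((-0 : ℝ) ^ k / k.factorial : ℝ) : ℂ) * L k)) := by
      intro k _
      refine Tendsto.mul ?_ (hL k)
      have : Continuous fun r : ℝ => (((-r) ^ k / k.factorial : ℝ) : ℂ) := by fun_prop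
      exact (this.tendsto 0).mono_left nhdsWithin_le_nhds
    have h2 := tendsto_finsetSum _ h1
    have h3 : ∑ k ∈ Finset.range (K + 1), ((((-0 : ℝ) ^ k / k.factorial : ℝ) : ℂ) * L k) = L 0 := by
      rw [Finset.sum_range_succ']; simp
    rwa [h3] at h2
  refine le_of_tendsto hlim.norm ?_
  filter_upwards [Ioc_mem_nhdsGT hS] with ε hε
  exact hWε ε hε.1 hε.2

/-! ### Iterated Laplacians of test functions -/

/-- The iterated Laplacian. -/
def lapPow {n : ℕ} (k : ℕ) (Φ : 𝓢(Rn n, ℂ)) : 𝓢(Rn n, ℂ) :=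
  (Laplacian.laplacian : 𝓢(Rn n, ℂ) → 𝓢(Rn n, ℂ))^[k] Φ

theorem lapPow_succ {n : ℕ} (k : ℕ) (Φ : 𝓢(Rn n, ℂ)) :
    lapPow (k + 1) Φ = Laplacian.laplacian (lapPow k Φ) := Function.iterate_succ_apply' _ _ _

theorem lapPow_succ' {n : ℕ} (k : ℕ) (Φ : 𝓢(Rn n, ℂ)) :
    lapPow (k + 1) Φ = lapPow k (Laplacian.laplacian Φ) := Function.iterate_succ_apply _ _ _

theorem weighted_laplacian_le {n N l : ℕ} {B : ℝ} {Φ : 𝓢(Rn n, ℂ)}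
    (h : ∀ (idx : Fin (l + 2) → Fin n) (x : Rn n),
      (1 + ‖x‖) ^ N * ‖(∂^{fun j => EuclideanSpace.basisFun (Fin n) ℝ (idx j)} Φ) x‖ ≤ B)
    (idx : Fin l → Fin n) (x : Rn n) :
    (1 + ‖x‖) ^ N * ‖(∂^{fun j => EuclideanSpace.basisFun (Fin n) ℝ (idx j)}
      (Laplacian.laplacian Φ)) x‖ ≤ n * B := by
  rw [SchwartzMap.laplacian_eq_sum (EuclideanSpace.basisFun (Fin n) ℝ), iteratedLineDerivOp_sum,
    sum_apply]
  have h1 : ∀ i : Fin n, (1 + ‖x‖) ^ N * ‖(∂^{fun j => EuclideanSpace.basisFun (Fin n) ℝ (idx j)}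
      (∂_{EuclideanSpace.basisFun (Fin n) ℝ i} (∂_{EuclideanSpace.basisFun (Fin n) ℝ i} Φ))) x‖
        ≤ B := by
    intro i
    -- A term of the Laplacian is the derivative along the index sequence with i appended twice.
    have h2 := h (Fin.snoc (Fin.snoc idx i : Fin (l + 1) → Fin n) i) x
    rw [iteratedLineDerivOp_succ_right, iteratedLineDerivOp_succ_right] at h2
    simpa [Fin.init_def] using h2
  calc _ ≤ (1 + ‖x‖) ^ N * ∑ i : Fin n, ‖(∂^{fun j => EuclideanSpace.basisFun (Fin n) ℝ (idx j)}
        (∂_{EuclideanSpace.basisFun (Fin n) ℝ i} (∂_{EuclideanSpace.basisFun (Fin n) ℝ i} Φ))) x‖ := by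
        gcongr; exact norm_sum_le _ _
    _ ≤ ∑ i : Fin n, B := by
        rw [Finset.mul_sum]; exact Finset.sum_le_sum fun i _ => h1 i
    _ = _ := by simp

theorem weighted_lapPow_le {n N k : ℕ} {B : ℝ} {Φ : 𝓢(Rn n, ℂ)}
    (h : ∀ (idx : Fin (2 * k) → Fin n) (x : Rn n),
      (1 + ‖x‖) ^ N * ‖(∂^{fun j => EuclideanSpace.basisFun (Fin n) ℝ (idx j)} Φ) x‖ ≤ B)
    (x : Rn n) : (1 + ‖x‖) ^ N * ‖lapPow k Φ x‖ ≤ n ^ k * B := by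
  induction k generalizing Φ B with
  | zero =>
    have := h Fin.elim0 x
    rw [iteratedLineDerivOp_fin_zero] at this
    simpa [lapPow] using this
  | succ k ih =>
    rw [lapPow_succ']
    refine (ih (weighted_laplacian_le (l := 2 * k) h)).trans (le_of_eq ?_)
    ring

theorem norm_le_sum_abs {n : ℕ} (x : Rn n) : ‖x‖ ≤ ∑ i, |x i| := by
  rw [EuclideanSpace.norm_eq, Real.sqrt_le_left (Finset.sum_nonneg fun i _ => abs_nonneg _)]
  simp only [Real.norm_eq_abs]
  exact Finset.sum_sq_le_sq_sum_of_nonneg fun i _ => abs_nonneg _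

theorem norm_pow_le_sum {n : ℕ} (N : ℕ) (x : Rn n) :
    ‖x‖ ^ N ≤ 1 + (n : ℝ) ^ N * ∑ i, |x i| ^ N := by
  rcases N with _ | N
  · simp
  have h0 : 0 ≤ ∑ i, |x i| ^ (N + 1) := Finset.sum_nonneg fun i _ => by positivity
  rcases Nat.eq_zero_or_pos n with rfl | hn
  · have : x = 0 := Subsingleton.elim _ _
    simp [this]
  have h1 := pow_sum_div_card_le_sum_pow (s := Finset.univ) (f := fun i => |x i|)
    (fun i _ => abs_nonneg _) N
  rw [Finset.card_univ, Fintype.card_fin, div_le_iff₀ (by positivity)] at h1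
  have hn1 : (1 : ℝ) ≤ n := by exact_mod_cast hn
  calc ‖x‖ ^ (N + 1) ≤ (∑ i, |x i|) ^ (N + 1) := by gcongr; exact norm_le_sum_abs x
    _ ≤ (∑ i, |x i| ^ (N + 1)) * n ^ N := h1
    _ ≤ (∑ i, |x i| ^ (N + 1)) * n ^ (N + 1) := by gcongr; omega
    _ ≤ _ := by linarith

theorem one_add_norm_pow_le_sum {n : ℕ} (N : ℕ) (x : Rn n) :
    (1 + ‖x‖) ^ N ≤ 2 ^ N * (2 + (n : ℝ) ^ N * ∑ i, |x i| ^ N) := by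
  have h := add_pow_le zero_le_one (norm_nonneg x) N
  rw [one_pow] at h
  refine h.trans ?_
  have h2 : (2 : ℝ) ^ (N - 1) ≤ 2 ^ N := pow_le_pow_right₀ one_le_two (Nat.sub_le _ _)
  have h3 := norm_pow_le_sum N x
  exact mul_le_mul h2 (by linarith) (by positivity) (by positivity)

/-- Weighted bounds for the derivatives of the functions of the class `𝒮_N`. -/
theorem testClass_weighted_le {n N k : ℕ} (hk : k ≤ N) {Φ : 𝓢(Rn n, ℂ)} (hΦ : Φ ∈ testClass n N)
    (idx : Fin k → Fin n) (x : Rn n) :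
    (1 + ‖x‖) ^ N * ‖(∂^{fun j => EuclideanSpace.basisFun (Fin n) ℝ (idx j)} Φ) x‖ ≤
      2 ^ N * (2 + (n : ℝ) ^ N * n) := by
  rw [SchwartzMap.iteratedLineDerivOp_eq_iteratedFDeriv]
  simp only [EuclideanSpace.basisFun_apply]
  set D := ‖iteratedFDeriv ℝ k Φ x fun j => EuclideanSpace.single (idx j) (1 : ℝ)‖ with hD
  -- The weight α = 0 bounds the derivative itself and α = N e_i bounds its product with |x_i|^N.
  -- Together they control the weight (1 + |x|)^N.
  have h0 : D ≤ 1 := by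
    have := hΦ 0 (by simp) k hk idx x
    simpa using this
  have hi : ∀ i, |x i| ^ N * D ≤ 1 := by
    intro i
    have := hΦ (Pi.single i N) (by simp) k hk idx x
    rw [norm_mul, norm_prod] at this
    rw [Finset.prod_eq_single i (fun j _ hj => by simp [Pi.single_eq_of_ne hj]) (by simp)] at this
    simpa using this
  have hD0 : 0 ≤ D := norm_nonneg _
  calc _ ≤ (2 ^ N * (2 + (n : ℝ) ^ N * ∑ i, |x i| ^ N)) * D := by
        gcongr; exact one_add_norm_pow_le_sum N x
    _ = 2 ^ N * (2 * D + (n : ℝ) ^ N * ∑ i, |x i| ^ N * D) := by rw [← Finset.sum_mul]; ring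
    _ ≤ 2 ^ N * (2 * 1 + (n : ℝ) ^ N * ∑ i : Fin n, 1) := by
        gcongr with i
        exact hi i
    _ = _ := by simp

theorem lapPow_le_of_mem_testClass {n N k : ℕ} (hk : 2 * k ≤ N) {Φ : 𝓢(Rn n, ℂ)}
    (hΦ : Φ ∈ testClass n N) (x : Rn n) :
    (1 + ‖x‖) ^ N * ‖lapPow k Φ x‖ ≤ n ^ k * (2 ^ N * (2 + (n : ℝ) ^ N * n)) :=
  weighted_lapPow_le (fun idx x => testClass_weighted_le hk hΦ idx x) x

theorem laplacian_dilate {n : ℕ} (Φ : 𝓢(Rn n, ℂ)) {s : ℝ} (hs : 0 < s) :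
    Laplacian.laplacian (dilate Φ s hs) = (s⁻¹ ^ 2 : ℝ) • dilate (Laplacian.laplacian Φ) s hs := by
  have h1 : ∀ (Ψ : 𝓢(Rn n, ℂ)) (m : Rn n), ∂_{m} (dilate Ψ s hs) = s⁻¹ • dilate (∂_{m} Ψ) s hs := by
    intro Ψ m
    unfold dilate
    rw [lineDerivOp_smul, SchwartzMap.lineDerivOp_compCLMOfContinuousLinearEquiv]
    have : (ContinuousLinearEquiv.smulLeft (Units.mk0 s⁻¹ (inv_ne_zero hs.ne')) : Rn n ≃L[ℝ] Rn n) m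
        = s⁻¹ • m := rfl
    rw [this, lineDerivOp_left_smul, smul_comm]
    congr 1
  have h2 : ∀ (a : ℝ) (Ψ : 𝓢(Rn n, ℂ)), dilate (a • Ψ) s hs = a • dilate Ψ s hs := by
    intro a Ψ
    ext x
    simp only [dilate_apply, smul_apply, Complex.real_smul]
    ring
  rw [SchwartzMap.laplacian_eq_sum (EuclideanSpace.basisFun (Fin n) ℝ),
    SchwartzMap.laplacian_eq_sum (EuclideanSpace.basisFun (Fin n) ℝ)]
  simp only [h1, lineDerivOp_smul, smul_smul]
  ext x
  simp only [sum_apply, smul_apply, dilate_apply, Complex.real_smul, Finset.mul_sum]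
  refine Finset.sum_congr rfl fun i _ => ?_
  push_cast; ring

/-- The factor s^{-2k} is the S^{-k} required by `norm_limit_le_of_iterated_deriv_bound`, with S =
s² the parabolic time attached to the scale s. -/
theorem lapPow_dilate {n : ℕ} (k : ℕ) (Φ : 𝓢(Rn n, ℂ)) {s : ℝ} (hs : 0 < s) :
    lapPow k (dilate Φ s hs) = ((s ^ 2) ^ k)⁻¹ • dilate (lapPow k Φ) s hs := by
  induction k with
  | zero => simp [lapPow]
  | succ k ih =>
    rw [lapPow_succ, ih, lapPow_succ]
    have : Laplacian.laplacian (((s ^ 2) ^ k)⁻¹ • dilate (lapPow k Φ) s hs) =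
        ((s ^ 2) ^ k)⁻¹ • Laplacian.laplacian (dilate (lapPow k Φ) s hs) :=
      (LineDeriv.laplacianCLM ℝ (Rn n) 𝓢(Rn n, ℂ)).map_smul _ _
    rw [this, laplacian_dilate, smul_smul]
    congr 1
    rw [pow_succ (s ^ 2), mul_inv, inv_pow]

/-! ### The grand maximal function is controlled by the caloric extension -/

/-- Reconstruction of f * Φ_s from the caloric extension. Pairing Δ^k Φ_s with U(r, x - ·) costs
(r/s²)^{-b/2} for r ≤ s². Since b/2 < K + 1, a Taylor expansion with remainder of order K + 1
absorbs this; N > n + b makes the spatial integral converge. -/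
theorem exists_conv_dilate_le {n N K : ℕ} {b : ℝ} (hb0 : 0 ≤ b) (hbK : b < 2 * (K + 1))
    (hKN : 2 * (K + 1) ≤ N) (hbN : n + b < N) :
    ∃ C : ℝ, 0 < C ∧ ∀ h : 𝓢'(Rn n, ℂ), IsBoundedDistribution h → ∀ (x : Rn n) (A : ℝ), 0 ≤ A →
      (∀ θ > 0, ∀ y, ‖caloric h θ (x - y)‖ ≤ A * (1 + ‖y‖ / √θ) ^ b) →
      ∀ Φ ∈ testClass n N, ∀ (s : ℝ) (hs : 0 < s), ‖conv h (dilate Φ s hs) x‖ ≤ C * A := by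
  set B : ℝ := ((n : ℝ) + 1) ^ (K + 1) * (2 ^ N * (2 + (n : ℝ) ^ N * n)) with hB
  set I : ℝ := ∫ y : Rn n, (1 + ‖y‖) ^ (-((N : ℝ) - b)) with hI
  have hI0 : 0 ≤ I := integral_nonneg fun y => by positivity
  have hint : Integrable fun y : Rn n => (1 + ‖y‖) ^ (-((N : ℝ) - b)) :=
    integrable_one_add_norm (by rw [finrank_euclideanSpace_fin]; linarith)
  have hB0 : 0 ≤ B := by positivity
  have hβ : b / 2 < (K : ℝ) + 1 := by linarith
  have hβ' : 0 < (K : ℝ) + 1 - b / 2 := by linarith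
  -- The constant of the Taylor lemma; the added 1 keeps it positive.
  refine ⟨B * I * ((K + 1) + 1 / (K + 1 - b / 2)) + 1, by positivity,
    fun h hh x A hA hU Φ hΦ s hs => ?_⟩
  set Ψ := dilate Φ s hs with hΨ
  let V : ℕ → ℝ → ℂ := fun k r => (4⁻¹ : ℂ) ^ k * conv h (sconv (heat n r) (lapPow k Ψ)) x
  have hV : ∀ k, ∀ r > 0, HasDerivAt (V k) (V (k + 1) r) r := by
    intro k r hr
    refine ((hasDerivAt_conv_sconv_heat hh (lapPow k Ψ) hr x).const_mul ((4⁻¹ : ℂ) ^ k)).congr_deriv ?_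
    simp only [V, lapPow_succ, pow_succ]
    ring
  have hL : ∀ k, Tendsto (V k) (𝓝[>] 0) (𝓝 ((4⁻¹ : ℂ) ^ k * conv h (lapPow k Ψ) x)) := by
    intro k
    obtain ⟨C, hC⟩ := hh (lapPow k Ψ)
    refine ((tendsto_heatT_zero (continuous_conv h (lapPow k Ψ)) hC x).const_mul _).congr' ?_
    filter_upwards [self_mem_nhdsWithin] with r hr
    simp only [V, conv_sconv_heat h _ hr]
  have hlap : ∀ k ≤ K + 1, ∀ y, ‖lapPow k Ψ y‖ ≤
      ((s ^ 2) ^ k)⁻¹ * (B * ((s ^ n)⁻¹ * (1 + ‖s⁻¹ • y‖) ^ (-(N : ℝ)))) := by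
    intro k hk y
    have h1 := lapPow_le_of_mem_testClass (k := k) (by omega) hΦ (s⁻¹ • y)
    have h2 : (n : ℝ) ^ k * (2 ^ N * (2 + (n : ℝ) ^ N * n)) ≤ B := by
      rw [hB]
      gcongr
      calc (n : ℝ) ^ k ≤ ((n : ℝ) + 1) ^ k := by gcongr; linarith
        _ ≤ _ := pow_le_pow_right₀ (by linarith [(Nat.cast_nonneg n : (0 : ℝ) ≤ n)]) hk
    have h3 : ‖lapPow k Φ (s⁻¹ • y)‖ ≤ B * (1 + ‖s⁻¹ • y‖) ^ (-(N : ℝ)) := by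
      rw [Real.rpow_neg (by positivity), Real.rpow_natCast, ← div_eq_mul_inv,
        le_div_iff₀ (by positivity), mul_comm]
      exact h1.trans h2
    have hsn : ‖((s : ℂ) ^ n)⁻¹‖ = (s ^ n)⁻¹ := by
      rw [norm_inv, norm_pow, Complex.norm_real, Real.norm_of_nonneg hs.le]
    rw [hΨ, lapPow_dilate, smul_apply, norm_smul, dilate_apply, norm_mul, hsn,
      Real.norm_of_nonneg (by positivity)]
    gcongr ((s ^ 2) ^ k)⁻¹ * ?_
    calc (s ^ n)⁻¹ * ‖lapPow k Φ (s⁻¹ • y)‖ ≤ (s ^ n)⁻¹ * (B * (1 + ‖s⁻¹ • y‖) ^ (-(N : ℝ))) := by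
          gcongr
      _ = _ := by ring
  have hbound : ∀ k ≤ K + 1, ∀ r, 0 < r → r ≤ s ^ 2 →
      ‖V k r‖ ≤ (A * B * I) * ((s ^ 2) ^ k)⁻¹ * (r / s ^ 2) ^ (-(b / 2)) := by
    intro k hk r hr hrs
    have hr' : √r ≤ s := by rw [← Real.sqrt_sq hs.le]; exact Real.sqrt_le_sqrt hrs
    have hsr : 0 < √r := Real.sqrt_pos.2 hr
    have hpt : ∀ y, ‖lapPow k Ψ y * caloric h r (x - y)‖ ≤
        (A * B * ((s ^ 2) ^ k)⁻¹ * (r / s ^ 2) ^ (-(b / 2)) * (s ^ n)⁻¹) *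
          (1 + ‖s⁻¹ • y‖) ^ (-((N : ℝ) - b)) := by
      intro y
      -- Since √r ≤ s, the growth at scale √r is exchanged for growth at scale s, at the price of a
      -- factor s/√r.
      have h1 : 1 + ‖y‖ / √r ≤ (s / √r) * (1 + ‖s⁻¹ • y‖) := by
        rw [norm_smul, norm_inv, Real.norm_of_nonneg hs.le]
        have : 1 ≤ s / √r := (one_le_div hsr).2 hr'
        have h2 : (s / √r) * (1 + s⁻¹ * ‖y‖) = s / √r + ‖y‖ / √r := by field_simp
        rw [h2]; linarith
      have h2 : (1 + ‖y‖ / √r) ^ b ≤ (r / s ^ 2) ^ (-(b / 2)) * (1 + ‖s⁻¹ • y‖) ^ b := by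
        calc (1 + ‖y‖ / √r) ^ b ≤ ((s / √r) * (1 + ‖s⁻¹ • y‖)) ^ b :=
              Real.rpow_le_rpow (by positivity) h1 hb0
          _ = (s / √r) ^ b * (1 + ‖s⁻¹ • y‖) ^ b := Real.mul_rpow (by positivity) (by positivity)
          _ = _ := by
              congr 1
              have h3 : r / s ^ 2 = (√r / s) ^ (2 : ℝ) := by
                rw [Real.rpow_two, div_pow, Real.sq_sqrt hr.le]
              rw [h3, ← Real.rpow_mul (by positivity)]
              have h4 : (2 : ℝ) * -(b / 2) = -b := by ring
              rw [h4, Real.rpow_neg (by positivity), ← Real.inv_rpow (by positivity), inv_div]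
      rw [norm_mul]
      calc _ ≤ (((s ^ 2) ^ k)⁻¹ * (B * ((s ^ n)⁻¹ * (1 + ‖s⁻¹ • y‖) ^ (-(N : ℝ))))) *
            (A * ((r / s ^ 2) ^ (-(b / 2)) * (1 + ‖s⁻¹ • y‖) ^ b)) := by
            refine mul_le_mul (hlap k hk y) ((hU r hr y).trans ?_) (norm_nonneg _) (by positivity)
            gcongr
        _ = (A * B * ((s ^ 2) ^ k)⁻¹ * (r / s ^ 2) ^ (-(b / 2)) * (s ^ n)⁻¹) *
            ((1 + ‖s⁻¹ • y‖) ^ (-(N : ℝ)) * (1 + ‖s⁻¹ • y‖) ^ b) := by ring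
        _ = _ := by
            rw [← Real.rpow_add (by positivity)]
            congr 2; ring
    have hscale : ∫ y : Rn n, (1 + ‖s⁻¹ • y‖) ^ (-((N : ℝ) - b)) = s ^ n * I := by
      have := Measure.integral_comp_inv_smul_of_nonneg (volume : Measure (Rn n))
        (fun y => (1 + ‖y‖) ^ (-((N : ℝ) - b))) hs.le
      rw [this, finrank_euclideanSpace_fin, smul_eq_mul]
    have hint' : Integrable fun y : Rn n => (1 + ‖s⁻¹ • y‖) ^ (-((N : ℝ) - b)) :=
      hint.comp_smul (inv_ne_zero hs.ne')
    simp only [V, norm_mul, norm_pow, conv_sconv_heat']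
    have h4 : ‖(4⁻¹ : ℂ)‖ ^ k ≤ 1 := pow_le_one₀ (norm_nonneg _) (by norm_num)
    have h5 := norm_integral_le_of_norm_le (hint'.const_mul _) (Eventually.of_forall hpt)
    rw [integral_const_mul, hscale] at h5
    calc _ ≤ 1 * _ := mul_le_mul h4 h5 (norm_nonneg _) zero_le_one
      _ = _ := by field_simp
  have hfin := norm_limit_le_of_iterated_deriv_bound hV hL (K := K) (A := A * B * I)
    (S := s ^ 2) (β := b / 2) (by positivity) (by positivity) hβ hbound
  have h0 : lapPow 0 Ψ = Ψ := rfl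
  rw [pow_zero, one_mul, h0] at hfin
  calc _ ≤ _ := hfin
    _ = (B * I * ((K + 1) + 1 / (K + 1 - b / 2))) * A := by ring
    _ ≤ _ := by gcongr; linarith

/-! ### The non-tangential maximal function -/

/-- The non-tangential maximal function of the caloric extension. -/
def ntMax {n : ℕ} (f : 𝓢'(Rn n, ℂ)) (x : Rn n) : ℝ≥0∞ :=
  ⨆ (θ : ℝ) (_ : 0 < θ) (z : Rn n) (_ : ‖z - x‖ ^ 2 < θ), ‖caloric f θ z‖ₑ

theorem le_ntMax {n : ℕ} (f : 𝓢'(Rn n, ℂ)) {θ : ℝ} {z x : Rn n} (h : ‖z - x‖ ^ 2 < θ) :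
    ‖caloric f θ z‖ₑ ≤ ntMax f x :=
  le_iSup₂_of_le θ ((sq_nonneg _).trans_lt h) (le_iSup₂_of_le z h le_rfl)

theorem ntMax_le {n : ℕ} {f : 𝓢'(Rn n, ℂ)} {x : Rn n} {a : ℝ≥0∞}
    (h : ∀ θ z, ‖z - x‖ ^ 2 < θ → ‖caloric f θ z‖ₑ ≤ a) : ntMax f x ≤ a :=
  iSup₂_le fun θ _ => iSup₂_le fun z hz => h θ z hz

/-- The cone condition |z - x|² < θ is open in x. This gives measurability and closed sublevel sets,
both needed later. -/
theorem lowerSemicontinuous_ntMax {n : ℕ} (f : 𝓢'(Rn n, ℂ)) :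
    LowerSemicontinuous (ntMax f) := by
  intro x a ha
  simp only [ntMax, lt_iSup_iff] at ha
  obtain ⟨θ, hθ, z, hz, hlt⟩ := ha
  have : Continuous fun y : Rn n => ‖z - y‖ ^ 2 := by fun_prop
  filter_upwards [(isOpen_lt this continuous_const).mem_nhds hz] with y hy
  exact hlt.trans_le (le_ntMax f hy)

theorem measurable_ntMax {n : ℕ} (f : 𝓢'(Rn n, ℂ)) : Measurable (ntMax f) :=
  (lowerSemicontinuous_ntMax f).measurable

theorem cube_eq_preimage {n : ℕ} (c : Rn n) {r : ℝ} (hr : 0 ≤ r) :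
    cube c r = (WithLp.ofLp : Rn n → Fin n → ℝ) ⁻¹' Metric.closedBall (WithLp.ofLp c) r := by
  ext y
  simp [cube, dist_pi_le_iff hr, Real.dist_eq]

theorem volume_cube {n : ℕ} (c : Rn n) {r : ℝ} (hr : 0 ≤ r) :
    volume (cube c r) = ENNReal.ofReal ((2 * r) ^ n) := by
  rw [cube_eq_preimage c hr,
    (PiLp.volume_preserving_ofLp (Fin n)).measure_preimage
      Metric.isClosed_closedBall.measurableSet.nullMeasurableSet,
    Real.volume_pi_closedBall _ hr, Fintype.card_fin]

/-- Every point of the ball of radius √θ about x - y has (θ, x - y) in its cone, so |U| there is at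
most `ntMax f`. The ball lies in the cube about x of half-side |y| + √θ, and the ratio of the
volumes gives the last factor. Finiteness almost everywhere lets the real-valued power replace
`ntMax f`, as `maximal` requires. -/
theorem caloric_rpow_le {n : ℕ} {f : 𝓢'(Rn n, ℂ)} (hf : ∀ᵐ z, ntMax f z < ∞) {p₀ : ℝ}
    (hp₀ : 0 < p₀) {θ : ℝ} (hθ : 0 < θ) (x y : Rn n) :
    ‖caloric f θ (x - y)‖ₑ ^ p₀ ≤ ENNReal.ofReal (2 ^ n) / volume (Metric.ball (0 : Rn n) 1) *
      maximal (fun z => (ntMax f z).toReal ^ p₀) x * ENNReal.ofReal ((1 + ‖y‖ / √θ) ^ n) := by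
  set r := √θ
  have hr : 0 < r := Real.sqrt_pos.2 hθ
  set R := ‖y‖ + r
  have hR : 0 < R := by positivity
  set g : Rn n → ℝ := fun z => (ntMax f z).toReal ^ p₀
  set v := volume (Metric.ball (0 : Rn n) 1)
  have hv0 : v ≠ 0 := (Metric.measure_ball_pos volume _ one_pos).ne'
  have hv1 : v ≠ ∞ := measure_ball_lt_top.ne
  have hg : ∀ᵐ z, ‖g z‖ₑ = ntMax f z ^ p₀ := by
    filter_upwards [hf] with z hz
    rw [Real.enorm_of_nonneg (by positivity), ENNReal.ofReal_rpow_of_nonneg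
      ENNReal.toReal_nonneg hp₀.le |>.symm, ENNReal.ofReal_toReal hz.ne]
  have hsub : Metric.ball (x - y) r ⊆ cube x R := by
    intro z hz i
    have h1 : |z i - x i| ≤ ‖z - x‖ := by
      have := PiLp.norm_apply_le (z - x) i
      simpa using this
    refine h1.trans ?_
    have h2 : ‖z - (x - y)‖ < r := by simpa [dist_eq_norm] using hz
    calc ‖z - x‖ = ‖(z - (x - y)) - y‖ := by congr 1; abel
      _ ≤ ‖z - (x - y)‖ + ‖y‖ := norm_sub_le _ _
      _ ≤ R := by simp only [R]; linarith
  have h1 : ‖caloric f θ (x - y)‖ₑ ^ p₀ * volume (Metric.ball (x - y) r) ≤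
      ∫⁻ z in cube x R, ‖g z‖ₑ := by
    calc _ = ∫⁻ z in Metric.ball (x - y) r, ‖caloric f θ (x - y)‖ₑ ^ p₀ := by
          rw [setLIntegral_const]
      _ ≤ ∫⁻ z in Metric.ball (x - y) r, ‖g z‖ₑ := by
          refine lintegral_mono_ae ?_
          filter_upwards [ae_restrict_of_ae hg, ae_restrict_mem measurableSet_ball] with z hz hzb
          rw [hz]
          refine ENNReal.rpow_le_rpow (le_ntMax f ?_) hp₀.le
          have h2 : ‖x - y - z‖ < r := by
            rw [← dist_eq_norm, dist_comm]; exact hzb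
          calc _ < r ^ 2 := by gcongr
            _ = θ := Real.sq_sqrt hθ.le
      _ ≤ _ := lintegral_mono_set hsub
  have h2 : ∫⁻ z in cube x R, ‖g z‖ₑ ≤ maximal g x * volume (cube x R) := by
    have hc0 : volume (cube x R) ≠ 0 := by
      rw [volume_cube x hR.le, ne_eq, ENNReal.ofReal_eq_zero, not_le]; positivity
    have hc1 : volume (cube x R) ≠ ∞ := by rw [volume_cube x hR.le]; exact ENNReal.ofReal_ne_top
    rw [← ENNReal.div_le_iff hc0 hc1]
    exact le_iSup₂_of_le x R (le_iSup₂_of_le hR (fun i => by simpa using hR.le) le_rfl)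
  have h3 := h1.trans h2
  rw [Measure.addHaar_ball_of_pos volume _ hr, finrank_euclideanSpace_fin, volume_cube x hR.le] at h3
  have hrn : ENNReal.ofReal (r ^ n) ≠ 0 := by
    rw [ne_eq, ENNReal.ofReal_eq_zero, not_le]; positivity
  have h4 : ‖caloric f θ (x - y)‖ₑ ^ p₀ ≤
      maximal g x * ENNReal.ofReal ((2 * R) ^ n) / (ENNReal.ofReal (r ^ n) * v) := by
    rw [ENNReal.le_div_iff_mul_le (Or.inl (mul_ne_zero hrn hv0))
      (Or.inl (ENNReal.mul_ne_top ENNReal.ofReal_ne_top hv1))]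
    exact h3
  refine h4.trans (le_of_eq ?_)
  have h5 : (2 * R) ^ n = 2 ^ n * (1 + ‖y‖ / r) ^ n * r ^ n := by
    rw [← mul_pow, ← mul_pow]
    congr 1
    simp only [R]
    field_simp; ring
  rw [h5, ENNReal.ofReal_mul (by positivity), ENNReal.ofReal_mul (by positivity),
    ENNReal.div_eq_inv_mul, ENNReal.mul_inv (Or.inl hrn) (Or.inl ENNReal.ofReal_ne_top),
    ENNReal.div_eq_inv_mul]
  calc _ = ((ENNReal.ofReal (r ^ n))⁻¹ * ENNReal.ofReal (r ^ n)) * (v⁻¹ * ENNReal.ofReal (2 ^ n) *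
        maximal g x * ENNReal.ofReal ((1 + ‖y‖ / r) ^ n)) := by ring
    _ = _ := by rw [ENNReal.inv_mul_cancel hrn ENNReal.ofReal_ne_top, one_mul]

/-- The grand maximal function is dominated by a power maximal function of `ntMax`. -/
theorem exists_grandMaximal_le {n N : ℕ} {p₀ : ℝ} (hn : 1 ≤ n) (hp₀ : 0 < p₀)
    (hN : (n : ℝ) / p₀ + n + 1 < N) :
    ∃ C : ℝ, 0 < C ∧ ∀ h : 𝓢'(Rn n, ℂ), IsBoundedDistribution h → (∀ᵐ z, ntMax h z < ∞) →
      ∀ x, grandMaximal N h x ≤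
        ENNReal.ofReal C * maximal (fun z => (ntMax h z).toReal ^ p₀) x ^ (1 / p₀) := by
  set b : ℝ := (n : ℝ) / p₀ with hb
  have hn1 : (1 : ℝ) ≤ n := by exact_mod_cast hn
  have hb0 : 0 < b := by positivity
  -- The least order with b/2 < K + 1. As n ≥ 1, 2(K + 1) ≤ b + 2 ≤ b + n + 1 < N, so 𝒮_N controls
  -- enough derivatives.
  set K := ⌊b / 2⌋₊
  have hK1 : b / 2 < K + 1 := Nat.lt_floor_add_one _
  have hK2 : (K : ℝ) ≤ b / 2 := Nat.floor_le (by positivity)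
  have hKN : 2 * (K + 1) ≤ N := by
    have : (2 * (K + 1) : ℝ) ≤ N := by linarith
    exact_mod_cast this
  obtain ⟨C, hC, hmain⟩ := exists_conv_dilate_le (n := n) (N := N) (K := K) hb0.le (by linarith)
    hKN (by linarith)
  set v := ENNReal.ofReal (2 ^ n) / volume (Metric.ball (0 : Rn n) 1) with hv
  have hv0 : v ≠ 0 := by
    refine (ENNReal.div_pos ?_ measure_ball_lt_top.ne).ne'
    rw [ne_eq, ENNReal.ofReal_eq_zero, not_le]; positivity
  have hv1 : v ≠ ∞ := ENNReal.div_ne_top ENNReal.ofReal_ne_top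
    (Metric.measure_ball_pos volume _ one_pos).ne'
  set w := v ^ (1 / p₀) with hw
  have hw0 : w ≠ 0 := by
    rw [hw, ne_eq, ENNReal.rpow_eq_zero_iff]; simp [hv0, hv1]
  have hw1 : w ≠ ∞ := ENNReal.rpow_ne_top_of_nonneg (by positivity) hv1
  have hwpos : 0 < w.toReal := ENNReal.toReal_pos hw0 hw1
  refine ⟨C * w.toReal, by positivity, fun h hh hfin x => ?_⟩
  set m := maximal (fun z => (ntMax h z).toReal ^ p₀) x with hm
  rcases eq_or_ne m ∞ with hmt | hmt
  · rw [hmt, ENNReal.top_rpow_of_pos (by positivity), ENNReal.mul_top]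
    · exact le_top
    · rw [ne_eq, ENNReal.ofReal_eq_zero, not_le]; positivity
  have hm1 : m ^ (1 / p₀) ≠ ∞ := ENNReal.rpow_ne_top_of_nonneg (by positivity) hmt
  have hU : ∀ θ > 0, ∀ y, ‖caloric h θ (x - y)‖ ≤
      (w * m ^ (1 / p₀)).toReal * (1 + ‖y‖ / √θ) ^ b := by
    intro θ hθ y
    have h1 := caloric_rpow_le hfin hp₀ hθ x y
    have h2 := ENNReal.rpow_le_rpow h1 (by positivity : 0 ≤ 1 / p₀)
    rw [← ENNReal.rpow_mul, mul_one_div_cancel hp₀.ne', ENNReal.rpow_one,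
      ENNReal.mul_rpow_of_nonneg _ _ (by positivity), ENNReal.mul_rpow_of_nonneg _ _ (by positivity),
      ENNReal.ofReal_rpow_of_nonneg (by positivity) (by positivity),
      ← Real.rpow_natCast (1 + ‖y‖ / √θ), ← Real.rpow_mul (by positivity), mul_one_div] at h2
    have h3 := ENNReal.toReal_mono (ENNReal.mul_ne_top (ENNReal.mul_ne_top hw1 hm1)
      ENNReal.ofReal_ne_top) h2
    rw [ENNReal.toReal_mul, ENNReal.toReal_ofReal (by positivity), toReal_enorm] at h3
    exact h3
  refine iSup₂_le fun Φ hΦ => iSup₂_le fun s hs => ?_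
  have h4 := hmain h hh x _ ENNReal.toReal_nonneg hU Φ hΦ s hs
  rw [← ofReal_norm]
  refine (ENNReal.ofReal_le_ofReal h4).trans (le_of_eq ?_)
  rw [ENNReal.toReal_mul, ← mul_assoc, ENNReal.ofReal_mul (by positivity), ENNReal.ofReal_toReal hm1]

/-! ### The Luxemburg functional -/

section Luxemburg

variable {n : ℕ} {p : Rn n → ℝ}

theorem modular_mono_ae (hp : ∀ x, 0 < p x) {g g' : Rn n → ℝ≥0∞} (h : g ≤ᵐ[volume] g') :
    modular p g ≤ modular p g' := by
  refine lintegral_mono_ae ?_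
  filter_upwards [h] with x hx
  exact ENNReal.rpow_le_rpow hx (hp x).le

theorem luxNorm_le {g : Rn n → ℝ≥0∞} {c : ℝ} (hc : 0 < c)
    (h : modular p (fun x => g x / ENNReal.ofReal c) ≤ 1) : luxNorm p g ≤ ENNReal.ofReal c :=
  iInf₂_le_of_le c hc (iInf_le _ h)

theorem exists_modular_le_one {g : Rn n → ℝ≥0∞} {a : ℝ≥0∞} (h : luxNorm p g < a) :
    ∃ c : ℝ, 0 < c ∧ ENNReal.ofReal c < a ∧ modular p (fun x => g x / ENNReal.ofReal c) ≤ 1 := by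
  simp only [luxNorm, iInf_lt_iff] at h
  obtain ⟨c, hc, h1, h2⟩ := h
  exact ⟨c, hc, h2, h1⟩

theorem luxNorm_mono_ae (hp : ∀ x, 0 < p x) {g g' : Rn n → ℝ≥0∞} (h : g ≤ᵐ[volume] g') :
    luxNorm p g ≤ luxNorm p g' := by
  refine le_iInf₂ fun c hc => le_iInf fun h1 => luxNorm_le hc ((modular_mono_ae hp ?_).trans h1)
  filter_upwards [h] with x hx
  exact ENNReal.div_le_div_right hx _

theorem luxNorm_const_mul_le {C : ℝ} (hC : 0 < C) (g : Rn n → ℝ≥0∞) :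
    luxNorm p (fun x => ENNReal.ofReal C * g x) ≤ ENNReal.ofReal C * luxNorm p g := by
  have hC0 : ENNReal.ofReal C ≠ 0 := by rw [ne_eq, ENNReal.ofReal_eq_zero, not_le]; exact hC
  rw [mul_comm, ← ENNReal.div_le_iff hC0 ENNReal.ofReal_ne_top]
  refine le_iInf₂ fun c hc => le_iInf fun h1 => ?_
  rw [ENNReal.div_le_iff hC0 ENNReal.ofReal_ne_top, mul_comm, ← ENNReal.ofReal_mul hC.le]
  refine luxNorm_le (mul_pos hC hc) (le_trans (le_of_eq ?_) h1)
  congr 1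
  funext x
  rw [ENNReal.ofReal_mul hC.le, ENNReal.mul_div_mul_left _ _ hC0 ENNReal.ofReal_ne_top]

/-- The powers 1/q and p/q combine in the integrand. Thus L^{p(·)} norms of 1/q-th powers become
L^{p(·)/q} norms, where for q = p₀ the maximal operator is bounded. -/
theorem modular_rpow {q : ℝ} (hq : 0 < q) (g : Rn n → ℝ≥0∞) {c : ℝ} (hc : 0 < c) :
    modular p (fun x => g x ^ (1 / q) / ENNReal.ofReal (c ^ (1 / q))) =
      modular (fun x => p x / q) (fun x => g x / ENNReal.ofReal c) := by
  unfold modular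
  congr 1
  funext x
  beta_reduce
  rw [← ENNReal.ofReal_rpow_of_nonneg hc.le (by positivity),
    ← ENNReal.div_rpow_of_nonneg _ _ (by positivity), ← ENNReal.rpow_mul]
  congr 1
  ring

theorem luxNorm_rpow_le {q : ℝ} (hq : 0 < q) (g : Rn n → ℝ≥0∞) :
    luxNorm p (fun x => g x ^ (1 / q)) ≤ luxNorm (fun x => p x / q) g ^ (1 / q) := by
  have h : luxNorm p (fun x => g x ^ (1 / q)) ^ q ≤ luxNorm (fun x => p x / q) g := by
    refine le_iInf₂ fun c hc => le_iInf fun h1 => ?_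
    have h2 := luxNorm_le (p := p) (g := fun x => g x ^ (1 / q)) (c := c ^ (1 / q)) (by positivity)
      (by rw [modular_rpow hq g hc]; exact h1)
    refine (ENNReal.rpow_le_rpow h2 hq.le).trans (le_of_eq ?_)
    rw [ENNReal.ofReal_rpow_of_nonneg (by positivity) hq.le, ← Real.rpow_mul hc.le,
      one_div_mul_cancel hq.ne', Real.rpow_one]
  have h3 := ENNReal.rpow_le_rpow h (by positivity : 0 ≤ 1 / q)
  rwa [← ENNReal.rpow_mul, mul_one_div_cancel hq.ne', ENNReal.rpow_one] at h3

theorem luxNorm_div_rpow_le {q : ℝ} (hq : 0 < q) (g : Rn n → ℝ≥0∞) :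
    luxNorm (fun x => p x / q) (fun x => g x ^ q) ≤ luxNorm p g ^ q := by
  have h : luxNorm (fun x => p x / q) (fun x => g x ^ q) ^ (1 / q) ≤ luxNorm p g := by
    refine le_iInf₂ fun c hc => le_iInf fun h1 => ?_
    have h2 := luxNorm_le (p := fun x => p x / q) (g := fun x => g x ^ q) (c := c ^ q)
      (by positivity) (by
        rw [← modular_rpow hq _ (by positivity)]
        simpa only [← ENNReal.rpow_mul, ← Real.rpow_mul hc.le, mul_one_div_cancel hq.ne',
          ENNReal.rpow_one, Real.rpow_one] using h1)
    refine (ENNReal.rpow_le_rpow h2 (by positivity)).trans (le_of_eq ?_)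
    rw [ENNReal.ofReal_rpow_of_nonneg (by positivity) (by positivity), ← Real.rpow_mul hc.le,
      mul_one_div_cancel hq.ne', Real.rpow_one]
  have h3 := ENNReal.rpow_le_rpow h hq.le
  rwa [← ENNReal.rpow_mul, one_div_mul_cancel hq.ne', ENNReal.rpow_one] at h3

theorem ae_lt_top_of_luxNorm_lt_top (hp : MemP0 p) {g : Rn n → ℝ≥0∞} (hg : AEMeasurable g volume)
    (h : luxNorm p g < ∞) : ∀ᵐ x, g x < ∞ := by
  obtain ⟨c, hc, -, hm⟩ := exists_modular_le_one h
  have h1 : ∀ᵐ x, (g x / ENNReal.ofReal c) ^ p x < ∞ :=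
    ae_lt_top' ((hg.div_const _).pow hp.aemeasurable) (hm.trans_lt ENNReal.one_lt_top).ne
  filter_upwards [h1] with x hx
  by_contra hxt
  rw [not_lt, top_le_iff] at hxt
  rw [hxt, ENNReal.top_div_of_ne_top ENNReal.ofReal_ne_top, ENNReal.top_rpow_of_pos (hp.pos x)] at hx
  exact lt_irrefl _ hx

/-- Every scale c is needed, because the modular at scale c only shows that the norm is eventually
at most c. -/
theorem tendsto_luxNorm_zero {ι : Type*} {l : Filter ι} {g : ι → Rn n → ℝ≥0∞}
    (h : ∀ c : ℝ, 0 < c → Tendsto (fun i => modular p (fun x => g i x / ENNReal.ofReal c)) l (𝓝 0)) :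
    Tendsto (fun i => luxNorm p (g i)) l (𝓝 0) := by
  rw [ENNReal.tendsto_nhds_zero]
  intro ε hε
  obtain ⟨c, hc, hcε⟩ : ∃ c : ℝ, 0 < c ∧ ENNReal.ofReal c ≤ ε := by
    rcases eq_or_ne ε ∞ with rfl | hεt
    · exact ⟨1, one_pos, le_top⟩
    · exact ⟨ε.toReal, ENNReal.toReal_pos hε.ne' hεt, ENNReal.ofReal_toReal_le⟩
  filter_upwards [ENNReal.tendsto_nhds_zero.1 (h c hc) 1 one_pos] with i hi
  exact (luxNorm_le hc hi).trans hcε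

theorem ae_lt_of_lt_pMinus {p₀ : ℝ} (h : ENNReal.ofReal p₀ < pMinus p) :
    ∀ᵐ x, p₀ < p x := by
  filter_upwards [ae_lt_of_lt_essInf (f := fun x => ENNReal.ofReal (p x)) h] with x hx
  exact (ENNReal.ofReal_lt_ofReal_iff'.1 hx).1

/-- A function in the variable Lebesgue space takes controlled values on every small ball. -/
theorem exists_le_of_luxNorm_lt_top {p₀ : ℝ} (hp₀ : 0 < p₀) (hlt : ENNReal.ofReal p₀ < pMinus p)
    {g : Rn n → ℝ≥0∞} (h : luxNorm p g < ∞) :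
    ∃ A : ℝ, 0 < A ∧ ∀ (x : Rn n) (r : ℝ), 0 < r → r ≤ 1 →
      ∃ y ∈ Metric.ball x r, g y ≤ ENNReal.ofReal (A * r ^ (-((n : ℝ) / p₀))) := by
  obtain ⟨c, hc, -, hm⟩ := exists_modular_le_one h
  set v := (volume (Metric.ball (0 : Rn n) 1)).toReal with hv
  have hv0 : 0 < v := ENNReal.toReal_pos (Metric.measure_ball_pos volume _ one_pos).ne'
    measure_ball_lt_top.ne
  have hvv : volume (Metric.ball (0 : Rn n) 1) = ENNReal.ofReal v :=
    (ENNReal.ofReal_toReal measure_ball_lt_top.ne).symm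
  -- D is chosen so that D^{p₀} v > 1: if g were larger than c D r^{-n/p₀} on the whole ball, its
  -- modular at scale c would exceed 1.
  set D : ℝ := 1 + v⁻¹ ^ (1 / p₀) with hD
  have hD1 : 1 ≤ D := by rw [hD]; have : 0 ≤ v⁻¹ ^ (1 / p₀) := by positivity
                         linarith
  have hDv : 1 < D ^ p₀ * v := by
    have h1 : v⁻¹ ^ (1 / p₀) < D := by rw [hD]; linarith
    have h2 := Real.rpow_lt_rpow (by positivity) h1 hp₀
    rw [← Real.rpow_mul (by positivity), one_div_mul_cancel hp₀.ne', Real.rpow_one] at h2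
    rwa [inv_lt_iff_one_lt_mul₀ hv0] at h2
  refine ⟨c * D, by positivity, fun x r hr hr1 => ?_⟩
  by_contra! hcon
  set e : ℝ := D * r ^ (-((n : ℝ) / p₀)) with he
  have hr2 : 1 ≤ r ^ (-((n : ℝ) / p₀)) :=
    Real.one_le_rpow_of_pos_of_le_one_of_nonpos hr hr1 (by
      have : 0 ≤ (n : ℝ) / p₀ := by positivity
      linarith)
  -- Because e ≥ 1, the variable power e^{p(y)} is bounded below by e^{p₀}. This is where r ≤ 1 is
  -- needed.
  have he1 : 1 ≤ e := by rw [he]; nlinarith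
  have key : ENNReal.ofReal (e ^ p₀) * volume (Metric.ball x r) ≤ 1 := by
    calc _ = ∫⁻ y in Metric.ball x r, ENNReal.ofReal (e ^ p₀) := by rw [setLIntegral_const]
      _ ≤ ∫⁻ y in Metric.ball x r, (g y / ENNReal.ofReal c) ^ p y := by
          refine lintegral_mono_ae ?_
          filter_upwards [ae_restrict_of_ae (ae_lt_of_lt_pMinus hlt),
            ae_restrict_mem measurableSet_ball] with y hy hyb
          have h1 := hcon y hyb
          have h2 : ENNReal.ofReal e ≤ g y / ENNReal.ofReal c := by
            rw [ENNReal.le_div_iff_mul_le (Or.inl (by simpa using hc)) (Or.inl ENNReal.ofReal_ne_top),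
              ← ENNReal.ofReal_mul (by positivity)]
            refine le_trans (le_of_eq ?_) h1.le
            congr 1
            rw [he]; ring
          calc ENNReal.ofReal (e ^ p₀) ≤ ENNReal.ofReal (e ^ p y) :=
                ENNReal.ofReal_le_ofReal (Real.rpow_le_rpow_of_exponent_le he1 hy.le)
            _ = ENNReal.ofReal e ^ p y :=
                (ENNReal.ofReal_rpow_of_nonneg (by positivity) (hp₀.trans hy).le).symm
            _ ≤ _ := ENNReal.rpow_le_rpow h2 (hp₀.trans hy).le
      _ ≤ _ := setLIntegral_le_lintegral _ _
      _ ≤ 1 := hm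
  rw [Measure.addHaar_ball_of_pos volume _ hr, finrank_euclideanSpace_fin, hvv,
    ← ENNReal.ofReal_mul (by positivity), ← ENNReal.ofReal_mul (by positivity),
    ENNReal.ofReal_le_one] at key
  have h3 : e ^ p₀ * (r ^ n * v) = D ^ p₀ * v := by
    rw [he, Real.mul_rpow (by positivity) (by positivity), ← Real.rpow_mul hr.le]
    have : -((n : ℝ) / p₀) * p₀ = -(n : ℝ) := by field_simp
    rw [this, Real.rpow_neg hr.le, Real.rpow_natCast]
    field_simp
  rw [h3] at key
  linarith

end Luxemburg

/-! ### Pointwise bounds by the grand maximal function -/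

theorem smul_mem_testClass {n N : ℕ} {Φ : 𝓢(Rn n, ℂ)} {B c : ℝ} (hc : 0 ≤ c) (hcB : c * B ≤ 1)
    (h : ∀ j ≤ N, ∀ x, (1 + ‖x‖) ^ N * ‖iteratedFDeriv ℝ j Φ x‖ ≤ B) :
    (c : ℂ) • Φ ∈ testClass n N := by
  intro α hα k hk idx x
  have h1 : iteratedFDeriv ℝ k (⇑((c : ℂ) • Φ)) x = (c : ℂ) • iteratedFDeriv ℝ k Φ x :=
    iteratedFDeriv_const_smul_apply (Φ.smooth k).contDiffAt
  rw [h1, smul_apply, norm_mul, norm_smul, norm_prod, Complex.norm_real,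
    Real.norm_of_nonneg hc]
  have h2 : ∏ i, ‖(x i : ℂ) ^ α i‖ ≤ (1 + ‖x‖) ^ N := by
    calc ∏ i, ‖(x i : ℂ) ^ α i‖ ≤ ∏ i, (1 + ‖x‖) ^ α i := by
          refine Finset.prod_le_prod (fun i _ => norm_nonneg _) fun i _ => ?_
          rw [norm_pow, Complex.norm_real]
          have := PiLp.norm_apply_le x i
          gcongr
          linarith
      _ = (1 + ‖x‖) ^ ∑ i, α i := Finset.prod_pow_eq_pow_sum _ _ _
      _ ≤ _ := pow_le_pow_right₀ (by linarith [norm_nonneg x]) hα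
  have h3 : ‖iteratedFDeriv ℝ k Φ x fun j => EuclideanSpace.single (idx j) (1 : ℝ)‖ ≤
      ‖iteratedFDeriv ℝ k Φ x‖ := by
    refine (ContinuousMultilinearMap.le_opNorm _ _).trans ?_
    simp
  calc _ ≤ (1 + ‖x‖) ^ N * (c * ‖iteratedFDeriv ℝ k Φ x‖) := by gcongr
    _ = c * ((1 + ‖x‖) ^ N * ‖iteratedFDeriv ℝ k Φ x‖) := by ring
    _ ≤ c * B := by gcongr; exact h k hk x
    _ ≤ 1 := hcB

theorem conv_smul {n : ℕ} (f : 𝓢'(Rn n, ℂ)) (c : ℂ) (Φ : 𝓢(Rn n, ℂ)) (x : Rn n) :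
    conv f (c • Φ) x = c * conv f Φ x := by
  rw [← convCLM_apply, map_smul, smul_eq_mul, convCLM_apply]

theorem dilate_smul {n : ℕ} (c : ℂ) (Φ : 𝓢(Rn n, ℂ)) {s : ℝ} (hs : 0 < s) :
    dilate (c • Φ) s hs = c • dilate Φ s hs := by
  ext x
  simp only [dilate_apply, smul_apply, smul_eq_mul]
  ring

theorem conv_dilate_le_grandMaximal {n N : ℕ} (f : 𝓢'(Rn n, ℂ)) {Φ : 𝓢(Rn n, ℂ)} {B : ℝ}
    (hB : 0 < B) (h : ∀ j ≤ N, ∀ x, (1 + ‖x‖) ^ N * ‖iteratedFDeriv ℝ j Φ x‖ ≤ B)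
    {s : ℝ} (hs : 0 < s) (x : Rn n) :
    ‖conv f (dilate Φ s hs) x‖ₑ ≤ ENNReal.ofReal B * grandMaximal N f x := by
  have h1 := smul_mem_testClass (inv_nonneg.2 hB.le) (inv_mul_cancel₀ hB.ne').le h
  have h2 : ‖conv f (dilate (((B⁻¹ : ℝ) : ℂ) • Φ) s hs) x‖ₑ ≤ grandMaximal N f x :=
    le_iSup₂_of_le _ h1 (le_iSup₂_of_le s hs le_rfl)
  rw [dilate_smul, conv_smul, enorm_mul] at h2
  have h3 : ‖((B⁻¹ : ℝ) : ℂ)‖ₑ = (ENNReal.ofReal B)⁻¹ := by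
    rw [← ofReal_norm, Complex.norm_real, Real.norm_of_nonneg (inv_nonneg.2 hB.le),
      ENNReal.ofReal_inv_of_pos hB]
  rw [h3] at h2
  have hB0 : ENNReal.ofReal B ≠ 0 := by simpa using hB
  calc _ = ENNReal.ofReal B * ((ENNReal.ofReal B)⁻¹ * ‖conv f (dilate Φ s hs) x‖ₑ) := by
        rw [← mul_assoc, ENNReal.mul_inv_cancel hB0 ENNReal.ofReal_ne_top, one_mul]
    _ ≤ _ := by gcongr

theorem translate_dilate {n : ℕ} (a : Rn n) (Φ : 𝓢(Rn n, ℂ)) {s : ℝ} (hs : 0 < s) :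
    translate a (dilate Φ s hs) = dilate (translate (s⁻¹ • a) Φ) s hs := by
  ext x
  simp only [translate, SchwartzMap.compSubConstCLM_apply, dilate_apply, smul_sub]

/-- Moving the point by at most s amounts to translating Φ by a vector of length at most 1, and such
translates stay in a fixed multiple of 𝒮_N. -/
theorem conv_dilate_le {n N : ℕ} (f : 𝓢'(Rn n, ℂ)) (Φ : 𝓢(Rn n, ℂ)) {s : ℝ} (hs : 0 < s)
    {x y : Rn n} (hxy : ‖x - y‖ ≤ s) :
    ‖conv f (dilate Φ s hs) x‖ₑ ≤
      ENNReal.ofReal (2 ^ N * weightedBound N N Φ) * grandMaximal N f y := by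
  -- Normalizing Φ requires a positive bound; a zero bound forces Φ = 0.
  rcases (weightedBound_nonneg N N Φ).eq_or_lt with h0 | hpos
  · have : Φ = 0 := by
      ext z
      have h1 := le_weightedBound (k := N) (Nat.zero_le N) Φ z
      rw [← h0, norm_iteratedFDeriv_zero] at h1
      have h2 : ‖Φ z‖ ≤ 0 := by
        by_contra! hcon
        have : 0 < (1 + ‖z‖) ^ N * ‖Φ z‖ := by positivity
        linarith
      simpa using h2
    have h2 : dilate (0 : 𝓢(Rn n, ℂ)) s hs = 0 := by
      ext z; simp [dilate_apply]
    rw [this, h2, ← convCLM_apply, map_zero]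
    simp
  · have h1 : conv f (dilate Φ s hs) x = conv f (dilate (translate (s⁻¹ • (y - x)) Φ) s hs) y := by
      rw [← translate_dilate, conv_translate]; simp
    rw [h1]
    refine conv_dilate_le_grandMaximal f (by positivity) (fun j hj z => ?_) hs y
    refine (weighted_iteratedFDeriv_translate_le hj Φ _ z).trans ?_
    rw [mul_comm]
    gcongr
    have : ‖s⁻¹ • (y - x)‖ ≤ 1 := by
      rw [norm_smul, norm_inv, Real.norm_of_nonneg hs.le, norm_sub_rev, inv_mul_le_iff₀ hs, mul_one]
      exact hxy
    linarith

theorem dilate_one {n : ℕ} (Φ : 𝓢(Rn n, ℂ)) : dilate Φ 1 one_pos = Φ := by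
  ext x; simp [dilate_apply]

/-- The constant in the comparison of `ntMax` with the grand maximal function. -/
def gaussBound (n N : ℕ) : ℝ := 2 ^ N * weightedBound N N (gauss n)

theorem caloric_le_grandMaximal {n N : ℕ} (f : 𝓢'(Rn n, ℂ)) {θ : ℝ} (hθ : 0 < θ) {x y : Rn n}
    (hxy : ‖x - y‖ ≤ √θ) :
    ‖caloric f θ x‖ₑ ≤ ENNReal.ofReal (gaussBound n N) * grandMaximal N f y := by
  rw [caloric, heat_of_pos hθ]
  exact conv_dilate_le f (gauss n) _ hxy

theorem ntMax_le_grandMaximal {n : ℕ} (N : ℕ) (f : 𝓢'(Rn n, ℂ)) (x : Rn n) :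
    ntMax f x ≤ ENNReal.ofReal (gaussBound n N) * grandMaximal N f x :=
  ntMax_le fun _ _ hz => caloric_le_grandMaximal f ((sq_nonneg _).trans_lt hz)
    (Real.le_sqrt_of_sq_le hz.le)

/-! ### Estimates for distributions in the Hardy space -/

section HardyBounds

variable {n N : ℕ} {p : Rn n → ℝ} {p₀ : ℝ} {f : 𝓢'(Rn n, ℂ)}

theorem norm_le_of_enorm_le {z : ℂ} {a : ℝ} (ha : 0 ≤ a) (h : ‖z‖ₑ ≤ ENNReal.ofReal a) :
    ‖z‖ ≤ a := by
  rwa [← ofReal_norm, ENNReal.ofReal_le_ofReal_iff ha] at h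

/-- Every unit ball contains a point where the grand maximal function is below a fixed constant, and
f * Φ is controlled from that point. The bound by a Schwartz seminorm also makes f * h a tempered
distribution. -/
theorem exists_conv_le_of_mem_Hp (hp₀ : IsMP0Index p p₀) (hf : f ∈ Hp p N) :
    ∃ A : ℝ, 0 < A ∧ ∀ (Φ : 𝓢(Rn n, ℂ)) (x : Rn n), ‖conv f Φ x‖ ≤ A * weightedBound N N Φ := by
  obtain ⟨A, hA, h⟩ := exists_le_of_luxNorm_lt_top hp₀.pos hp₀.lt_pMinus hf
  refine ⟨A * 2 ^ N, by positivity, fun Φ x => ?_⟩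
  obtain ⟨y, hy, hle⟩ := h x 1 one_pos le_rfl
  have hw := weightedBound_nonneg N N Φ
  have h1 := conv_dilate_le (N := N) f Φ one_pos (x := x) (y := y) (by
    rw [← dist_eq_norm, dist_comm]; exact (Metric.mem_ball.1 hy).le)
  rw [dilate_one] at h1
  refine norm_le_of_enorm_le (by positivity) (h1.trans ?_)
  rw [Real.one_rpow, mul_one] at hle
  calc _ ≤ ENNReal.ofReal (2 ^ N * weightedBound N N Φ) * ENNReal.ofReal A := by gcongr
    _ = _ := by rw [← ENNReal.ofReal_mul (by positivity)]; congr 1; ring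

theorem isBoundedDistribution_of_mem_Hp (hp₀ : IsMP0Index p p₀) (hf : f ∈ Hp p N) :
    IsBoundedDistribution f := by
  obtain ⟨A, -, h⟩ := exists_conv_le_of_mem_Hp hp₀ hf
  exact fun Φ => ⟨_, h Φ⟩

/-- The point of comparison may be sought within distance min(1, √θ), and smaller balls force a
larger constant. Only a power of θ is lost at θ = 0, which is integrable after subordination. -/
theorem exists_caloric_le_of_mem_Hp (hp₀ : IsMP0Index p p₀) (hf : f ∈ Hp p N) :
    ∃ A : ℝ, 0 < A ∧ ∀ θ > 0, ∀ x : Rn n,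
      ‖caloric f θ x‖ ≤ A * (1 + θ ^ (-((n : ℝ) / p₀ / 2))) := by
  obtain ⟨A, hA, h⟩ := exists_le_of_luxNorm_lt_top hp₀.pos hp₀.lt_pMinus hf
  have hg : 0 ≤ gaussBound n N := by
    have := weightedBound_nonneg N N (gauss n)
    unfold gaussBound; positivity
  have hb : 0 ≤ (n : ℝ) / p₀ := div_nonneg (Nat.cast_nonneg n) hp₀.pos.le
  refine ⟨(gaussBound n N + 1) * A, by positivity, fun θ hθ x => ?_⟩
  have key : ∀ r : ℝ, 0 < r → r ≤ 1 → r ≤ √θ →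
      ‖caloric f θ x‖ ≤ (gaussBound n N + 1) * A * r ^ (-((n : ℝ) / p₀)) := by
    intro r hr hr1 hrθ
    obtain ⟨y, hy, hle⟩ := h x r hr hr1
    have h1 := caloric_le_grandMaximal (N := N) f hθ (x := x) (y := y) (by
      rw [← dist_eq_norm, dist_comm]; exact (Metric.mem_ball.1 hy).le.trans hrθ)
    refine norm_le_of_enorm_le (by positivity) (h1.trans ?_)
    calc _ ≤ ENNReal.ofReal (gaussBound n N + 1) * ENNReal.ofReal (A * r ^ (-((n : ℝ) / p₀))) := by
          gcongr; linarith
      _ = _ := by rw [← ENNReal.ofReal_mul (by positivity)]; congr 1; ring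
  have hpow : 0 ≤ θ ^ (-((n : ℝ) / p₀ / 2)) := by positivity
  rcases le_total 1 θ with h1 | h1
  · have := key 1 one_pos le_rfl (by rwa [Real.one_le_sqrt])
    rw [Real.one_rpow, mul_one] at this
    refine this.trans (le_mul_of_one_le_right (by positivity) (by linarith))
  · have := key (√θ) (Real.sqrt_pos.2 hθ) (by rwa [Real.sqrt_le_one]) le_rfl
    refine this.trans ?_
    rw [Real.sqrt_eq_rpow, ← Real.rpow_mul hθ.le]
    have h2 : (1 / 2 : ℝ) * -((n : ℝ) / p₀) = -((n : ℝ) / p₀ / 2) := by ring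
    rw [h2]
    gcongr
    linarith

/-- The Hardy norm is controlled by the norm of the non-tangential maximal function. -/
theorem exists_hpNorm_le_luxNorm_ntMax (hn : 1 ≤ n) (hp : MemP0 p) (hp₀ : IsMP0Index p p₀)
    (hN : (n : ℝ) / p₀ + n + 1 < N) :
    ∃ C : ℝ≥0∞, C ≠ ∞ ∧ ∀ h : 𝓢'(Rn n, ℂ), IsBoundedDistribution h → luxNorm p (ntMax h) < ∞ →
      hpNorm p N h ≤ C * luxNorm p (ntMax h) := by
  have hq := hp₀.pos
  obtain ⟨C, hC, hmain⟩ := exists_grandMaximal_le hn hq hN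
  obtain ⟨D, hD⟩ := hp₀.bounded
  refine ⟨ENNReal.ofReal C * (D : ℝ≥0∞) ^ (1 / p₀), ENNReal.mul_ne_top ENNReal.ofReal_ne_top
    (ENNReal.rpow_ne_top_of_nonneg (by positivity) ENNReal.coe_ne_top), fun h hh hlt => ?_⟩
  have hae := ae_lt_top_of_luxNorm_lt_top hp (measurable_ntMax h).aemeasurable hlt
  set g : Rn n → ℝ := fun z => (ntMax h z).toReal ^ p₀ with hg
  have hgm : AEMeasurable g volume := ((measurable_ntMax h).ennreal_toReal.pow_const p₀).aemeasurable
  have hp' : ∀ x, 0 < p x / p₀ := fun x => div_pos (hp.pos x) hq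
  have hge : (fun x => ‖g x‖ₑ) ≤ᵐ[volume] fun x => ntMax h x ^ p₀ := by
    filter_upwards [hae] with z hz
    rw [Real.enorm_of_nonneg (by positivity), ENNReal.ofReal_rpow_of_nonneg
      ENNReal.toReal_nonneg hq.le |>.symm, ENNReal.ofReal_toReal hz.ne]
  have h1 : luxNorm (fun x => p x / p₀) (fun x => ‖g x‖ₑ) ≤ luxNorm p (ntMax h) ^ p₀ :=
    (luxNorm_mono_ae hp' hge).trans (luxNorm_div_rpow_le hq _)
  have h2 := hD g hgm (h1.trans_lt (ENNReal.rpow_lt_top_of_nonneg hq.le hlt.ne))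
  calc hpNorm p N h ≤ luxNorm p (fun x => ENNReal.ofReal C * maximal g x ^ (1 / p₀)) :=
        luxNorm_mono_ae hp.pos (Eventually.of_forall (hmain h hh hae))
    _ ≤ ENNReal.ofReal C * luxNorm p (fun x => maximal g x ^ (1 / p₀)) :=
        luxNorm_const_mul_le hC _
    _ ≤ ENNReal.ofReal C * (luxNorm (fun x => p x / p₀) (maximal g)) ^ (1 / p₀) := by
        gcongr; exact luxNorm_rpow_le hq _
    _ ≤ ENNReal.ofReal C * (D * luxNorm p (ntMax h) ^ p₀) ^ (1 / p₀) := by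
        gcongr
        exact h2.trans (by gcongr)
    _ = _ := by
        rw [ENNReal.mul_rpow_of_nonneg _ _ (by positivity), ← ENNReal.rpow_mul,
          mul_one_div_cancel hq.ne', ENNReal.rpow_one, mul_assoc]

theorem luxNorm_ntMax_lt_top (hp : MemP0 p) (hf : f ∈ Hp p N) : luxNorm p (ntMax f) < ∞ := by
  have hg : 0 ≤ gaussBound n N := by
    have := weightedBound_nonneg N N (gauss n)
    unfold gaussBound; positivity
  have h1 : luxNorm p (ntMax f) ≤
      luxNorm p (fun x => ENNReal.ofReal (gaussBound n N + 1) * grandMaximal N f x) := by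
    refine luxNorm_mono_ae hp.pos (Eventually.of_forall fun x => ?_)
    refine (ntMax_le_grandMaximal N f x).trans ?_
    beta_reduce
    gcongr
    linarith
  refine (h1.trans (luxNorm_const_mul_le (by linarith) _)).trans_lt ?_
  exact ENNReal.mul_lt_top ENNReal.ofReal_lt_top hf

end HardyBounds

/-! ### Subordination of the Poisson kernel to the heat kernel -/

/-- The subordinating measure, with density `η^(-1/2) e^(-η) / √π` on `(0, ∞)`. -/
def subord : Measure ℝ := ProbabilityTheory.gammaMeasure (1 / 2) 1

instance : IsProbabilityMeasure subord :=
  ProbabilityTheory.isProbabilityMeasure_gammaMeasure (by norm_num) one_pos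

theorem measurable_gammaPDF (a r : ℝ) : Measurable (ProbabilityTheory.gammaPDF a r) :=
  (ProbabilityTheory.measurable_gammaPDFReal a r).ennreal_ofReal

theorem ae_subord_pos : ∀ᵐ η ∂subord, 0 < η := by
  unfold subord ProbabilityTheory.gammaMeasure
  rw [ae_withDensity_iff (measurable_gammaPDF _ _)]
  have h0 : ∀ᵐ η : ℝ, η ≠ 0 := by simp [ae_iff]
  filter_upwards [h0] with η h0 h
  by_contra hlt
  exact h (ProbabilityTheory.gammaPDF_of_neg (lt_of_le_of_ne (not_lt.1 hlt) h0))

theorem restrict_subord : subord.restrict (Ioi 0) = subord :=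
  Measure.restrict_eq_self_of_ae_mem ae_subord_pos

theorem toReal_gammaPDF {η : ℝ} (h : 0 < η) :
    (ProbabilityTheory.gammaPDF (1 / 2) 1 η).toReal =
      (√Real.pi)⁻¹ * (η ^ (-(1 / 2) : ℝ) * Real.exp (-η)) := by
  rw [ProbabilityTheory.gammaPDF_of_nonneg h.le, ENNReal.toReal_ofReal, Real.Gamma_one_half_eq,
    Real.one_rpow, one_mul]
  · norm_num
    ring
  · have := Real.Gamma_pos_of_pos (by norm_num : (0 : ℝ) < 1 / 2)
    positivity

theorem integral_subord (g : ℝ → ℝ) :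
    ∫ η, g η ∂subord =
      (√Real.pi)⁻¹ * ∫ η in Ioi 0, η ^ (-(1 / 2) : ℝ) * Real.exp (-η) * g η := by
  rw [← restrict_subord, subord, ProbabilityTheory.gammaMeasure,
    restrict_withDensity measurableSet_Ioi,
    integral_withDensity_eq_integral_toReal_smul (measurable_gammaPDF _ _)
      (Eventually.of_forall fun _ => ENNReal.ofReal_lt_top), ← integral_const_mul]
  refine setIntegral_congr_fun measurableSet_Ioi fun η hη => ?_
  rw [toReal_gammaPDF hη, smul_eq_mul, mul_assoc]

/-- The singularity θ^{-b} at θ = t²/η turns into the moment η^b, a Gamma integral. -/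
theorem integrable_subord_rpow {b : ℝ} (hb : 0 ≤ b) : Integrable (fun η => η ^ b) subord := by
  rw [← restrict_subord, subord, ProbabilityTheory.gammaMeasure,
    restrict_withDensity measurableSet_Ioi,
    integrable_withDensity_iff_integrable_smul' (measurable_gammaPDF _ _)
      (Eventually.of_forall fun _ => ENNReal.ofReal_lt_top)]
  have h := (Real.GammaIntegral_convergent (s := b + 1 / 2) (by positivity)).const_mul (√Real.pi)⁻¹
  refine h.congr ?_
  filter_upwards [ae_restrict_mem measurableSet_Ioi] with η hη
  have hη : 0 < η := hη
  rw [toReal_gammaPDF hη, smul_eq_mul, show b + 1 / 2 - 1 = -(1 / 2) + b by ring,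
    Real.rpow_add hη]
  ring

theorem heatK_div {n : ℕ} {t η : ℝ} (ht : 0 < t) (hη : 0 < η) (x : Rn n) :
    heatK (t ^ 2 / η) x = (Real.pi * t ^ 2) ^ (-(n : ℝ) / 2) *
      (η ^ ((n : ℝ) / 2) * Real.exp (-(‖x‖ ^ 2 / t ^ 2 * η))) := by
  have hpi := Real.pi_pos
  unfold heatK
  rw [← mul_div_assoc, Real.div_rpow (by positivity) hη.le, neg_div (2 : ℝ) (n : ℝ),
    Real.rpow_neg hη.le, div_inv_eq_mul, mul_assoc]
  congr 3
  field_simp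

/-- The Poisson kernel is an average of heat kernels. -/
theorem integral_heatK_subord {n : ℕ} {t : ℝ} (ht : 0 < t) (x : Rn n) :
    ∫ η, heatK (t ^ 2 / η) x ∂subord = poissonT t x := by
  have hpi := Real.pi_pos
  have h1 : ∫ η in Ioi (0 : ℝ), η ^ (-(1 / 2) : ℝ) * Real.exp (-η) * heatK (t ^ 2 / η) x =
      (Real.pi * t ^ 2) ^ (-(n : ℝ) / 2) * ∫ η in Ioi (0 : ℝ),
        η ^ (((n : ℝ) + 1) / 2 - 1) * Real.exp (-((1 + ‖x‖ ^ 2 / t ^ 2) * η)) := by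
    rw [← integral_const_mul]
    refine setIntegral_congr_fun measurableSet_Ioi fun η hη => ?_
    have hη : 0 < η := hη
    rw [heatK_div ht hη, show ((n : ℝ) + 1) / 2 - 1 = -(1 / 2) + n / 2 by ring, Real.rpow_add hη,
      show -((1 + ‖x‖ ^ 2 / t ^ 2) * η) = -η + -(‖x‖ ^ 2 / t ^ 2 * η) by ring, Real.exp_add]
    ring
  rw [integral_subord, h1, Real.integral_rpow_mul_exp_neg_mul_Ioi (by positivity) (by positivity)]
  have h2 : ‖t⁻¹ • x‖ ^ 2 = ‖x‖ ^ 2 / t ^ 2 := by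
    rw [norm_smul, mul_pow, Real.norm_of_nonneg (by positivity)]
    field_simp
  have h3 : (Real.pi * t ^ 2) ^ (-(n : ℝ) / 2) = (Real.pi ^ ((n : ℝ) / 2))⁻¹ * (t ^ n)⁻¹ := by
    rw [neg_div, Real.rpow_neg (by positivity), Real.mul_rpow hpi.le (by positivity), mul_inv]
    congr 2
    rw [← Real.rpow_natCast, ← Real.rpow_mul ht.le, ← Real.rpow_natCast]
    congr 1; push_cast; ring
  have h4 : Real.pi ^ (((n : ℝ) + 1) / 2) = Real.pi ^ ((n : ℝ) / 2) * √Real.pi := by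
    rw [Real.sqrt_eq_rpow, ← Real.rpow_add hpi]; congr 1; ring
  rw [poissonT, poisson, h2, h3, h4, one_div, Real.inv_rpow (by positivity)]
  have : √Real.pi ≠ 0 := by positivity
  field_simp

theorem integrable_prod_heatK {n : ℕ} {t : ℝ} (ht : 0 < t) :
    Integrable (fun q : ℝ × Rn n => heatK (t ^ 2 / q.1) q.2) (subord.prod volume) := by
  have hm : Measurable fun q : ℝ × Rn n => heatK (t ^ 2 / q.1) q.2 := by
    unfold heatK
    fun_prop
  rw [integrable_prod_iff hm.aestronglyMeasurable]
  constructor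
  · filter_upwards [ae_subord_pos] with η hη
    exact integrable_heatK (by positivity)
  · refine (integrable_const (1 : ℝ)).congr ?_
    filter_upwards [ae_subord_pos] with η hη
    have h : 0 < t ^ 2 / η := by positivity
    rw [← integral_heatK (n := n) h]
    congr 1; funext x
    exact (Real.norm_of_nonneg (heatK_pos h x).le).symm

theorem integrable_poissonT {n : ℕ} {t : ℝ} (ht : 0 < t) :
    Integrable (poissonT t : Rn n → ℝ) := by
  have := (integrable_prod_heatK (n := n) ht).integral_prod_right
  simpa only [integral_heatK_subord ht] using this

theorem integral_poissonT_smul {n : ℕ} {t : ℝ} (ht : 0 < t) {w : Rn n → ℂ}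
    (hw : AEStronglyMeasurable w volume) {C : ℝ} (hC : ∀ x, ‖w x‖ ≤ C) (z : Rn n) :
    ∫ y, poissonT t y • w (z - y) = ∫ η, heatT (t ^ 2 / η) w z ∂subord := by
  have h1 : Integrable (fun q : ℝ × Rn n => heatK (t ^ 2 / q.1) q.2 • w (z - q.2))
      (subord.prod volume) := by
    refine ((integrable_prod_heatK ht).norm.mul_const C).mono'
      ((integrable_prod_heatK ht).aestronglyMeasurable.smul
        (aestronglyMeasurable_comp_sub hw z).comp_snd) (Eventually.of_forall fun q => ?_)
    rw [norm_smul]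
    exact mul_le_mul_of_nonneg_left (hC _) (norm_nonneg _)
  unfold heatT
  rw [integral_integral_swap h1]
  congr 1; funext y
  rw [integral_smul_const, integral_heatK_subord ht]

/-! ### Convolution with the Poisson kernel -/

/-- The convolution of a Hardy space distribution with an integrable function exists. -/
theorem exists_isConvL1 {n N : ℕ} {f : 𝓢'(Rn n, ℂ)} {A : ℝ} (hA : 0 ≤ A)
    (hf : ∀ (Φ : 𝓢(Rn n, ℂ)) (x : Rn n), ‖conv f Φ x‖ ≤ A * weightedBound N N Φ)
    {h : Rn n → ℝ} (hh : Integrable h) : ∃ g, IsConvL1 f h g := by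
  have hh' : Integrable (fun x => (h (-x) : ℂ)) := hh.comp_neg.ofReal
  have hi : ∀ φ, Integrable fun x => conv f φ x * (h (-x) : ℂ) := fun φ =>
    hh'.bdd_mul (continuous_conv f φ).aestronglyMeasurable (Eventually.of_forall (hf φ))
  let B : 𝓢(Rn n, ℂ) →L[ℂ] ℂ := SchwartzMap.mkCLMtoNormedSpace (σ := RingHom.id ℂ)
    (fun φ => ∫ x, conv f φ x * (h (-x) : ℂ))
    (fun φ ψ => by
      rw [← integral_add (hi φ) (hi ψ)]
      congr 1; funext x
      rw [← convCLM_apply, map_add, convCLM_apply, convCLM_apply, add_mul])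
    (fun c φ => by
      rw [RingHom.id_apply, smul_eq_mul, ← integral_const_mul]
      congr 1; funext x
      rw [conv_smul, mul_assoc])
    ⟨Finset.Iic (N, N), A * 2 ^ N * ∫ x, ‖(h (-x) : ℂ)‖, by positivity, fun φ => by
      have : A * 2 ^ N * (∫ x, ‖(h (-x) : ℂ)‖) *
          ((Finset.Iic (N, N)).sup (schwartzSeminormFamily ℂ (Rn n) ℂ)) φ =
          ∫ x, (A * weightedBound N N φ) * ‖(h (-x) : ℂ)‖ := by
        rw [integral_const_mul, weightedBound]
        change _ * ((Finset.Iic (N, N)).sup fun m => SchwartzMap.seminorm ℂ m.1 m.2) φ = _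
        ring
      rw [this]
      refine norm_integral_le_of_norm_le (hh'.norm.const_mul _) (Eventually.of_forall fun x => ?_)
      rw [norm_mul]
      exact mul_le_mul_of_nonneg_right (hf φ x) (norm_nonneg _)⟩
  refine ⟨ContinuousLinearMap.toPointwiseConvergenceCLM _ _ _ _ (B.comp
    (SchwartzMap.compCLMOfContinuousLinearEquiv ℂ (ContinuousLinearEquiv.neg ℝ))),
    ⟨fun Φ => ⟨_, hf Φ⟩, hh, fun φ => rfl⟩⟩

/-! ### Poisson integrals of distributions in the Hardy space -/

section PoissonConvolution

variable {n N : ℕ} {p : Rn n → ℝ} {p₀ : ℝ} {f g : 𝓢'(Rn n, ℂ)} {t : ℝ}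

theorem conv_eq_of_isConvL1 (ht : 0 < t) (h : IsConvL1 f (poissonT t) g) (Ψ : 𝓢(Rn n, ℂ))
    (x : Rn n) : conv g Ψ x = ∫ η, heatT (t ^ 2 / η) (conv f Ψ) x ∂subord := by
  obtain ⟨C, hC⟩ := h.bounded Ψ
  rw [← integral_poissonT_smul ht (continuous_conv f Ψ).aestronglyMeasurable hC, conv, h.apply_eq,
    ← integral_neg_eq_self]
  congr 1; funext y
  have : reflect ((reflect Ψ).compSubConstCLM ℂ x) = translate (-x) Ψ := by
    ext y
    simp only [reflect_apply, SchwartzMap.compSubConstCLM_apply]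
    congr 1; abel
  rw [this, conv_translate, neg_neg, Complex.real_smul, mul_comm]
  congr 2; abel

/-- Subordination on the level of caloric extensions: convolving with P_t averages U over the
delayed times θ + t²/η at the same point z. -/
theorem caloric_eq_of_isConvL1 (ht : 0 < t) (h : IsConvL1 f (poissonT t) g) {θ : ℝ} (hθ : 0 < θ)
    (z : Rn n) : caloric g θ z = ∫ η, caloric f (t ^ 2 / η + θ) z ∂subord := by
  rw [caloric, conv_eq_of_isConvL1 ht h]
  refine integral_congr_ae ?_
  filter_upwards [ae_subord_pos] with η hη
  exact (caloric_add f (by positivity) hθ z).symm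

theorem isBoundedDistribution_of_isConvL1 (ht : 0 < t) (h : IsConvL1 f (poissonT t) g) :
    IsBoundedDistribution g := by
  intro Ψ
  obtain ⟨C, hC⟩ := h.bounded Ψ
  refine ⟨C, fun x => ?_⟩
  rw [conv_eq_of_isConvL1 ht h]
  refine (norm_integral_le_of_norm_le_const (C := C) ?_).trans_eq (by simp)
  filter_upwards [ae_subord_pos] with η hη
  exact norm_heatT_le (by positivity) hC x

/-- The delayed points (θ + t²/η, z) lie in the same cone, and `subord` is a probability measure. -/
theorem ntMax_le_of_isConvL1 (ht : 0 < t) (h : IsConvL1 f (poissonT t) g) (x : Rn n) :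
    ntMax g x ≤ ntMax f x := by
  refine ntMax_le fun θ z hz => ?_
  have hθ : 0 < θ := (sq_nonneg _).trans_lt hz
  rw [caloric_eq_of_isConvL1 ht h hθ]
  refine (enorm_integral_le_lintegral_enorm _).trans ?_
  refine (lintegral_mono_ae (g := fun _ => ntMax f x) ?_).trans_eq (by simp)
  filter_upwards [ae_subord_pos] with η hη
  refine le_ntMax f (hz.trans ?_)
  have : 0 < t ^ 2 / η := by positivity
  linarith

theorem continuousOn_caloric_div (hf : IsBoundedDistribution f) (ht : 0 < t) :
    ContinuousOn (fun q : ℝ × Rn n => caloric f (t ^ 2 / q.1) q.2) {q | 0 < q.1} := by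
  refine (continuousOn_caloric hf).comp (f := fun q : ℝ × Rn n => (t ^ 2 / q.1, q.2)) ?_ ?_
  · refine ContinuousOn.prodMk (ContinuousOn.div (by fun_prop) (by fun_prop) ?_) (by fun_prop)
    exact fun q hq => (ne_of_gt hq)
  · intro q (hq : 0 < q.1)
    change 0 < t ^ 2 / q.1
    positivity

/-- The density is y ↦ ∫ U(t²/η, y) dη-law, with dominating function `bd`; it is in fact continuous.
-/
theorem mem_L1loc_of_isConvL1 (hp₀ : IsMP0Index p p₀) (hf : f ∈ Hp p N) (ht : 0 < t)
    (h : IsConvL1 f (poissonT t) g) : g ∈ L1loc n := by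
  obtain ⟨A, hA, hcal⟩ := exists_caloric_le_of_mem_Hp hp₀ hf
  set b : ℝ := (n : ℝ) / p₀ / 2 with hb
  have hb0 : 0 ≤ b := by have := hp₀.pos; positivity
  let bd : ℝ → ℝ := fun η => A * (1 + (t ^ 2) ^ (-b) * η ^ b)
  have hbd : Integrable bd subord :=
    ((integrable_const 1).add ((integrable_subord_rpow hb0).const_mul _)).const_mul A
  have hle : ∀ η > 0, ∀ y : Rn n, ‖caloric f (t ^ 2 / η) y‖ ≤ bd η := by
    intro η hη y
    refine (hcal _ (by positivity) y).trans_eq ?_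
    rw [Real.div_rpow (by positivity) hη.le, Real.rpow_neg hη.le, div_inv_eq_mul]
  have hcont := continuousOn_caloric_div h.bounded ht
  have hmeas : ∀ y : Rn n, AEStronglyMeasurable (fun η => caloric f (t ^ 2 / η) y) subord := by
    intro y
    rw [← restrict_subord]
    refine ContinuousOn.aestronglyMeasurable ?_ measurableSet_Ioi
    exact hcont.comp (f := fun η : ℝ => (η, y)) (by fun_prop) fun η hη => hη
  have hpr : (subord.prod volume).restrict {q : ℝ × Rn n | 0 < q.1} = subord.prod volume := by
    refine Measure.restrict_eq_self_of_ae_mem ?_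
    exact Measure.quasiMeasurePreserving_fst.ae ae_subord_pos
  have hms : MeasurableSet {q : ℝ × Rn n | 0 < q.1} := measurableSet_lt measurable_const measurable_fst
  refine ⟨fun y => ∫ η, caloric f (t ^ 2 / η) y ∂subord, ?_, fun φ _ => ?_⟩
  · refine Continuous.locallyIntegrable ?_
    refine continuous_of_dominated (bound := bd) hmeas (fun y => ?_) hbd
      (Eventually.of_forall fun η => continuous_caloric f _)
    filter_upwards [ae_subord_pos] with η hη
    exact hle η hη y
  -- The pairing is a convolution at the origin, to which subordination applies; Fubini then exposes
  -- the density.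
  · have h1 : g φ = conv g (reflect φ) 0 := by
      unfold conv
      congr 1
      ext y
      simp [reflect_apply]
    have h2 : Integrable (fun q : ℝ × Rn n => φ q.2 * caloric f (t ^ 2 / q.1) q.2)
        (subord.prod volume) := by
      have h3 : Integrable (fun q : ℝ × Rn n => bd q.1 * ‖φ q.2‖) (subord.prod volume) :=
        hbd.mul_prod φ.integrable.norm
      refine h3.mono' ?_ ?_
      · rw [← hpr]
        exact ContinuousOn.aestronglyMeasurable
          ((φ.continuous.comp continuous_snd).continuousOn.mul hcont) hms
      · filter_upwards [Measure.quasiMeasurePreserving_fst.ae ae_subord_pos] with q hq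
        rw [norm_mul, mul_comm]
        exact mul_le_mul_of_nonneg_right (hle _ hq _) (norm_nonneg _)
    rw [h1, conv_eq_of_isConvL1 ht h]
    calc _ = ∫ η, (∫ y : Rn n, φ y * caloric f (t ^ 2 / η) y) ∂subord := by
          refine integral_congr_ae ?_
          filter_upwards [ae_subord_pos] with η hη
          rw [← conv_sconv_heat f _ (by positivity), conv_sconv_heat', ← integral_neg_eq_self]
          congr 1; funext y
          simp [reflect_apply]
      _ = ∫ y, ∫ η, φ y * caloric f (t ^ 2 / η) y ∂subord := integral_integral_swap h2
      _ = _ := by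
          congr 1; funext y
          rw [integral_const_mul, mul_comm]

theorem mem_Hp_of_isConvL1 (hn : 1 ≤ n) (hp : MemP0 p) (hp₀ : IsMP0Index p p₀)
    (hN : (n : ℝ) / p₀ + n + 1 < N) (hf : f ∈ Hp p N) (ht : 0 < t)
    (h : IsConvL1 f (poissonT t) g) : g ∈ Hp p N := by
  obtain ⟨C, hC, hle⟩ := exists_hpNorm_le_luxNorm_ntMax hn hp hp₀ hN
  have h1 : luxNorm p (ntMax g) < ∞ :=
    (luxNorm_mono_ae hp.pos (Eventually.of_forall (ntMax_le_of_isConvL1 ht h))).trans_lt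
      (luxNorm_ntMax_lt_top hp hf)
  exact (hle g (isBoundedDistribution_of_isConvL1 ht h) h1).trans_lt (ENNReal.mul_lt_top hC.lt_top h1)

end PoissonConvolution

/-! ### Parabolic convergence at Lebesgue points -/

/-- The index m is the dyadic size of 1 + |z - y|/√θ. Decay of order n + 2 beats growth of order
r^{n+1} on balls and leaves a summable 2^{-m}; the centre moves from z to x inside the cone. -/
theorem exists_dyadic_heatK_le {n : ℕ} {θ : ℝ} (hθ : 0 < θ) {x z : Rn n} (hz : ‖z - x‖ ^ 2 < θ)
    (y : Rn n) : ∃ m : ℕ, y ∈ Metric.closedBall x (2 ^ (m + 1) * √θ) ∧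
      heatK θ (z - y) ≤ Real.exp (((n + 2 : ℕ) : ℝ) ^ 2) * (√θ ^ n)⁻¹ * ((2 ^ m) ^ (n + 2))⁻¹ := by
  have hs : 0 < √θ := Real.sqrt_pos.2 hθ
  set s := √θ
  set ρ : ℝ := ‖z - y‖ / s with hρ
  have hρ0 : 0 ≤ ρ := by positivity
  obtain ⟨m, hm1, hm2⟩ := exists_nat_pow_near (by linarith : (1 : ℝ) ≤ 1 + ρ) one_lt_two
  refine ⟨m, ?_, ?_⟩
  · rw [Metric.mem_closedBall, dist_eq_norm]
    have h1 : ‖z - x‖ < s := Real.lt_sqrt_of_sq_lt hz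
    calc ‖y - x‖ = ‖(z - x) - (z - y)‖ := by congr 1; abel
      _ ≤ ‖z - x‖ + ‖z - y‖ := norm_sub_le _ _
      _ ≤ s + ρ * s := by
          have : ρ * s = ‖z - y‖ := by rw [hρ]; field_simp
          linarith
      _ = (1 + ρ) * s := by ring
      _ ≤ _ := by gcongr
  · have h1 : z - y = s • (s⁻¹ • (z - y)) := by rw [smul_smul, mul_inv_cancel₀ hs.ne', one_smul]
    have h2 : ‖s⁻¹ • (z - y)‖ = ρ := by
      rw [norm_smul, Real.norm_of_nonneg (by positivity), hρ]; field_simp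
    rw [h1, heatK_scale hθ, heatK, h2, mul_one, div_one]
    have h3 : Real.pi ^ (-(n : ℝ) / 2) ≤ 1 :=
      Real.rpow_le_one_of_one_le_of_nonpos (by linarith [Real.pi_gt_three]) (by
        have : (0 : ℝ) ≤ n := by positivity
        linarith)
    have h4 := one_add_pow_mul_exp_le (n + 2) hρ0
    have h5 : Real.exp (-ρ ^ 2) ≤ Real.exp (((n + 2 : ℕ) : ℝ) ^ 2) * ((2 ^ m) ^ (n + 2))⁻¹ := by
      rw [← div_eq_mul_inv, le_div_iff₀ (by positivity), mul_comm]
      refine le_trans ?_ h4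
      gcongr
    calc _ ≤ (s ^ n)⁻¹ * (1 * (Real.exp (((n + 2 : ℕ) : ℝ) ^ 2) * ((2 ^ m) ^ (n + 2))⁻¹)) := by
          gcongr
      _ = _ := by ring

theorem lintegral_heatK_mul_le {n : ℕ} {g : Rn n → ℝ≥0∞} (hg : AEMeasurable g volume) {x z : Rn n}
    {a b : ℝ} (ha : 0 ≤ a) (hb : 0 ≤ b)
    (h : ∀ r > 0, ∫⁻ y in Metric.closedBall x r, g y ≤ ENNReal.ofReal (a * r ^ n + b * r ^ (n + 1)))
    {θ : ℝ} (hθ : 0 < θ) (hz : ‖z - x‖ ^ 2 < θ) :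
    ∫⁻ y, ENNReal.ofReal (heatK θ (z - y)) * g y ≤
      ENNReal.ofReal (2 ^ (n + 1) * Real.exp (((n + 2 : ℕ) : ℝ) ^ 2) * (a + 2 * b * √θ)) := by
  have hs : 0 < √θ := Real.sqrt_pos.2 hθ
  set s := √θ
  set C := Real.exp (((n + 2 : ℕ) : ℝ) ^ 2)
  have hC : 0 < C := Real.exp_pos _
  let c : ℕ → ℝ := fun m => C * (s ^ n)⁻¹ * ((2 ^ m) ^ (n + 2))⁻¹
  have hc : ∀ m, 0 ≤ c m := fun m => by positivity
  calc ∫⁻ y, ENNReal.ofReal (heatK θ (z - y)) * g y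
      ≤ ∫⁻ y, ∑' m : ℕ, ENNReal.ofReal (c m) *
          (Metric.closedBall x (2 ^ (m + 1) * s)).indicator g y := by
        refine lintegral_mono fun y => ?_
        obtain ⟨m, hm, hle⟩ := exists_dyadic_heatK_le hθ hz y
        refine le_trans ?_ (ENNReal.le_tsum m)
        rw [indicator_of_mem hm]
        gcongr
    _ = ∑' m : ℕ, ENNReal.ofReal (c m) * ∫⁻ y in Metric.closedBall x (2 ^ (m + 1) * s), g y := by
        rw [lintegral_tsum fun m => (hg.indicator measurableSet_closedBall).const_mul _]
        congr 1; funext m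
        rw [lintegral_const_mul'' _ (hg.indicator measurableSet_closedBall),
          lintegral_indicator measurableSet_closedBall]
    _ ≤ ∑' m : ℕ, ENNReal.ofReal (C * 2 ^ n * (a + 2 * b * s) * (1 / 2) ^ m) := by
        refine ENNReal.tsum_le_tsum fun m => ?_
        refine (mul_le_mul_right (h _ (by positivity)) _).trans ?_
        rw [← ENNReal.ofReal_mul (hc m)]
        refine ENNReal.ofReal_le_ofReal ?_
        have h1 : c m * (a * (2 ^ (m + 1) * s) ^ n + b * (2 ^ (m + 1) * s) ^ (n + 1)) =
            C * 2 ^ n * (a * ((1 / 2) ^ m * (1 / 2) ^ m) + 2 * b * s * (1 / 2) ^ m) := by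
          simp only [c, one_div, inv_pow]
          field_simp
          ring
        rw [h1, mul_assoc (C * 2 ^ n), add_mul]
        have h2 : ((1 : ℝ) / 2) ^ m ≤ 1 := pow_le_one₀ (by norm_num) (by norm_num)
        have h3 : ((1 : ℝ) / 2) ^ m * (1 / 2) ^ m ≤ (1 / 2) ^ m :=
          mul_le_of_le_one_right (by positivity) h2
        gcongr
    _ = _ := by
        rw [← ENNReal.ofReal_tsum_of_nonneg (fun m => by positivity)
          (summable_geometric_two.mul_left _), tsum_mul_left, tsum_geometric_two]
        congr 1; ring

/-- At a Lebesgue point the small radii give ε r^n. For radii beyond δ the crude bound by the global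
integral is absorbed in b r^{n+1}, so one estimate covers all r. -/
theorem ae_exists_lintegral_ball_le {n : ℕ} {F : Type*} [NormedAddCommGroup F] {w : Rn n → F}
    (hw : Integrable w) : ∀ᵐ x, ∀ ε > 0, ∃ b : ℝ, 0 ≤ b ∧ ∀ r > 0,
      ∫⁻ y in Metric.closedBall x r, ‖w y - w x‖ₑ ≤ ENNReal.ofReal (ε * r ^ n + b * r ^ (n + 1)) := by
  filter_upwards [IsUnifLocDoublingMeasure.ae_tendsto_average_norm_sub (volume : Measure (Rn n))
    hw.locallyIntegrable 1] with x hx ε hε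
  set V : ℝ := (volume (Metric.closedBall (0 : Rn n) 1)).toReal with hV
  have hvol : ∀ r, 0 < r → volume.real (Metric.closedBall x r) = r ^ n * V := by
    intro r hr
    rw [Measure.real, Measure.addHaar_closedBall' _ _ hr.le, ENNReal.toReal_mul,
      ENNReal.toReal_ofReal (by positivity), finrank_euclideanSpace_fin]
  have hV0 : 0 < V := ENNReal.toReal_pos (Metric.measure_closedBall_pos _ _ one_pos).ne'
    measure_closedBall_lt_top.ne
  have hint : ∀ r, IntegrableOn (fun y => w y - w x) (Metric.closedBall x r) := fun r =>
    hw.integrableOn.sub (integrableOn_const measure_closedBall_lt_top.ne)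
  have heq : ∀ r, ∫⁻ y in Metric.closedBall x r, ‖w y - w x‖ₑ =
      ENNReal.ofReal (∫ y in Metric.closedBall x r, ‖w y - w x‖) := fun r =>
    (ofReal_integral_norm_eq_lintegral_enorm (hint r)).symm
  have hlim := hx (fun _ : ℝ => x) id tendsto_id (by
    filter_upwards [self_mem_nhdsWithin] with r hr
    simpa using (le_of_lt hr : (0 : ℝ) ≤ r))
  have hev := (tendsto_order.1 hlim).2 (ε / V) (by positivity)
  obtain ⟨δ, hδ, hsub⟩ := mem_nhdsGT_iff_exists_Ioo_subset.1 hev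
  have hδ : 0 < δ := hδ
  -- For r ≥ δ, multiply the integral of |w| by (r/δ)^{n+1} ≥ 1 and the constant part by r/δ ≥ 1.
  refine ⟨(∫ y, ‖w y‖) / δ ^ (n + 1) + ‖w x‖ * V / δ, by positivity, fun r hr => ?_⟩
  rw [heq]
  refine ENNReal.ofReal_le_ofReal ?_
  rcases lt_or_ge r δ with h | h
  · have h1 : ⨍ y in Metric.closedBall x r, ‖w y - w x‖ < ε / V := hsub ⟨hr, h⟩
    rw [setAverage_eq, hvol r hr, smul_eq_mul, inv_mul_lt_iff₀ (by positivity)] at h1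
    have h2 : r ^ n * V * (ε / V) = ε * r ^ n := by field_simp
    have h3 : 0 ≤ ((∫ y, ‖w y‖) / δ ^ (n + 1) + ‖w x‖ * V / δ) * r ^ (n + 1) := by positivity
    linarith
  · calc ∫ y in Metric.closedBall x r, ‖w y - w x‖
        ≤ ∫ y in Metric.closedBall x r, (‖w y‖ + ‖w x‖) := by
          refine integral_mono (hint r).norm
            (hw.norm.integrableOn.add (integrableOn_const measure_closedBall_lt_top.ne))
            fun y => norm_sub_le _ _
      _ = (∫ y in Metric.closedBall x r, ‖w y‖) + r ^ n * V * ‖w x‖ := by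
          rw [integral_add hw.norm.integrableOn (integrableOn_const measure_closedBall_lt_top.ne),
            setIntegral_const, hvol r hr, smul_eq_mul]
      _ ≤ (∫ y, ‖w y‖) + r ^ n * V * ‖w x‖ := by
          exact add_le_add
            (setIntegral_le_integral hw.norm (Eventually.of_forall fun _ => norm_nonneg _)) le_rfl
      _ ≤ (∫ y, ‖w y‖) * (r / δ) ^ (n + 1) + r ^ n * V * ‖w x‖ * (r / δ) := by
          have h1 : 1 ≤ r / δ := by rwa [one_le_div hδ]
          exact add_le_add (le_mul_of_one_le_right (by positivity) (one_le_pow₀ h1))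
            (le_mul_of_one_le_right (by positivity) h1)
      _ = ((∫ y, ‖w y‖) / δ ^ (n + 1) + ‖w x‖ * V / δ) * r ^ (n + 1) := by
          rw [div_pow]; field_simp; ring
      _ ≤ _ := by
          have : 0 ≤ ε * r ^ n := by positivity
          linarith

theorem norm_heatK_le {n : ℕ} {θ : ℝ} (h : 0 < θ) (x : Rn n) :
    ‖heatK θ x‖ ≤ (Real.pi * θ) ^ (-(n : ℝ) / 2) := by
  have hpi := Real.pi_pos
  rw [Real.norm_of_nonneg (heatK_pos h x).le, heatK]
  refine mul_le_of_le_one_right (by positivity) (Real.exp_le_one_iff.2 ?_)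
  have : 0 ≤ ‖x‖ ^ 2 / θ := by positivity
  rw [neg_div]; linarith

theorem integrable_heatK_smul_of_integrable {n : ℕ} {F : Type*} [NormedAddCommGroup F]
    [NormedSpace ℝ F] {w : Rn n → F} (hw : Integrable w) {θ : ℝ} (h : 0 < θ) (z : Rn n) :
    Integrable fun y => heatK θ (z - y) • w y :=
  hw.bdd_smul _ ((continuous_heatK θ).comp (by fun_prop)).aestronglyMeasurable
    (Eventually.of_forall fun y => norm_heatK_le h _)

/-- The heat semigroup converges nontangentially at almost every point. -/
theorem ae_heatT_tendsto {n : ℕ} {F : Type*} [NormedAddCommGroup F] [NormedSpace ℝ F]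
    [CompleteSpace F] {w : Rn n → F} (hw : Integrable w) :
    ∀ᵐ x, ∀ ε > 0, ∃ δ > 0, ∀ θ ∈ Ioo 0 δ, ∀ z, ‖z - x‖ ^ 2 < θ → ‖heatT θ w z - w x‖ ≤ ε := by
  filter_upwards [ae_exists_lintegral_ball_le hw] with x hx ε hε
  set C : ℝ := 2 ^ (n + 1) * Real.exp (((n + 2 : ℕ) : ℝ) ^ 2) with hC
  have hC0 : 0 < C := by positivity
  obtain ⟨b, hb, hball⟩ := hx (ε / (2 * C)) (by positivity)
  -- This makes each of the two terms in C(a + 2b√θ) at most ε/2, with a = ε/(2C); b + 1 replaces b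
  -- to avoid dividing by zero.
  refine ⟨(ε / (4 * C * (b + 1))) ^ 2, by positivity, fun θ hθ z hz => ?_⟩
  have hθ0 := hθ.1
  have hs : √θ ≤ ε / (4 * C * (b + 1)) :=
    (Real.sqrt_le_sqrt hθ.2.le).trans_eq (Real.sqrt_sq (by positivity))
  have hk : Integrable fun y => heatK θ (z - y) • w x :=
    ((integrable_heatK hθ0).comp_sub_left z).smul_const _
  have h1 : heatT θ w z - w x = ∫ y, heatK θ (z - y) • (w y - w x) := by
    simp_rw [smul_sub]
    rw [integral_sub (integrable_heatK_smul_of_integrable hw hθ0 z) hk, heatT_eq_integral_sub,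
      integral_smul_const, integral_sub_left_eq_self (fun y => heatK θ y) volume z,
      integral_heatK hθ0, one_smul]
  have h2 : ‖heatT θ w z - w x‖ₑ ≤ ENNReal.ofReal (C * (ε / (2 * C) + 2 * b * √θ)) := by
    rw [h1]
    refine (enorm_integral_le_lintegral_enorm _).trans ?_
    refine le_trans (le_of_eq ?_) (lintegral_heatK_mul_le
      (hw.aestronglyMeasurable.sub aestronglyMeasurable_const).enorm (by positivity) hb hball hθ0 hz)
    congr 1; funext y
    rw [enorm_smul, Real.enorm_of_nonneg (heatK_pos hθ0 _).le]
    rfl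
  rw [← ofReal_norm, ENNReal.ofReal_le_ofReal_iff (by positivity)] at h2
  refine h2.trans ?_
  have h3 : 2 * b * √θ ≤ ε / (2 * C) := by
    calc 2 * b * √θ ≤ 2 * (b + 1) * (ε / (4 * C * (b + 1))) := by gcongr; linarith
      _ = _ := by field_simp; norm_num
  calc C * (ε / (2 * C) + 2 * b * √θ) ≤ C * (ε / (2 * C) + ε / (2 * C)) := by gcongr
    _ = ε := by field_simp; norm_num

/-! ### A maximum principle for the heat semigroup -/

section MaximumPrinciple

variable {n : ℕ}

/-- The fourth moment of the heat kernel at time `1`. -/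
def heatMoment (n : ℕ) : ℝ := ∫ y : Rn n, ‖y‖ ^ 4 * heatK 1 y

theorem heatMoment_nonneg : 0 ≤ heatMoment n :=
  integral_nonneg fun y => mul_nonneg (by positivity) (heatK_pos one_pos y).le

theorem integrable_heatK_smul_indicator {σ : ℝ} (hσ : 0 < σ) (ρ : ℝ) :
    Integrable fun y : Rn n => heatK σ y • {y : Rn n | ρ ≤ ‖y‖}.indicator (1 : Rn n → ℝ) y := by
  have hm : MeasurableSet {y : Rn n | ρ ≤ ‖y‖} := measurableSet_le measurable_const measurable_norm
  refine ((integrable_heatK hσ).indicator hm).congr (Eventually.of_forall fun y => ?_)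
  by_cases hy : y ∈ {y : Rn n | ρ ≤ ‖y‖} <;> simp only [indicator, hy] <;> simp

/-- Chebyshev with the fourth moment. The order σ² matters: in the maximum principle the tail must
be negligible against a gain linear in σ. -/
theorem integral_heatK_tail_le {σ ρ : ℝ} (hσ : 0 < σ) (hρ : 0 < ρ) :
    ∫ y : Rn n, heatK σ y • {y : Rn n | ρ ≤ ‖y‖}.indicator (1 : Rn n → ℝ) y ≤
      heatMoment n * σ ^ 2 / ρ ^ 4 := by
  rw [integral_heatK_smul hσ]
  have h1 : heatMoment n * σ ^ 2 / ρ ^ 4 = ∫ y : Rn n, (σ ^ 2 / ρ ^ 4) * (‖y‖ ^ 4 * heatK 1 y) := by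
    rw [integral_const_mul, heatMoment]; ring
  rw [h1]
  refine integral_mono_of_nonneg (Eventually.of_forall fun y => ?_)
    ((integrable_pow_mul_heatK one_pos 4).const_mul _) (Eventually.of_forall fun y => ?_)
  · exact mul_nonneg (heatK_pos one_pos y).le (indicator_nonneg (fun _ _ => zero_le_one) _)
  · have hk := (heatK_pos one_pos y).le
    dsimp only
    by_cases hy : √σ • y ∈ {y : Rn n | ρ ≤ ‖y‖}
    · rw [indicator_of_mem hy, Pi.one_apply, smul_eq_mul, mul_one]
      have h2 : ρ ≤ √σ * ‖y‖ := by
        have : ρ ≤ ‖√σ • y‖ := hy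
        rwa [norm_smul, Real.norm_of_nonneg (Real.sqrt_nonneg σ)] at this
      have h3 : ρ ^ 4 ≤ σ ^ 2 * ‖y‖ ^ 4 := by
        calc ρ ^ 4 ≤ (√σ * ‖y‖) ^ 4 := by gcongr
          _ = (√σ ^ 2) ^ 2 * ‖y‖ ^ 4 := by ring
          _ = _ := by rw [Real.sq_sqrt hσ.le]
      have h4 : 1 ≤ σ ^ 2 / ρ ^ 4 * ‖y‖ ^ 4 := by
        rw [div_mul_eq_mul_div, one_le_div (by positivity)]; exact h3
      calc heatK 1 y = 1 * heatK 1 y := (one_mul _).symm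
        _ ≤ (σ ^ 2 / ρ ^ 4 * ‖y‖ ^ 4) * heatK 1 y := by gcongr
        _ = _ := by ring
    · rw [indicator_of_notMem hy, smul_zero]
      positivity

/-- The mass of the heat kernel at time `1` in the unit ball. -/
def heatBallMass (n : ℕ) : ℝ := ∫ y : Rn n in Metric.ball 0 1, heatK 1 y

theorem heatBallMass_pos : 0 < heatBallMass n := by
  rw [heatBallMass, setIntegral_pos_iff_support_of_nonneg_ae
    (Eventually.of_forall fun y => (heatK_pos one_pos y).le) (integrable_heatK one_pos).integrableOn]
  have : Function.support (heatK 1 : Rn n → ℝ) = univ :=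
    eq_univ_of_forall fun y => (heatK_pos one_pos y).ne'
  rw [this, univ_inter]
  exact Metric.measure_ball_pos _ _ one_pos

theorem norm_indicator_one_le (s : Set (Rn n)) (x : Rn n) :
    ‖s.indicator (1 : Rn n → ℝ) x‖ ≤ 1 := by
  by_cases h : x ∈ s <;> simp [h]

/-- On and beyond the lateral boundary dist(z, E)² = θ, the ball of radius √θ about z misses E.
Hence the barrier has a uniform positive lower bound there. -/
theorem heatBallMass_le {E : Set (Rn n)} (hE : MeasurableSet E) {θ : ℝ} (hθ : 0 < θ) {z : Rn n}
    (hz : θ ≤ Metric.infDist z E ^ 2) :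
    heatBallMass n ≤ heatT θ (Eᶜ.indicator (1 : Rn n → ℝ)) z := by
  have hs : 0 < √θ := Real.sqrt_pos.2 hθ
  have hd : √θ ≤ Metric.infDist z E := Real.sqrt_le_iff.2 ⟨Metric.infDist_nonneg, hz⟩
  rw [heatT_eq_integral_scaled hθ, heatBallMass, ← integral_indicator measurableSet_ball]
  have hm : Measurable (Eᶜ.indicator (1 : Rn n → ℝ)) := measurable_one.indicator hE.compl
  refine integral_mono_of_nonneg (Eventually.of_forall fun y =>
    indicator_nonneg (fun y _ => (heatK_pos one_pos y).le) y) ?_ (Eventually.of_forall fun y => ?_)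
  · refine (integrable_heatK (n := n) one_pos).mul_bdd (c := 1) ?_
      (Eventually.of_forall fun y => norm_indicator_one_le _ _)
    exact (hm.comp (by fun_prop)).aestronglyMeasurable
  · by_cases hy : y ∈ Metric.ball (0 : Rn n) 1
    · have h1 : z - √θ • y ∈ Eᶜ := by
        intro hmem
        have h2 := Metric.infDist_le_dist_of_mem (x := z) hmem
        rw [dist_eq_norm, sub_sub_cancel, norm_smul, Real.norm_of_nonneg hs.le] at h2
        have h3 : ‖y‖ < 1 := by simpa using hy
        nlinarith
      simp [hy, h1]
    · simp only [indicator_of_notMem hy]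
      exact mul_nonneg (heatK_pos one_pos y).le (indicator_nonneg (fun _ _ => zero_le_one) _)

/-- Near E only heat that has travelled a distance of at least √ε/2 is seen, so the solution is
small at the bottom of the region. -/
theorem norm_heatT_le_of_vanish {E : Set (Rn n)} {q : Rn n → ℂ} {C : ℝ} (hC : ∀ x, ‖q x‖ ≤ C)
    {ε : ℝ} (hε : 0 < ε) (hq0 : ∀ z, Metric.infDist z E ^ 2 < ε → q z = 0) {θ : ℝ} (hθ : 0 < θ)
    (hθε : θ ≤ ε / 4) {z : Rn n} (hz : Metric.infDist z E ^ 2 ≤ θ) :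
    ‖heatT θ q z‖ ≤ C * (heatMoment n * θ ^ 2 / (√ε / 2) ^ 4) := by
  have hC0 : 0 ≤ C := (norm_nonneg _).trans (hC 0)
  have hs : 0 < √ε := Real.sqrt_pos.2 hε
  have hd : Metric.infDist z E ≤ √ε / 2 := by
    have : Metric.infDist z E ^ 2 ≤ (√ε / 2) ^ 2 := by
      rw [div_pow, Real.sq_sqrt hε.le]; linarith
    exact le_of_sq_le_sq this (by positivity)
  have h1 : ‖heatT θ q z‖ ≤ ∫ y : Rn n, C *
      (heatK θ y • {y : Rn n | √ε / 2 ≤ ‖y‖}.indicator (1 : Rn n → ℝ) y) := by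
    refine norm_integral_le_of_norm_le ((integrable_heatK_smul_indicator hθ _).const_mul C)
      (Eventually.of_forall fun y => ?_)
    have hk := (heatK_pos hθ y).le
    rw [norm_smul, Real.norm_of_nonneg hk]
    by_cases hy : y ∈ {y : Rn n | √ε / 2 ≤ ‖y‖}
    · rw [indicator_of_mem hy, Pi.one_apply, smul_eq_mul, mul_one, mul_comm]
      exact mul_le_mul_of_nonneg_right (hC _) hk
    · have hy' : ‖y‖ < √ε / 2 := not_le.1 hy
      have h2 : Metric.infDist (z - y) E < √ε := by
        have := Metric.infDist_le_infDist_add_dist (s := E) (x := z - y) (y := z)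
        rw [dist_eq_norm, sub_sub_cancel_left, norm_neg] at this
        linarith
      have h3 : q (z - y) = 0 := by
        refine hq0 _ ?_
        rw [← Real.sq_sqrt hε.le]
        exact pow_lt_pow_left₀ h2 Metric.infDist_nonneg two_ne_zero
      rw [h3, norm_zero, mul_zero, indicator_of_notMem hy, smul_zero, mul_zero]
  refine h1.trans ?_
  rw [integral_const_mul]
  exact mul_le_mul_of_nonneg_left (integral_heatK_tail_le hθ (by positivity)) hC0

theorem continuous_heatT {F : Type*} [NormedAddCommGroup F] [NormedSpace ℝ F] {w : Rn n → F}
    (hw : AEStronglyMeasurable w volume) {C : ℝ} (hC : ∀ x, ‖w x‖ ≤ C) {θ : ℝ} (hθ : 0 < θ) :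
    Continuous (heatT θ w) := by
  rw [← continuousOn_univ]
  exact (continuousOn_heatT hw hC).comp (f := fun z : Rn n => (θ, z)) (by fun_prop) fun _ _ => hθ

/-- Maximum principle in the region dist(z, E)² ≤ θ. The barrier beats the solution on the lateral
boundary, and the solution is negligible near time 0. An interior maximum is excluded by looking
back a short time σ through the semigroup, so no spatial derivatives are needed. -/
theorem norm_heatT_le_barrier {E : Set (Rn n)} (hE : IsCompact E) (hne : E.Nonempty) {q : Rn n → ℂ}
    (hq : AEStronglyMeasurable q volume) {C : ℝ} (hC : ∀ x, ‖q x‖ ≤ C) {ε : ℝ} (hε : 0 < ε)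
    (hq0 : ∀ z, Metric.infDist z E ^ 2 < ε → q z = 0) {lam : ℝ}
    (hlam : ∀ θ > 0, ∀ z, Metric.infDist z E ^ 2 ≤ θ → ‖heatT θ q z‖ ≤ lam) {θ₁ : ℝ} (hθ₁ : 0 < θ₁)
    {z₁ : Rn n} (hz₁ : Metric.infDist z₁ E ^ 2 ≤ θ₁) :
    ‖heatT θ₁ q z₁‖ ≤ lam / heatBallMass n * heatT θ₁ (Eᶜ.indicator (1 : Rn n → ℝ)) z₁ := by
  have hC0 : 0 ≤ C := (norm_nonneg _).trans (hC 0)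
  have hlam0 : 0 ≤ lam := (norm_nonneg _).trans (hlam θ₁ hθ₁ z₁ hz₁)
  have hc0 := heatBallMass_pos (n := n)
  have hM := heatMoment_nonneg (n := n)
  set A : ℝ := lam / heatBallMass n with hA
  have hA0 : 0 ≤ A := by positivity
  set e : Rn n → ℝ := Eᶜ.indicator (1 : Rn n → ℝ) with he
  have hem : AEStronglyMeasurable e volume :=
    (measurable_one.indicator hE.measurableSet.compl).aestronglyMeasurable
  have he1 : ∀ x, ‖e x‖ ≤ 1 := norm_indicator_one_le _
  have hbar : ∀ θ > 0, ∀ z, 0 ≤ heatT θ e z := fun θ hθ z => integral_nonneg fun y =>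
    mul_nonneg (heatK_pos hθ y).le (indicator_nonneg (fun _ _ => zero_le_one) _)
  by_contra! hcon
  -- Half of the violation, per unit of time: subtracting κθ leaves H positive at (θ₁, z₁) and makes
  -- the comparison strict.
  set κ : ℝ := (‖heatT θ₁ q z₁‖ - A * heatT θ₁ e z₁) / (2 * θ₁) with hκ
  have hκ0 : 0 < κ := div_pos (by linarith) (by linarith)
  let H : ℝ × Rn n → ℝ := fun p => ‖heatT p.1 q p.2‖ - A * heatT p.1 e p.2 - κ * p.1
  have hH1 : 0 < H (θ₁, z₁) := by
    have : κ * θ₁ = (‖heatT θ₁ q z₁‖ - A * heatT θ₁ e z₁) / 2 := by rw [hκ]; field_simp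
    simp only [H, this]
    linarith
  have hHle : ∀ θ > 0, ∀ z, H (θ, z) ≤ ‖heatT θ q z‖ := by
    intro θ hθ z
    have h1 := mul_nonneg hA0 (hbar θ hθ z)
    have h2 : 0 < κ * θ := mul_pos hκ0 hθ
    simp only [H]
    linarith
  -- Below time δ the function H is smaller than its value at (θ₁, z₁), so the maximum over the
  -- compact part δ ≤ θ ≤ θ₁ is one over the whole region up to θ₁.
  obtain ⟨δ, hδ, hδθ, hδε, hbot⟩ : ∃ δ > 0, δ ≤ θ₁ ∧ δ ≤ ε / 4 ∧
      C * (heatMoment n * δ ^ 2 / (√ε / 2) ^ 4) < H (θ₁, z₁) := by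
    have hcont : Tendsto (fun δ : ℝ => C * (heatMoment n * δ ^ 2 / (√ε / 2) ^ 4)) (𝓝[>] 0) (𝓝 0) := by
      have : Continuous fun δ : ℝ => C * (heatMoment n * δ ^ 2 / (√ε / 2) ^ 4) := by fun_prop
      have h := this.tendsto 0
      simp only [ne_eq, OfNat.ofNat_ne_zero, not_false_eq_true, zero_pow, mul_zero, zero_div] at h
      exact h.mono_left nhdsWithin_le_nhds
    have h1 := (tendsto_order.1 hcont).2 _ hH1
    have h2 : ∀ᶠ δ : ℝ in 𝓝[>] 0, δ < min θ₁ (ε / 4) :=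
      nhdsWithin_le_nhds (gt_mem_nhds (by positivity))
    obtain ⟨δ, ⟨h1, h2⟩, h3⟩ := ((h1.and h2).and self_mem_nhdsWithin).exists
    exact ⟨δ, h3, (h2.le.trans (min_le_left _ _)), (h2.le.trans (min_le_right _ _)), h1⟩
  let K : Set (ℝ × Rn n) := (Icc δ θ₁ ×ˢ Metric.cthickening (√θ₁) E) ∩
    {p | Metric.infDist p.2 E ^ 2 ≤ p.1}
  have hK : IsCompact K := by
    refine (isCompact_Icc.prod hE.cthickening).inter_right ?_
    exact isClosed_le ((Metric.continuous_infDist_pt E).comp continuous_snd |>.pow 2) continuous_fst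
  have hKmem : ∀ θ z, δ ≤ θ → θ ≤ θ₁ → Metric.infDist z E ^ 2 ≤ θ → (θ, z) ∈ K := by
    intro θ z h1 h2 h3
    refine ⟨⟨⟨h1, h2⟩, ?_⟩, h3⟩
    rw [Metric.mem_cthickening_iff,
      ENNReal.le_ofReal_iff_toReal_le (Metric.infEDist_ne_top hne) (Real.sqrt_nonneg _)]
    exact Real.le_sqrt_of_sq_le (h3.trans h2)
  have hHc : ContinuousOn H K := by
    have hsub : K ⊆ {p | 0 < p.1} := fun p hp => hδ.trans_le hp.1.1.1
    have h1 := (continuousOn_heatT hq hC).mono hsub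
    have h2 := (continuousOn_heatT hem he1).mono hsub
    fun_prop
  obtain ⟨⟨θ, z⟩, hmem, hmax⟩ := hK.exists_isMaxOn ⟨_, hKmem θ₁ z₁ hδθ le_rfl hz₁⟩ hHc
  have hθδ : δ ≤ θ := hmem.1.1.1
  have hθθ : θ ≤ θ₁ := hmem.1.1.2
  have hθz : Metric.infDist z E ^ 2 ≤ θ := hmem.2
  have hθ0 : 0 < θ := hδ.trans_le hθδ
  have hpos : H (θ₁, z₁) ≤ H (θ, z) := hmax (hKmem θ₁ z₁ hδθ le_rfl hz₁)
  have hall : ∀ θ' > 0, θ' ≤ θ₁ → ∀ z', Metric.infDist z' E ^ 2 ≤ θ' → H (θ', z') ≤ H (θ, z) := by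
    intro θ' h1 h2 z' h3
    rcases le_or_gt δ θ' with h | h
    · exact hmax (hKmem θ' z' h h2 h3)
    · refine (hHle θ' h1 z').trans (le_trans ?_ hpos)
      refine (norm_heatT_le_of_vanish hC hε hq0 h1 (h.le.trans hδε) h3).trans (le_trans ?_ hbot.le)
      gcongr
  -- On the lateral boundary the barrier term is at least `lam`, which would make H negative.
  have hlt : Metric.infDist z E ^ 2 < θ := by
    refine lt_of_le_of_ne hθz fun heq => ?_
    have h1 := hlam θ hθ0 z hθz
    have h2 := heatBallMass_le hE.measurableSet hθ0 heq.ge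
    have h3 : lam ≤ A * heatT θ e z := by
      calc lam = A * heatBallMass n := by rw [hA]; field_simp
        _ ≤ _ := by gcongr
    have h4 : 0 < κ * θ := by positivity
    have h5 : H (θ, z) = ‖heatT θ q z‖ - A * heatT θ e z - κ * θ := rfl
    linarith
  set d := Metric.infDist z E with hd
  have hd0 : 0 ≤ d := Metric.infDist_nonneg
  set γ : ℝ := θ - d ^ 2 with hγ
  have hγ0 : 0 < γ := by linarith
  obtain ⟨ρ, hρ, hρ1⟩ : ∃ ρ > 0, (d + ρ) ^ 2 ≤ θ - γ / 2 := by
    refine ⟨min 1 (γ / 2 / (2 * d + 1)), by positivity, ?_⟩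
    have h1 : min 1 (γ / 2 / (2 * d + 1)) ≤ 1 := min_le_left _ _
    have h2 : min 1 (γ / 2 / (2 * d + 1)) ≤ γ / 2 / (2 * d + 1) := min_le_right _ _
    have h0 : 0 < min 1 (γ / 2 / (2 * d + 1)) := by positivity
    rw [le_div_iff₀ (by positivity)] at h2
    nlinarith
  -- The first bound keeps (θ - σ, z - y) in the region for |y| < ρ; the second makes the tail error
  -- smaller than κσ.
  set σ : ℝ := min (γ / 2) (κ * ρ ^ 4 / (2 * (C * heatMoment n + 1))) with hσ
  have hσ0 : 0 < σ := by positivity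
  have hσ1 : σ ≤ γ / 2 := min_le_left _ _
  have hσ2 : σ ≤ κ * ρ ^ 4 / (2 * (C * heatMoment n + 1)) := min_le_right _ _
  have hτ : 0 < θ - σ := by nlinarith [sq_nonneg d]
  have hQm : AEStronglyMeasurable (fun z => ‖heatT (θ - σ) q z‖) volume :=
    (continuous_heatT hq hC hτ).norm.aestronglyMeasurable
  have hQb : ∀ z, ‖‖heatT (θ - σ) q z‖‖ ≤ C := fun z => by
    rw [norm_norm]; exact norm_heatT_le hτ hC z
  have hem' : AEStronglyMeasurable (heatT (θ - σ) e) volume :=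
    (continuous_heatT hem he1 hτ).aestronglyMeasurable
  have heb' : ∀ z, ‖heatT (θ - σ) e z‖ ≤ 1 := norm_heatT_le hτ he1
  have hi1 := integrable_heatK_smul hσ0 hQm hQb z
  have hi2 := integrable_heatK_smul hσ0 hem' heb' z
  have hq1 : ‖heatT θ q z‖ ≤ ∫ y, heatK σ y • ‖heatT (θ - σ) q (z - y)‖ := by
    have : heatT θ q z = heatT σ (heatT (θ - σ) q) z := by
      rw [heatT_heatT hσ0 hτ hq hC]; congr 1; ring
    rw [this]
    refine (norm_integral_le_integral_norm _).trans_eq ?_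
    congr 1; funext y
    rw [norm_smul, Real.norm_of_nonneg (heatK_pos hσ0 y).le, smul_eq_mul]
  have he2 : heatT θ e z = ∫ y, heatK σ y • heatT (θ - σ) e (z - y) := by
    have : heatT θ e z = heatT σ (heatT (θ - σ) e) z := by
      rw [heatT_heatT hσ0 hτ hem he1]; congr 1; ring
    exact this
  have hint : H (θ, z) + κ * θ ≤ ∫ y, (heatK σ y • ‖heatT (θ - σ) q (z - y)‖ -
      A * (heatK σ y • heatT (θ - σ) e (z - y))) := by
    rw [integral_sub hi1 (hi2.const_mul A), integral_const_mul, ← he2]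
    simp only [H]
    linarith
  -- For |y| < ρ maximality of H applies; for |y| ≥ ρ the solution is at most C and the other terms
  -- only help.
  have hup : ∫ y, (heatK σ y • ‖heatT (θ - σ) q (z - y)‖ -
      A * (heatK σ y • heatT (θ - σ) e (z - y))) ≤
      ∫ y, (heatK σ y * (H (θ, z) + κ * (θ - σ)) +
        C * (heatK σ y • {y : Rn n | ρ ≤ ‖y‖}.indicator (1 : Rn n → ℝ) y)) := by
    refine integral_mono (hi1.sub (hi2.const_mul A)) (((integrable_heatK hσ0).mul_const _).add
      ((integrable_heatK_smul_indicator hσ0 ρ).const_mul C)) fun y => ?_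
    have hk := (heatK_pos hσ0 y).le
    simp only [smul_eq_mul]
    have hkey : ‖heatT (θ - σ) q (z - y)‖ - A * heatT (θ - σ) e (z - y) ≤
        (H (θ, z) + κ * (θ - σ)) + C * {y : Rn n | ρ ≤ ‖y‖}.indicator (1 : Rn n → ℝ) y := by
      by_cases hy : y ∈ {y : Rn n | ρ ≤ ‖y‖}
      · rw [indicator_of_mem hy, Pi.one_apply, mul_one]
        have h1 := norm_heatT_le hτ hC (z - y)
        have h2 := mul_nonneg hA0 (hbar _ hτ (z - y))
        have h3 : 0 < κ * (θ - σ) := by positivity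
        linarith
      · rw [indicator_of_notMem hy, mul_zero, add_zero]
        have hy' : ‖y‖ < ρ := not_le.1 hy
        have h1 : Metric.infDist (z - y) E ≤ d + ρ := by
          have := Metric.infDist_le_infDist_add_dist (s := E) (x := z - y) (y := z)
          rw [dist_eq_norm, sub_sub_cancel_left, norm_neg] at this
          linarith
        have h2 : Metric.infDist (z - y) E ^ 2 ≤ θ - σ :=
          (pow_le_pow_left₀ Metric.infDist_nonneg h1 2).trans (by linarith)
        have h3 := hall (θ - σ) hτ (by linarith) (z - y) h2
        have h4 : H (θ - σ, z - y) = ‖heatT (θ - σ) q (z - y)‖ - A * heatT (θ - σ) e (z - y) -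
          κ * (θ - σ) := rfl
        linarith
    calc heatK σ y * ‖heatT (θ - σ) q (z - y)‖ - A * (heatK σ y * heatT (θ - σ) e (z - y))
        = heatK σ y * (‖heatT (θ - σ) q (z - y)‖ - A * heatT (θ - σ) e (z - y)) := by ring
      _ ≤ heatK σ y * ((H (θ, z) + κ * (θ - σ)) +
          C * {y : Rn n | ρ ≤ ‖y‖}.indicator (1 : Rn n → ℝ) y) := by gcongr
      _ = _ := by ring
  rw [integral_add ((integrable_heatK hσ0).mul_const _)
    ((integrable_heatK_smul_indicator hσ0 ρ).const_mul C), integral_mul_const, integral_const_mul,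
    integral_heatK hσ0, one_mul] at hup
  have htail := mul_le_mul_of_nonneg_left (integral_heatK_tail_le (n := n) hσ0 hρ) hC0
  have hfin : κ * σ ≤ C * (heatMoment n * σ ^ 2 / ρ ^ 4) := by linarith
  have h1 : C * (heatMoment n * σ ^ 2 / ρ ^ 4) = (C * heatMoment n * σ / ρ ^ 4) * σ := by ring
  rw [h1] at hfin
  have h2 : κ ≤ C * heatMoment n * σ / ρ ^ 4 := le_of_mul_le_mul_right hfin hσ0
  rw [le_div_iff₀ (by positivity)] at h2
  rw [le_div_iff₀ (by positivity)] at hσ2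
  have h3 : 0 < κ * ρ ^ 4 := by positivity
  nlinarith

end MaximumPrinciple

/-! ### Weak limits of bounded families -/

/-- A uniformly bounded family of functions on a space of finite measure converges weakly along
every ultrafilter. -/
theorem exists_weak_limit {α ι : Type*} [MeasurableSpace α] (ν : Measure α) [IsFiniteMeasure ν]
    (l : Ultrafilter ι) {F : ι → α → ℂ} (hm : ∀ i, AEStronglyMeasurable (F i) ν) {C : ℝ}
    (hC : ∀ i x, ‖F i x‖ ≤ C) :
    ∃ w : α → ℂ, Integrable w ν ∧ ∀ k : α → ℝ, AEStronglyMeasurable k ν → (∃ B, ∀ x, ‖k x‖ ≤ B) →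
      Tendsto (fun i => ∫ x, k x • F i x ∂ν) l (𝓝 (∫ x, k x • w x ∂ν)) := by
  have hF : ∀ i, MemLp (F i) 2 ν := fun i =>
    MemLp.of_bound (hm i) C (Eventually.of_forall (hC i))
  let Φ : ι → WeakDual ℂ (Lp ℂ 2 ν) := fun i =>
    StrongDual.toWeakDual (InnerProductSpace.toDual ℂ (Lp ℂ 2 ν) (hF i).toLp)
  obtain ⟨R, hR⟩ : ∃ R, ∀ i, ‖(hF i).toLp‖ ≤ R := by
    by_cases hne : Nonempty α
    · obtain ⟨a⟩ := hne
      refine ⟨measureUnivNNReal ν ^ (2 : ℝ≥0∞).toReal⁻¹ * C, fun i => ?_⟩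
      refine Lp.norm_le_of_ae_bound ((norm_nonneg _).trans (hC i a)) ?_
      filter_upwards [(hF i).coeFn_toLp] with x hx
      rw [hx]; exact hC i x
    · have := not_nonempty_iff.1 hne
      refine ⟨0, fun i => ?_⟩
      have : ν = 0 := Measure.eq_zero_of_isEmpty ν
      rw [Lp.norm_toLp, this]
      simp
  -- Banach–Alaoglu in the dual of L², identified with L² by Riesz; an ultrafilter makes extraction
  -- of a subsequence unnecessary.
  have hcomp := WeakDual.isCompact_closedBall (𝕜 := ℂ) (E := Lp ℂ 2 ν) 0 R
  obtain ⟨φ, -, hφ⟩ := hcomp.ultrafilter_le_nhds (l.map Φ) (by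
    rw [Ultrafilter.coe_map, le_principal_iff]
    refine mem_map.2 (Eventually.of_forall fun i => ?_)
    change dist (InnerProductSpace.toDual ℂ (Lp ℂ 2 ν) (hF i).toLp) 0 ≤ R
    rw [dist_zero_right, LinearIsometryEquiv.norm_map]
    exact hR i)
  let w : Lp ℂ 2 ν := (InnerProductSpace.toDual ℂ (Lp ℂ 2 ν)).symm (WeakDual.toStrongDual φ)
  refine ⟨w, (Lp.memLp w).integrable (by norm_num), fun k hk ⟨B, hB⟩ => ?_⟩
  have hkm : MemLp (fun x => (k x : ℂ)) 2 ν := by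
    refine MemLp.of_bound (Complex.continuous_ofReal.comp_aestronglyMeasurable hk) B
      (Eventually.of_forall fun x => ?_)
    rw [Complex.norm_real]; exact hB x
  have h1 : Tendsto (fun i => Φ i hkm.toLp) l (𝓝 (φ hkm.toLp)) :=
    ((WeakDual.eval_continuous hkm.toLp).tendsto φ).comp hφ
  have h2 : ∀ u : α → ℂ, ∀ v : Lp ℂ 2 ν, v =ᵐ[ν] u →
      ∫ x, k x • u x ∂ν = (starRingEnd ℂ) (inner ℂ v hkm.toLp) := by
    intro u v hv
    rw [inner_conj_symm, L2.inner_def]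
    refine integral_congr_ae ?_
    filter_upwards [hv, hkm.coeFn_toLp] with x hx hx2
    rw [hx, hx2, RCLike.inner_apply, Complex.conj_ofReal, Complex.real_smul, mul_comm]
  have h3 := (Complex.continuous_conj.tendsto _).comp h1
  convert h3 using 2 with i
  · exact h2 (F i) _ (hF i).coeFn_toLp
  · rw [h2 w w EventuallyEq.rfl]
    congr 1
    exact InnerProductSpace.toDual_symm_apply

/-! ### Nontangential limits of caloric extensions -/

section Fatou

variable {n : ℕ} {f : 𝓢'(Rn n, ℂ)}

theorem exists_mem_norm_sub_sq_lt {E : Set (Rn n)} (hne : E.Nonempty) {z : Rn n} {θ : ℝ}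
    (hz : Metric.infDist z E ^ 2 < θ) : ∃ x ∈ E, ‖z - x‖ ^ 2 < θ := by
  have hθ : 0 < θ := (sq_nonneg _).trans_lt hz
  obtain ⟨x, hx, hlt⟩ := (Metric.infDist_lt_iff hne).1 (Real.lt_sqrt_of_sq_lt hz)
  refine ⟨x, hx, ?_⟩
  rw [dist_eq_norm] at hlt
  exact (Real.lt_sqrt (norm_nonneg _)).1 hlt

theorem norm_caloric_le {E : Set (Rn n)} (hne : E.Nonempty) {lam : ℝ} (hlam : 0 ≤ lam)
    (hE : ∀ x ∈ E, ntMax f x ≤ ENNReal.ofReal lam) {z : Rn n} {θ : ℝ}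
    (hz : Metric.infDist z E ^ 2 < θ) : ‖caloric f θ z‖ ≤ lam := by
  obtain ⟨x, hx, h⟩ := exists_mem_norm_sub_sq_lt hne hz
  exact norm_le_of_enorm_le hlam ((le_ntMax f h).trans (hE x hx))

/-- Split U(ε, ·) into F_ε, its part within distance √ε of E, bounded by λ, and the rest q_ε. Then
U(θ + ε, ·) is the heat evolution of both. The q_ε part is at most 2λ over the region and vanishes
near E, so the barrier bounds it uniformly in ε. A weak limit of F_ε gives w. -/
theorem exists_heatT_approx (hf : IsBoundedDistribution f) {E : Set (Rn n)} (hEc : IsCompact E)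
    (hne : E.Nonempty) {lam : ℝ} (hlam : 0 ≤ lam) (hE : ∀ x ∈ E, ntMax f x ≤ ENNReal.ofReal lam) :
    ∃ w : Rn n → ℂ, Integrable w ∧ ∀ θ > 0, ∀ z, Metric.infDist z E ^ 2 < θ →
      ‖caloric f θ z - heatT θ w z‖ ≤
        2 * lam / heatBallMass n * heatT θ (Eᶜ.indicator (1 : Rn n → ℝ)) z := by
  let S : ℝ → Set (Rn n) := fun ε => {z | Metric.infDist z E ^ 2 < ε}
  have hS : ∀ ε, MeasurableSet (S ε) := fun ε =>
    (isOpen_lt ((Metric.continuous_infDist_pt E).pow 2) continuous_const).measurableSet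
  let F : ℝ → Rn n → ℂ := fun ε => (S ε).indicator (caloric f ε)
  let q : ℝ → Rn n → ℂ := fun ε => (S ε)ᶜ.indicator (caloric f ε)
  have hcm : ∀ ε, AEStronglyMeasurable (caloric f ε) volume := fun ε =>
    (continuous_caloric f ε).aestronglyMeasurable
  have hFm : ∀ ε, AEStronglyMeasurable (F ε) volume := fun ε => (hcm ε).indicator (hS ε)
  have hqm : ∀ ε, AEStronglyMeasurable (q ε) volume := fun ε => (hcm ε).indicator (hS ε).compl
  have hFb : ∀ ε z, ‖F ε z‖ ≤ lam := by
    intro ε z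
    by_cases hz : z ∈ S ε
    · simp only [F, indicator_of_mem hz]
      exact norm_caloric_le hne hlam hE hz
    · simp only [F, indicator_of_notMem hz, norm_zero, hlam]
  -- For ε < 1 all the F_ε are supported in this compact set, so weak compactness on finite measure
  -- applies.
  let B : Set (Rn n) := Metric.cthickening 1 E
  have hBc : IsCompact B := hEc.cthickening
  have : IsFiniteMeasure (volume.restrict B) := ⟨by
    rw [Measure.restrict_apply_univ]; exact hBc.measure_lt_top⟩
  let l : Ultrafilter ℝ := Ultrafilter.of (𝓝[>] 0)
  have hl : (l : Filter ℝ) ≤ 𝓝[>] 0 := Ultrafilter.of_le _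
  obtain ⟨w₀, hw₀, hlim⟩ := exists_weak_limit (volume.restrict B) l
    (fun ε => (hFm ε).restrict) hFb
  have hBm : MeasurableSet B := Metric.isClosed_cthickening.measurableSet
  refine ⟨B.indicator w₀, (integrable_indicator_iff hBm).2 hw₀, fun θ hθ z hz => ?_⟩
  have hk := hlim (fun y => heatK θ (z - y))
    ((continuous_heatK θ).comp (by fun_prop)).aestronglyMeasurable
    ⟨_, fun y => norm_heatK_le hθ _⟩
  have hlimw : ∫ y in B, heatK θ (z - y) • w₀ y = heatT θ (B.indicator w₀) z := by
    rw [heatT_eq_integral_sub, ← integral_indicator hBm]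
    congr 1; funext y
    by_cases hy : y ∈ B <;> simp [hy]
  have hlimF : ∀ᶠ ε in (l : Filter ℝ), ∫ y in B, heatK θ (z - y) • F ε y = heatT θ (F ε) z := by
    refine hl (nhdsWithin_le_nhds ?_)
    filter_upwards [gt_mem_nhds (one_pos : (0 : ℝ) < 1)] with ε hε
    rw [heatT_eq_integral_sub]
    refine setIntegral_eq_integral_of_forall_compl_eq_zero fun y hy => ?_
    have : y ∉ S ε := by
      intro hyS
      refine hy ?_
      rw [Metric.mem_cthickening_iff,
        ENNReal.le_ofReal_iff_toReal_le (Metric.infEDist_ne_top hne) zero_le_one]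
      have h1 : Metric.infDist y E ^ 2 < ε := hyS
      change Metric.infDist y E ≤ 1
      nlinarith [Metric.infDist_nonneg (x := y) (s := E)]
    simp only [F, indicator_of_notMem this, smul_zero]
  rw [hlimw] at hk
  have hk' := hk.congr' hlimF
  have hcal : Tendsto (fun ε => caloric f (θ + ε) z) l (𝓝 (caloric f θ z)) := by
    have h1 : ContinuousAt (fun p : ℝ × Rn n => caloric f p.1 p.2) (θ + 0, z) :=
      (continuousOn_caloric hf).continuousAt
        ((isOpen_lt continuous_const continuous_fst).mem_nhds (by change 0 < θ + 0; simpa using hθ))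
    have h2 : ContinuousAt ((fun p : ℝ × Rn n => caloric f p.1 p.2) ∘ fun ε => (θ + ε, z)) 0 :=
      ContinuousAt.comp (x := (0 : ℝ)) h1 (by fun_prop)
    have h3 := h2.tendsto
    simp only [Function.comp_def, add_zero] at h3
    exact h3.mono_left (hl.trans nhdsWithin_le_nhds)
  refine le_of_tendsto ((hcal.sub hk').norm) (hl ?_)
  filter_upwards [self_mem_nhdsWithin] with ε hε
  have hε : 0 < ε := hε
  obtain ⟨C, hC⟩ := hf (heat n ε)
  have hC0 : 0 ≤ C := (norm_nonneg _).trans (hC 0)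
  have hqb : ∀ z, ‖q ε z‖ ≤ C := fun z => (norm_indicator_le_norm_self _ _).trans (hC z)
  have hdecomp : ∀ θ' > 0, ∀ z', heatT θ' (q ε) z' =
      caloric f (θ' + ε) z' - heatT θ' (F ε) z' := by
    intro θ' hθ' z'
    rw [caloric_add f hθ' hε, eq_sub_iff_add_eq]
    unfold heatT
    rw [← integral_add (integrable_heatK_smul hθ' (hqm ε) hqb z')
      (integrable_heatK_smul hθ' (hFm ε) (hFb ε) z')]
    congr 1; funext y
    rw [← smul_add]
    congr 1
    exact indicator_compl_add_self_apply (S ε) (caloric f ε) (z' - y)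
  rw [← hdecomp θ hθ z]
  refine norm_heatT_le_barrier hEc hne (hqm ε) hqb hε (fun z' hz' => ?_) (fun θ' hθ' z' hz' => ?_)
    hθ hz.le
  · have : z' ∉ (S ε)ᶜ := fun h => h hz'
    exact indicator_of_notMem this _
  · rw [hdecomp θ' hθ' z']
    refine (norm_sub_le _ _).trans ?_
    have h1 := norm_caloric_le (f := f) (z := z') (θ := θ' + ε) hne hlam hE (by linarith)
    have h2 := norm_heatT_le hθ' (hFb ε) z'
    linarith

/-- **Fatou's theorem**: a caloric extension has parabolic limits at almost every point where its
nontangential maximal function is finite. -/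
theorem ae_exists_caloric_limit (hf : IsBoundedDistribution f) :
    ∀ᵐ x, ntMax f x < ∞ → ∃ ℓ : ℂ, ∀ ε > 0, ∃ δ > 0, ∀ θ ∈ Ioo 0 δ, ∀ z, ‖z - x‖ ^ 2 < θ →
      ‖caloric f θ z - ℓ‖ ≤ ε := by
  -- Compact by lower semicontinuity; these sets exhaust the points where `ntMax f` is finite.
  let E : ℕ → Set (Rn n) := fun k => {x | ntMax f x ≤ ENNReal.ofReal k} ∩ Metric.closedBall 0 k
  have hEc : ∀ k, IsCompact (E k) := fun k =>
    (isCompact_closedBall _ _).inter_left ((lowerSemicontinuous_ntMax f).isClosed_preimage _)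
  have hmain : ∀ k : ℕ, ∀ᵐ x, x ∈ E k → ∃ ℓ : ℂ, ∀ ε > 0, ∃ δ > 0, ∀ θ ∈ Ioo 0 δ, ∀ z,
      ‖z - x‖ ^ 2 < θ → ‖caloric f θ z - ℓ‖ ≤ ε := by
    intro k
    rcases (E k).eq_empty_or_nonempty with hne | hne
    · simp [hne]
    have hk : (0 : ℝ) ≤ k := Nat.cast_nonneg k
    obtain ⟨w, hw, happ⟩ := exists_heatT_approx hf (hEc k) hne hk (fun x hx => hx.1)
    have hEm := (hEc k).measurableSet
    have hind : Integrable ((E k).indicator (1 : Rn n → ℝ)) :=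
      (integrable_indicator_iff hEm).2 (integrableOn_const (hEc k).measure_lt_top.ne)
    filter_upwards [ae_heatT_tendsto hw, ae_heatT_tendsto hind] with x hx1 hx2 hxE
    refine ⟨w x, fun ε hε => ?_⟩
    set A : ℝ := 2 * k / heatBallMass n with hA
    have hA0 : 0 ≤ A := by have := heatBallMass_pos (n := n); positivity
    obtain ⟨δ₁, hδ₁, h1⟩ := hx1 (ε / 2) (by positivity)
    obtain ⟨δ₂, hδ₂, h2⟩ := hx2 (ε / (2 * (A + 1))) (by positivity)
    refine ⟨min δ₁ δ₂, by positivity, fun θ hθ z hz => ?_⟩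
    have hθ0 := hθ.1
    have h3 := h1 θ ⟨hθ.1, hθ.2.trans_le (min_le_left _ _)⟩ z hz
    have h4 := h2 θ ⟨hθ.1, hθ.2.trans_le (min_le_right _ _)⟩ z hz
    have hdist : Metric.infDist z (E k) ^ 2 < θ := by
      refine lt_of_le_of_lt (pow_le_pow_left₀ Metric.infDist_nonneg ?_ 2) hz
      rw [← dist_eq_norm]; exact Metric.infDist_le_dist_of_mem hxE
    have h5 := happ θ hθ0 z hdist
    -- The two indicators have heat extensions of sum 1, and that of E tends to 1 at its density
    -- points.
    have h6 : heatT θ ((E k)ᶜ.indicator (1 : Rn n → ℝ)) z ≤ ε / (2 * (A + 1)) := by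
      have hsum : heatT θ ((E k)ᶜ.indicator (1 : Rn n → ℝ)) z +
          heatT θ ((E k).indicator (1 : Rn n → ℝ)) z = 1 := by
        unfold heatT
        rw [← integral_add
          (integrable_heatK_smul hθ0 (measurable_one.indicator hEm.compl).aestronglyMeasurable
            (norm_indicator_one_le _) z)
          (integrable_heatK_smul hθ0 (measurable_one.indicator hEm).aestronglyMeasurable
            (norm_indicator_one_le _) z), ← integral_heatK (n := n) hθ0]
        congr 1; funext y
        rw [← smul_add, indicator_compl_add_self_apply, Pi.one_apply, smul_eq_mul, mul_one]
      rw [indicator_of_mem hxE, Pi.one_apply, Real.norm_eq_abs] at h4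
      have := (abs_le.1 h4).1
      linarith
    calc ‖caloric f θ z - w x‖ = ‖(caloric f θ z - heatT θ w z) + (heatT θ w z - w x)‖ := by
          congr 1; ring
      _ ≤ ‖caloric f θ z - heatT θ w z‖ + ‖heatT θ w z - w x‖ := norm_add_le _ _
      _ ≤ A * (ε / (2 * (A + 1))) + ε / 2 := by
          refine add_le_add (h5.trans ?_) h3
          gcongr
      _ ≤ (A + 1) * (ε / (2 * (A + 1))) + ε / 2 := by gcongr; linarith
      _ = ε := by field_simp; norm_num
  filter_upwards [ae_all_iff.2 hmain] with x hx hfin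
  obtain ⟨k₁, hk₁⟩ := exists_nat_ge (ntMax f x).toReal
  obtain ⟨k₂, hk₂⟩ := exists_nat_ge ‖x‖
  refine hx (max k₁ k₂) ⟨?_, ?_⟩
  · change ntMax f x ≤ _
    rw [← ENNReal.ofReal_toReal hfin.ne]
    refine ENNReal.ofReal_le_ofReal (hk₁.trans ?_)
    exact_mod_cast le_max_left _ _
  · rw [mem_closedBall_zero_iff]
    refine hk₂.trans ?_
    exact_mod_cast le_max_right _ _

end Fatou

/-! ### Approximation by Poisson integrals -/

section Approximation

variable {n N : ℕ} {p : Rn n → ℝ} {p₀ : ℝ} {f g : 𝓢'(Rn n, ℂ)}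

/-- Away from time `0`, caloric extensions are uniformly Lipschitz in time. -/
theorem exists_caloric_lipschitz (hf : IsBoundedDistribution f) {δ : ℝ} (hδ : 0 < δ) :
    ∃ C : ℝ, 0 ≤ C ∧ ∀ θ, δ < θ → ∀ ρ > 0, ∀ z,
      ‖caloric f (θ + ρ) z - caloric f θ z‖ ≤ C * ρ := by
  obtain ⟨C, hC⟩ := hf (Laplacian.laplacian (heat n δ))
  have hC0 : 0 ≤ C := (norm_nonneg _).trans (hC 0)
  refine ⟨‖(4⁻¹ : ℂ)‖ * C, by positivity, fun θ hθ ρ hρ z => ?_⟩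
  -- A fixed time δ is reserved for h_δ, whose Laplacian gives a bounded convolution with f; the
  -- remaining heat flow is a contraction.
  have h := (convex_Ioi (0 : ℝ)).norm_image_sub_le_of_norm_hasDerivWithin_le
    (f := fun s => conv f (sconv (heat n s) (heat n δ)) z)
    (f' := fun s => 4⁻¹ * conv f (sconv (heat n s) (Laplacian.laplacian (heat n δ))) z)
    (C := ‖(4⁻¹ : ℂ)‖ * C)
    (fun s hs => (hasDerivAt_conv_sconv_heat hf _ hs z).hasDerivWithinAt)
    (fun s hs => by
      rw [norm_mul, conv_sconv_heat f _ hs]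
      exact mul_le_mul_of_nonneg_left (norm_heatT_le hs hC z) (norm_nonneg _))
    (x := θ - δ) (y := θ - δ + ρ) (sub_pos.2 hθ) (by change 0 < θ - δ + ρ; linarith)
  rw [sconv_heat (by linarith) hδ, sconv_heat (by linarith) hδ, add_sub_cancel_left,
    Real.norm_of_nonneg hρ.le, sub_add_cancel, show θ - δ + ρ + δ = θ + ρ by ring] at h
  exact h

/-- A small delay ρ changes U little, uniformly over the whole cone: at early times both values are
near the limit ℓ, at later times U is Lipschitz in time. -/
theorem exists_caloric_sub_le (hf : IsBoundedDistribution f) {x : Rn n} {ℓ : ℂ}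
    (hx : ∀ ε > 0, ∃ δ > 0, ∀ θ ∈ Ioo 0 δ, ∀ z, ‖z - x‖ ^ 2 < θ → ‖caloric f θ z - ℓ‖ ≤ ε)
    {ε : ℝ} (hε : 0 < ε) :
    ∃ r > 0, ∀ ρ ∈ Ioo 0 r, ∀ θ z, ‖z - x‖ ^ 2 < θ →
      ‖caloric f (ρ + θ) z - caloric f θ z‖ ≤ ε := by
  obtain ⟨δ, hδ, h⟩ := hx (ε / 2) (by positivity)
  obtain ⟨C, hC0, hC⟩ := exists_caloric_lipschitz hf (by positivity : 0 < δ / 4)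
  refine ⟨min (δ / 2) (ε / (C + 1)), by positivity, fun ρ hρ θ z hz => ?_⟩
  have hθ : 0 < θ := (sq_nonneg _).trans_lt hz
  have hρ0 := hρ.1
  have hρ1 : ρ < δ / 2 := hρ.2.trans_le (min_le_left _ _)
  have hρ2 : ρ < ε / (C + 1) := hρ.2.trans_le (min_le_right _ _)
  rcases lt_or_ge θ (δ / 2) with hlt | hge
  · have h1 := h (ρ + θ) ⟨by linarith, by linarith⟩ z (by linarith)
    have h2 := h θ ⟨hθ, by linarith⟩ z hz
    calc _ = ‖(caloric f (ρ + θ) z - ℓ) - (caloric f θ z - ℓ)‖ := by congr 1; ring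
      _ ≤ _ := norm_sub_le _ _
      _ ≤ ε := by linarith
  · rw [add_comm ρ]
    refine (hC θ (by linarith) ρ hρ0 z).trans ?_
    rw [lt_div_iff₀ (by positivity)] at hρ2
    nlinarith

theorem integrable_caloric_subord (hf : IsBoundedDistribution f) {t θ : ℝ} (ht : 0 < t)
    (hθ : 0 < θ) (z : Rn n) : Integrable (fun η => caloric f (t ^ 2 / η + θ) z) subord := by
  obtain ⟨C, hC⟩ := hf (heat n θ)
  refine Integrable.of_bound (C := C) ?_ ?_
  · rw [← restrict_subord]
    refine ContinuousOn.aestronglyMeasurable ?_ measurableSet_Ioi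
    refine (continuousOn_caloric hf).comp (f := fun η : ℝ => (t ^ 2 / η + θ, z)) ?_ ?_
    · refine ContinuousOn.prodMk (ContinuousOn.add
        (ContinuousOn.div (by fun_prop) (by fun_prop) ?_) (by fun_prop)) (by fun_prop)
      exact fun q hq => (ne_of_gt hq)
    · intro η (hη : 0 < η)
      change 0 < t ^ 2 / η + θ
      positivity
  · filter_upwards [ae_subord_pos] with η hη
    rw [caloric_add f (by positivity) hθ]
    exact norm_heatT_le (by positivity) hC z

theorem ntMax_sub_le (f g : 𝓢'(Rn n, ℂ)) (x : Rn n) : ntMax (f - g) x ≤ ntMax f x + ntMax g x := by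
  refine ntMax_le fun θ z hz => ?_
  rw [caloric_sub]
  exact (enorm_sub_le).trans (add_le_add (le_ntMax f hz) (le_ntMax g hz))

/-- Delays t²/η below r cost ε. A delay of at least r forces η ≤ t²/r ≤ s, an event of small
probability on which 2 `ntMax f` suffices. -/
theorem ntMax_poisson_sub_le {t : ℝ} (ht : 0 < t) (h : IsConvL1 f (poissonT t) g) {x : Rn n}
    {ε r s : ℝ} (hr : 0 < r)
    (hsub : ∀ ρ ∈ Ioo 0 r, ∀ θ z, ‖z - x‖ ^ 2 < θ →
      ‖caloric f (ρ + θ) z - caloric f θ z‖ ≤ ε) (hts : t ^ 2 ≤ r * s) :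
    ntMax (g - f) x ≤ ENNReal.ofReal ε + 2 * ntMax f x * subord (Icc (0 - s) (0 + s)) := by
  refine ntMax_le fun θ z hz => ?_
  have hθ : 0 < θ := (sq_nonneg _).trans_lt hz
  have h1 : caloric (g - f) θ z =
      ∫ η, (caloric f (t ^ 2 / η + θ) z - caloric f θ z) ∂subord := by
    rw [caloric_sub, caloric_eq_of_isConvL1 ht h hθ,
      integral_sub (integrable_caloric_subord h.bounded ht hθ z) (integrable_const _)]
    simp
  rw [h1]
  refine (enorm_integral_le_lintegral_enorm _).trans ?_
  calc ∫⁻ η, ‖caloric f (t ^ 2 / η + θ) z - caloric f θ z‖ₑ ∂subord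
      ≤ ∫⁻ η, (ENNReal.ofReal ε +
          (Icc (0 - s) (0 + s)).indicator (fun _ => 2 * ntMax f x) η) ∂subord := by
        refine lintegral_mono_ae ?_
        filter_upwards [ae_subord_pos] with η hη
        have hpos : 0 < t ^ 2 / η := by positivity
        rcases lt_or_ge (t ^ 2 / η) r with hlt | hge
        · refine le_add_right ?_
          rw [← ofReal_norm]
          exact ENNReal.ofReal_le_ofReal (hsub _ ⟨hpos, hlt⟩ θ z hz)
        · have hηs : η ≤ s := by
            rw [le_div_iff₀ hη] at hge
            exact le_of_mul_le_mul_left (hge.trans hts) hr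
          rw [indicator_of_mem (show η ∈ Icc (0 - s) (0 + s) from ⟨by linarith, by linarith⟩)]
          refine le_add_left ((enorm_sub_le).trans ?_)
          rw [two_mul]
          exact add_le_add (le_ntMax f (by linarith)) (le_ntMax f hz)
    _ = _ := by
        rw [lintegral_add_left measurable_const, lintegral_const, measure_univ, mul_one,
          lintegral_indicator measurableSet_Icc, setLIntegral_const]

/-- First r is fixed by the parabolic limit, then s by the absence of an atom of `subord` at 0, and
finally t with t² < rs. -/
theorem tendsto_ntMax_poisson_sub {u : ℝ → 𝓢'(Rn n, ℂ)}
    (hu : ∀ t, 0 < t → IsConvL1 f (poissonT t) (u t)) {x : Rn n} (hfin : ntMax f x < ∞) {ℓ : ℂ}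
    (hx : ∀ ε > 0, ∃ δ > 0, ∀ θ ∈ Ioo 0 δ, ∀ z, ‖z - x‖ ^ 2 < θ → ‖caloric f θ z - ℓ‖ ≤ ε) :
    Tendsto (fun t => ntMax (u t - f) x) (𝓝[>] 0) (𝓝 0) := by
  have hf : IsBoundedDistribution f := (hu 1 one_pos).bounded
  have h0 : subord {(0 : ℝ)} = 0 :=
    measure_mono_null (fun η (hη : η = 0) => by simp [hη]) (ae_iff.1 ae_subord_pos)
  have htail : Tendsto (fun s : ℝ => 2 * ntMax f x * subord (Icc (0 - s) (0 + s))) (𝓝[>] 0)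
      (𝓝 0) := by
    have h1 := ENNReal.Tendsto.const_mul (a := 2 * ntMax f x)
      (tendsto_measure_Icc_nhdsWithin_right' subord (0 : ℝ))
      (Or.inr (ENNReal.mul_lt_top (by simp) hfin).ne)
    rwa [h0, mul_zero] at h1
  rw [ENNReal.tendsto_nhds_zero]
  intro ε hε
  obtain ⟨e, he, heε⟩ : ∃ e : ℝ, 0 < e ∧ ENNReal.ofReal e ≤ ε / 2 := by
    rcases eq_or_ne ε ∞ with rfl | hεt
    · exact ⟨1, one_pos, by simp [ENNReal.top_div]⟩
    · have h2 : ε / 2 ≠ ∞ := (ENNReal.div_lt_top hεt two_ne_zero).ne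
      exact ⟨(ε / 2).toReal, ENNReal.toReal_pos (ENNReal.half_pos hε.ne').ne' h2,
        ENNReal.ofReal_toReal_le⟩
  obtain ⟨r, hr, hsub⟩ := exists_caloric_sub_le hf hx he
  obtain ⟨s, hs1, hs⟩ := ((ENNReal.tendsto_nhds_zero.1 htail (ε / 2) (ENNReal.half_pos hε.ne')).and
    self_mem_nhdsWithin).exists
  have hs : 0 < s := hs
  have hev : ∀ᶠ t : ℝ in 𝓝[>] 0, t ^ 2 < r * s := by
    refine nhdsWithin_le_nhds ((continuous_pow 2).tendsto (0 : ℝ) (gt_mem_nhds ?_))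
    rw [zero_pow two_ne_zero]; positivity
  filter_upwards [hev, self_mem_nhdsWithin] with t ht1 ht
  calc _ ≤ _ := ntMax_poisson_sub_le ht (hu t ht) hr hsub ht1.le
    _ ≤ ε / 2 + ε / 2 := add_le_add heε hs1
    _ = ε := ENNReal.add_halves ε

/-- A change of scale multiplies the integrand by at most max(1, Cc)^{p₊}; here p₊ < ∞ is essential.
This supplies the dominating function at every scale. -/
theorem lintegral_rpow_ne_top_of_luxNorm_lt_top (hp : MemP0 p) {h : Rn n → ℝ≥0∞}
    (hh : luxNorm p h < ∞) {C : ℝ} (hC : 0 < C) :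
    ∫⁻ x, (ENNReal.ofReal C * h x) ^ p x ≠ ∞ := by
  obtain ⟨c, hc, -, hm⟩ := exists_modular_le_one hh
  have hP : ∀ᵐ x, p x ≤ (pPlus p).toReal := by
    filter_upwards [ENNReal.ae_le_essSup fun x => ENNReal.ofReal (p x)] with x hx
    exact (ENNReal.ofReal_le_iff_le_toReal hp.pPlus_lt_top.ne).1 hx
  set D : ℝ≥0∞ := ENNReal.ofReal (max 1 (C * c)) ^ (pPlus p).toReal with hD
  have hDt : D ≠ ∞ := ENNReal.rpow_ne_top_of_nonneg ENNReal.toReal_nonneg ENNReal.ofReal_ne_top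
  have hle : ∫⁻ x, (ENNReal.ofReal C * h x) ^ p x ≤
      ∫⁻ x, D * (h x / ENNReal.ofReal c) ^ p x := by
    refine lintegral_mono_ae ?_
    filter_upwards [hP] with x hx
    have h1 : ENNReal.ofReal C * h x = ENNReal.ofReal (C * c) * (h x / ENNReal.ofReal c) := by
      rw [ENNReal.ofReal_mul hC.le, mul_assoc, ENNReal.mul_div_cancel
        (ENNReal.ofReal_pos.2 hc).ne' ENNReal.ofReal_ne_top]
    rw [h1, ENNReal.mul_rpow_of_nonneg _ _ (hp.pos x).le]
    refine mul_le_mul' ?_ le_rfl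
    calc ENNReal.ofReal (C * c) ^ p x ≤ ENNReal.ofReal (max 1 (C * c)) ^ p x :=
          ENNReal.rpow_le_rpow (ENNReal.ofReal_le_ofReal (le_max_right _ _)) (hp.pos x).le
      _ ≤ D := by
          refine ENNReal.rpow_le_rpow_of_exponent_le ?_ hx
          rw [← ENNReal.ofReal_one]
          exact ENNReal.ofReal_le_ofReal (le_max_left _ _)
  refine (hle.trans_lt ?_).ne
  rw [lintegral_const_mul' _ _ hDt]
  exact ENNReal.mul_lt_top hDt.lt_top (hm.trans_lt ENNReal.one_lt_top)

theorem tendsto_hpNorm_poisson_sub (hn : 1 ≤ n) (hp : MemP0 p) (hp₀ : IsMP0Index p p₀)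
    (hN : (n : ℝ) / p₀ + n + 1 < N) (hf : f ∈ Hp p N) {u : ℝ → 𝓢'(Rn n, ℂ)}
    (hu : ∀ t, 0 < t → IsConvL1 f (poissonT t) (u t)) :
    Tendsto (fun t => hpNorm p N (u t - f)) (𝓝[>] 0) (𝓝 0) := by
  have hbd := isBoundedDistribution_of_mem_Hp hp₀ hf
  have hlux := luxNorm_ntMax_lt_top hp hf
  have hfin := ae_lt_top_of_luxNorm_lt_top hp (measurable_ntMax f).aemeasurable hlux
  have hdom : ∀ t, 0 < t → ∀ x, ntMax (u t - f) x ≤ ENNReal.ofReal 2 * ntMax f x := by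
    intro t ht x
    refine (ntMax_sub_le _ _ x).trans ?_
    rw [ENNReal.ofReal_ofNat, two_mul]
    exact add_le_add (ntMax_le_of_isConvL1 ht (hu t ht) x) le_rfl
  have hlim : Tendsto (fun t => luxNorm p (ntMax (u t - f))) (𝓝[>] 0) (𝓝 0) := by
    refine tendsto_luxNorm_zero fun c hc => ?_
    have h0 : (0 : ℝ≥0∞) = ∫⁻ x : Rn n, 0 := by simp
    unfold modular
    rw [h0]
    refine tendsto_lintegral_filter_of_dominated_convergence'
      (fun x => (ENNReal.ofReal (2 / c) * ntMax f x) ^ p x) ?_ ?_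
      (lintegral_rpow_ne_top_of_luxNorm_lt_top hp hlux (by positivity)) ?_
    · exact Eventually.of_forall fun t =>
        ((measurable_ntMax _).div_const _).aemeasurable.pow hp.aemeasurable
    · filter_upwards [self_mem_nhdsWithin] with t ht
      refine Eventually.of_forall fun x => ENNReal.rpow_le_rpow ?_ (hp.pos x).le
      rw [ENNReal.ofReal_div_of_pos hc, ENNReal.mul_div_right_comm.symm]
      exact ENNReal.div_le_div_right (hdom t ht x) _
    -- Pointwise convergence comes from Fatou's theorem.
    · filter_upwards [hfin, ae_exists_caloric_limit hbd] with x hx1 hx2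
      obtain ⟨ℓ, hℓ⟩ := hx2 hx1
      have h1 := ENNReal.Tendsto.div_const (tendsto_ntMax_poisson_sub hu hx1 hℓ)
        (b := ENNReal.ofReal c) (Or.inr (ENNReal.ofReal_pos.2 hc).ne')
      have h2 := h1.ennrpow_const (p x)
      rwa [ENNReal.zero_div, ENNReal.zero_rpow_of_pos (hp.pos x)] at h2
  obtain ⟨C, hC, hle⟩ := exists_hpNorm_le_luxNorm_ntMax hn hp hp₀ hN
  have hlim' := ENNReal.Tendsto.const_mul (a := C) hlim (Or.inr hC)
  rw [mul_zero] at hlim'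
  refine tendsto_of_tendsto_of_tendsto_of_le_of_le' tendsto_const_nhds hlim'
    (Eventually.of_forall fun _ => zero_le) ?_
  filter_upwards [self_mem_nhdsWithin] with t ht
  refine hle _ (fun Ψ => ?_) ?_
  · obtain ⟨A, hA⟩ := isBoundedDistribution_of_isConvL1 ht (hu t ht) Ψ
    obtain ⟨B, hB⟩ := hbd Ψ
    exact ⟨A + B, fun x => (norm_sub_le _ _).trans (add_le_add (hA x) (hB x))⟩
  · refine (luxNorm_mono_ae hp.pos (Eventually.of_forall (hdom t ht))).trans_lt ?_
    exact (luxNorm_const_mul_le two_pos _).trans_lt (ENNReal.mul_lt_top ENNReal.ofReal_lt_top hlux)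

theorem hpNorm_sub_comm (f g : 𝓢'(Rn n, ℂ)) : hpNorm p N (f - g) = hpNorm p N (g - f) := by
  have h : ∀ Φ x, ‖conv (f - g) Φ x‖ₑ = ‖conv (g - f) Φ x‖ₑ := fun Φ x => by
    rw [← enorm_neg]
    congr 1
    exact neg_sub _ _
  have h2 : grandMaximal N (f - g) = grandMaximal N (g - f) := by
    funext x
    simp only [grandMaximal, radialMaximal, h]
  rw [hpNorm, hpNorm, h2]

end Approximation

end

end VarHardy

/-! ### Density of the locally integrable distributions -/

theorem proposition4p2 {n : ℕ} (hn : 1 ≤ n) (p : VarHardy.Rn n → ℝ) (hp : VarHardy.MemMP0 p)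
    (p₀ : ℝ) (hp₀ : VarHardy.IsMP0Index p p₀)
    (N : ℕ) (hN : (n : ℝ) / p₀ + n + 1 < N) :
    (∀ f ∈ VarHardy.Hp p N, ∀ ε : ℝ≥0∞, 0 < ε →
      ∃ g ∈ VarHardy.Hp p N ∩ VarHardy.L1loc n, VarHardy.hpNorm p N (f - g) < ε) ∧
    (∀ f ∈ VarHardy.Hp p N, VarHardy.IsBoundedDistribution f ∧
      ∃ u : ℝ → 𝓢'(VarHardy.Rn n, ℂ),
        (∀ t, 0 < t → VarHardy.IsConvL1 f (VarHardy.poissonT t) (u t) ∧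
          u t ∈ VarHardy.Hp p N ∩ VarHardy.L1loc n) ∧
        Tendsto (fun t => VarHardy.hpNorm p N (u t - f)) (𝓝[>] 0) (𝓝 0)) := by

  have key : ∀ f ∈ VarHardy.Hp p N, VarHardy.IsBoundedDistribution f ∧
      ∃ u : ℝ → 𝓢'(VarHardy.Rn n, ℂ),
        (∀ t, 0 < t → VarHardy.IsConvL1 f (VarHardy.poissonT t) (u t) ∧
          u t ∈ VarHardy.Hp p N ∩ VarHardy.L1loc n) ∧
        Tendsto (fun t => VarHardy.hpNorm p N (u t - f)) (𝓝[>] 0) (𝓝 0) := by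
    intro f hf
    obtain ⟨A, hA, hbound⟩ := VarHardy.exists_conv_le_of_mem_Hp hp₀ hf
    have hex : ∀ t : ℝ, ∃ g : 𝓢'(VarHardy.Rn n, ℂ),
        0 < t → VarHardy.IsConvL1 f (VarHardy.poissonT t) g := by
      intro t
      -- The family must be defined for every real t; the value 0 at t ≤ 0 plays no role in the
      -- limit from the right.
      by_cases ht : 0 < t
      · obtain ⟨g, hg⟩ := VarHardy.exists_isConvL1 hA.le hbound (VarHardy.integrable_poissonT ht)
        exact ⟨g, fun _ => hg⟩
      · exact ⟨0, fun h => absurd h ht⟩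
    choose u hu using hex
    refine ⟨VarHardy.isBoundedDistribution_of_mem_Hp hp₀ hf, u, fun t ht => ⟨hu t ht, ?_, ?_⟩, ?_⟩
    · exact VarHardy.mem_Hp_of_isConvL1 hn hp.memP0 hp₀ hN hf ht (hu t ht)
    · exact VarHardy.mem_L1loc_of_isConvL1 hp₀ hf ht (hu t ht)
    · exact VarHardy.tendsto_hpNorm_poisson_sub hn hp.memP0 hp₀ hN hf hu
  refine ⟨fun f hf ε hε => ?_, key⟩
  obtain ⟨-, u, hu, hlim⟩ := key f hf
  obtain ⟨t, hlt, ht⟩ := (((tendsto_order.1 hlim).2 ε hε).and self_mem_nhdsWithin).exists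
  refine ⟨u t, (hu t ht).2, ?_⟩
  rwa [VarHardy.hpNorm_sub_comm]
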